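/- Proposition. Let $M$ be a compact connected smooth manifold (Hausdorff, without boundary) of dimension $n\ge 2$, let $g$ be a smooth Lorentzian metric on $M$, and let $\mathrm{Iso}(M,g)$ be the group of smooth isometries of $(M,g)$ with the compact-open topology. Let $K$ be a Killing vector field on $(M,g)$, i.e. a smooth vector field whose flow acts by isometries, such that - $K$ is closed, i.e. the one-parameter group of isometries generated by $K$ is a closed subset of $\mathrm{Iso}(M,g)$; - $K$ vanishes nowhere; - $K$ is timelike somewhere, i.e. $g(K_p,K_p)<0$ for some $p\in M$. Let $M_0$ be the orbit space of the action on $M$ of the one-parameter group generated by $K$ (an $\mathbb S^1$-action), and let $\pi:M\to M_0$ be the canonical projection. Then the group $\mathrm{Iso}(M,g;\pi)$ of all isometries of $(M,g)$ that preserve the fibration, i.e. that map each fibre of $\pi$ onto a fibre of $\pi$, is compact. -/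

import Mathlib

open scoped Manifold ContDiff

noncomputable section

namespace LorentzFibration

/-- A smooth Lorentzian metric on an `n`-dimensional smooth manifold without boundary: a smooth
field of symmetric bilinear forms of signature `(-, +, …, +)` on the tangent spaces. -/
structure LorentzMetric (n : ℕ) (M : Type*) [TopologicalSpace M]
    [ChartedSpace (EuclideanSpace ℝ (Fin n)) M] [IsManifold (𝓡 n) ∞ M] where
  /-- The bilinear form on the tangent space at `p`. -/
  form (p : M) : TangentSpace (𝓡 n) p →L[ℝ] TangentSpace (𝓡 n) p →L[ℝ] ℝ
  symm (p : M) (v w : TangentSpace (𝓡 n) p) : form p v w = form p w v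
  /-- Every tangent space has an orthonormal basis with exactly one timelike vector. -/
  signature (p : M) : ∃ (b : Module.Basis (Fin n) ℝ (TangentSpace (𝓡 n) p)) (i₀ : Fin n),
    ∀ i j, form p (b i) (b j) = if i = j then (if i = i₀ then -1 else 1) else 0
  contMDiff : ContMDiff (𝓡 n)
    ((𝓡 n).prod 𝓘(ℝ, EuclideanSpace ℝ (Fin n) →L[ℝ] EuclideanSpace ℝ (Fin n) →L[ℝ] ℝ)) ∞
    (fun p ↦ Bundle.TotalSpace.mk'
      (EuclideanSpace ℝ (Fin n) →L[ℝ] EuclideanSpace ℝ (Fin n) →L[ℝ] ℝ)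
      (E := fun p : M ↦ TangentSpace (𝓡 n) p →L[ℝ] TangentSpace (𝓡 n) p →L[ℝ] ℝ) p (form p))

variable {n : ℕ} {M : Type*} [TopologicalSpace M]
  [ChartedSpace (EuclideanSpace ℝ (Fin n)) M] [IsManifold (𝓡 n) ∞ M]

/-- The isometry group `Iso(M, g)`: smooth diffeomorphisms of `M` whose differential preserves
`g`. -/
def isometryGroup (g : LorentzMetric n M) : Subgroup (M ≃ₜ M) where
  carrier := {Φ | ContMDiff (𝓡 n) (𝓡 n) ∞ (Φ : M → M) ∧
    ContMDiff (𝓡 n) (𝓡 n) ∞ (Φ.symm : M → M) ∧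
    ∀ (p : M) (v w : TangentSpace (𝓡 n) p),
      g.form (Φ p) (mfderiv (𝓡 n) (𝓡 n) Φ p v) (mfderiv (𝓡 n) (𝓡 n) Φ p w) = g.form p v w}
  mul_mem' := by
    rintro Φ Ψ ⟨hΦ, hΦ', hΦg⟩ ⟨hΨ, hΨ', hΨg⟩
    refine ⟨hΦ.comp hΨ, hΨ'.comp hΦ', fun p v w ↦ ?_⟩
    have h : mfderiv (𝓡 n) (𝓡 n) (Φ ∘ Ψ) p =
        (mfderiv (𝓡 n) (𝓡 n) Φ (Ψ p)).comp (mfderiv (𝓡 n) (𝓡 n) Ψ p) :=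
      mfderiv_comp p (hΦ.mdifferentiable (by simp) _) (hΨ.mdifferentiable (by simp) _)
    change g.form (Φ (Ψ p)) (mfderiv (𝓡 n) (𝓡 n) (Φ ∘ Ψ) p v)
      (mfderiv (𝓡 n) (𝓡 n) (Φ ∘ Ψ) p w) = _
    rw [h]
    exact (hΦg (Ψ p) _ _).trans (hΨg p v w)
  one_mem' := by
    refine ⟨contMDiff_id, contMDiff_id, fun p v w ↦ ?_⟩
    change g.form p (mfderiv (𝓡 n) (𝓡 n) id p v) (mfderiv (𝓡 n) (𝓡 n) id p w) = _
    rw [mfderiv_id]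
    rfl
  inv_mem' := by
    rintro Φ ⟨hΦ, hΦ', hΦg⟩
    refine ⟨hΦ', hΦ, fun p v w ↦ ?_⟩
    have h : (mfderiv (𝓡 n) (𝓡 n) Φ (Φ.symm p)).comp (mfderiv (𝓡 n) (𝓡 n) Φ.symm p) =
        ContinuousLinearMap.id ℝ (TangentSpace (𝓡 n) p) := by
      have h1 := mfderiv_comp p (hΦ.mdifferentiable (by simp) (Φ.symm p))
        (hΦ'.mdifferentiable (by simp) p)
      have h2 : (Φ : M → M) ∘ (Φ.symm : M → M) = id := by
        ext x
        simp
      rw [h2, mfderiv_id] at h1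
      exact h1.symm
    have h3 := hΦg (Φ.symm p) (mfderiv (𝓡 n) (𝓡 n) Φ.symm p v)
      (mfderiv (𝓡 n) (𝓡 n) Φ.symm p w)
    have hv : ∀ u : TangentSpace (𝓡 n) p, mfderiv (𝓡 n) (𝓡 n) Φ (Φ.symm p)
        (mfderiv (𝓡 n) (𝓡 n) Φ.symm p u) = u := fun u ↦ DFunLike.congr_fun h u
    have h4 : ∀ q : M, q = p → ∀ a b : EuclideanSpace ℝ (Fin n),
        g.form q (show TangentSpace (𝓡 n) q from a) (show TangentSpace (𝓡 n) q from b) =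
        g.form p (show TangentSpace (𝓡 n) p from a) (show TangentSpace (𝓡 n) p from b) := by
      rintro q rfl a b
      rfl
    change g.form (Φ.symm p) (mfderiv (𝓡 n) (𝓡 n) Φ.symm p v)
      (mfderiv (𝓡 n) (𝓡 n) Φ.symm p w) = _
    rw [← h3]
    refine (h4 _ (Φ.apply_symm_apply p) _ _).trans ?_
    exact congrArg₂ (fun a b ↦ g.form p a b) (hv v) (hv w)

/-- `Iso(M, g)` carries the compact-open topology. -/
instance (g : LorentzMetric n M) : TopologicalSpace (isometryGroup g) :=
  TopologicalSpace.induced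
    (fun Φ : isometryGroup g ↦ (⟨Φ.1, Φ.1.continuous⟩ : C(M, M))) inferInstance

/-- `φ` is the (smooth, globally defined) flow of the vector field `K`. -/
structure IsFlowOf (φ : Flow ℝ M) (K : (p : M) → TangentSpace (𝓡 n) p) : Prop where
  contMDiff : ContMDiff (𝓘(ℝ, ℝ).prod (𝓡 n)) (𝓡 n) ∞ (fun x : ℝ × M ↦ φ x.1 x.2)
  isMIntegralCurve (p : M) : IsMIntegralCurve (I := 𝓡 n) (fun t : ℝ ↦ φ t p) K

/-- A Killing vector field on a compact manifold: a smooth vector field whose flow (which is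
globally defined, by compactness) acts by isometries. -/
def IsKilling [CompactSpace M] (g : LorentzMetric n M)
    (K : (p : M) → TangentSpace (𝓡 n) p) : Prop :=
  ContMDiff (𝓡 n) (𝓡 n).tangent ∞
    (fun p ↦ (Bundle.TotalSpace.mk p (K p) : TangentBundle (𝓡 n) M)) ∧
  ∃ φ : Flow ℝ M, IsFlowOf φ K ∧ ∀ t : ℝ, ∃ Φ : isometryGroup g, ∀ p, Φ.1 p = φ t p

/-- The one-parameter group of isometries generated by `K`, as a subset of `Iso(M, g)`. -/
def oneParameterGroup (g : LorentzMetric n M) (K : (p : M) → TangentSpace (𝓡 n) p) :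
    Set (isometryGroup g) :=
  {Φ | ∃ φ : Flow ℝ M, IsFlowOf φ K ∧ ∃ t : ℝ, ∀ p, Φ.1 p = φ t p}

/-- A Killing field is closed if the one-parameter group of isometries that it generates is a
closed subset of `Iso(M, g)`. -/
def IsClosedKilling [CompactSpace M] (g : LorentzMetric n M)
    (K : (p : M) → TangentSpace (𝓡 n) p) : Prop :=
  IsKilling g K ∧ IsClosed (oneParameterGroup g K)

/-- The orbit space of the action on `M` of the one-parameter group generated by `K`. -/
def OrbitSpace (g : LorentzMetric n M) (K : (p : M) → TangentSpace (𝓡 n) p) : Type _ :=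
  Quot (fun p q : M ↦ ∃ Φ ∈ oneParameterGroup g K, Φ.1 p = q)

/-- The canonical projection of `M` onto the orbit space; its fibres are the orbits. -/
def orbitProj (g : LorentzMetric n M) (K : (p : M) → TangentSpace (𝓡 n) p) :
    M → OrbitSpace g K :=
  Quot.mk _

/-- `Iso(M, g; π)`: the isometries that preserve the fibration of `M` by the fibres of `π`, that
is, that map every fibre of `π` onto a fibre of `π`. -/
def fibrationIsometryGroup (g : LorentzMetric n M) {B : Type*} (π : M → B) :
    Subgroup (isometryGroup g) where
  carrier := {Φ | ∀ p q : M, π (Φ.1 p) = π (Φ.1 q) ↔ π p = π q}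
  mul_mem' := by
    intro Φ Ψ hΦ hΨ p q
    exact (hΦ (Ψ.1 p) (Ψ.1 q)).trans (hΨ p q)
  one_mem' := fun _ _ ↦ Iff.rfl
  inv_mem' := by
    intro Φ hΦ p q
    have h := hΦ (Φ.1.symm p) (Φ.1.symm q)
    simp only [Homeomorph.apply_symm_apply] at h
    exact h.symm

end LorentzFibration

end

/-! Let `φ` be the flow of `K`. An isometry `Φ` that permutes the orbits conjugates `φ` to a flow by
isometries with the same orbits, whose generator has the form `f K`. Since `K` and `f K` are both
Killing, `df ⊗ K♭ + K♭ ⊗ df = 0`, so `f` is a constant `c` and `Φ` pushes `K` to `c K`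
(`exists_vel_eq_smul`). The function `h = g(K, K)` then satisfies `h = c² (h ∘ Φ)`. It attains a
negative minimum on the compact manifold, and comparing values at a minimum point `p₀`, at its image
and at its preimage gives `c² = 1` (`sq_eq_one_of_mder_vel`). Hence every `Φ` in the group preserves
the compact set where `h = h(p₀)`. There `K` is timelike, and `Φ` preserves the positive definite
form `g - (2 / h) K♭ ⊗ K♭`, so the differentials at `p₀` are uniformly bounded
(`IsIsometricFlow.jetsBounded`).

The rest is rigidity of isometries. By Koszul's formula the second derivative of an isometry is a
smooth function of its one-jet, so a bound on one-jets at one point spreads to a neighbourhood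
(`exists_propagation`, `exists_jets_uniform`) and, by connectedness, to all of `M`. The group is
then equicontinuous; Arzelà–Ascoli provides uniform limits of the maps and of their inverses, and
the second-order equation makes these limits smooth isometries (`limit_isometric`). A closed group
with bounded one-jets at one point is therefore compact (`isCompact_of_jetsBounded`).

Closedness again uses `c = ±1`: the group is the union of the two closed sets of isometries with `Φ
∘ φ_t = φ_t ∘ Φ`, respectively `Φ ∘ φ_t = φ_{-t} ∘ Φ`. -/

open scoped Manifold ContDiff

noncomputable section

namespace LorentzFibration

open Set Filter Topology Metric

set_option maxSynthPendingDepth 3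

/-! ### The second derivative of an isometry as a function of its one-jet. -/

section Local

variable {E : Type*} [NormedAddCommGroup E] [NormedSpace ℝ E]

/-- The pull-back of a trilinear form by a linear map. -/
def pullTri (B : E →L[ℝ] E →L[ℝ] E →L[ℝ] ℝ) (L : E →L[ℝ] E) : E →L[ℝ] E →L[ℝ] E →L[ℝ] ℝ :=
  (ContinuousLinearMap.compL ℝ E (E →L[ℝ] ℝ) (E →L[ℝ] ℝ)
    ((ContinuousLinearMap.compL ℝ E E ℝ).flip L)).comp
    (((ContinuousLinearMap.compL ℝ E E (E →L[ℝ] ℝ)).flip L).comp (B.comp L))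

@[simp]
theorem pullTri_apply (B : E →L[ℝ] E →L[ℝ] E →L[ℝ] ℝ) (L : E →L[ℝ] E) (u v w : E) :
    pullTri B L u v w = B (L u) (L v) (L w) := rfl

/-- The trilinear form `S` with `T u v w = S u v w + S u w v` that is symmetric in its first two
arguments (the algebra behind Koszul's formula). -/
def koszul (T : E →L[ℝ] E →L[ℝ] E →L[ℝ] ℝ) : E →L[ℝ] E →L[ℝ] E →L[ℝ] ℝ :=
  (1 / 2 : ℝ) • (T + T.flip -
    ((ContinuousLinearMap.flipₗᵢ ℝ E E ℝ).toContinuousLinearEquiv :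
      (E →L[ℝ] E →L[ℝ] ℝ) →L[ℝ] (E →L[ℝ] E →L[ℝ] ℝ)).comp T.flip)

theorem koszul_apply (T : E →L[ℝ] E →L[ℝ] E →L[ℝ] ℝ) (u v w : E) :
    koszul T u v w = (1 / 2) * (T u v w + T v u w - T w u v) := rfl

/-- The second derivative at `x` of an isometry from the metric `G₁` to the metric `G₂`, expressed
by `A = G₁ x`, by the derivatives `A'` of `G₁` at `x` and `B'` of `G₂` at the image of `x`, and by
the derivative `L` of the isometry at `x`. -/
def accel (A : E →L[ℝ] E →L[ℝ] ℝ) (A' B' : E →L[ℝ] E →L[ℝ] E →L[ℝ] ℝ) (L : E →L[ℝ] E) :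
    E →L[ℝ] E →L[ℝ] E :=
  (ContinuousLinearMap.compL ℝ E (E →L[ℝ] ℝ) E (L.comp A.inverse)).comp (koszul (A' - pullTri B' L))

theorem accel_apply (A : E →L[ℝ] E →L[ℝ] ℝ) (A' B' : E →L[ℝ] E →L[ℝ] E →L[ℝ] ℝ) (L : E →L[ℝ] E)
    (u v : E) : accel A A' B' L u v = L (A.inverse (koszul (A' - pullTri B' L) u v)) := rfl

/-- A smooth field of symmetric nondegenerate bilinear forms on `U`. -/
structure IsMetricOn (G : E → E →L[ℝ] E →L[ℝ] ℝ) (U : Set E) : Prop where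
  isOpen : IsOpen U
  contDiffOn : ContDiffOn ℝ ∞ G U
  symm : ∀ x ∈ U, ∀ v w, G x v w = G x w v
  nondeg : ∀ x ∈ U, (G x).IsInvertible

theorem IsMetricOn.eq_zero {G : E → E →L[ℝ] E →L[ℝ] ℝ} {U : Set E} (hG : IsMetricOn G U) {x : E}
    (hx : x ∈ U) {v : E} (hv : ∀ w, G x v w = 0) : v = 0 := by
  have h : G x v = G x 0 := by ext w; simp [hv w]
  exact (hG.nondeg x hx).injective h

/-- Differentiating the isometry equation gives `T u v w = S u v w + S u w v`, where `S u v w` pairs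
the second derivative on `(u, v)` with `L w`. Symmetry of the second derivative lets Koszul's cyclic
sum solve for `S`. Nondegeneracy then recovers the second derivative, since `L` is bijective. -/
theorem fderiv_fderiv_eq_accel [FiniteDimensional ℝ E] {G₁ G₂ : E → E →L[ℝ] E →L[ℝ] ℝ}
    {U₁ U₂ : Set E} (h₁ : IsMetricOn G₁ U₁) (h₂ : IsMetricOn G₂ U₂) {f : E → E} {x : E}
    (hx : x ∈ U₁) (hfx : f x ∈ U₂) (hf : ContDiffAt ℝ 2 f x)
    (hiso : ∀ᶠ z in 𝓝 x, ∀ v w, G₂ (f z) (fderiv ℝ f z v) (fderiv ℝ f z w) = G₁ z v w) :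
    fderiv ℝ (fderiv ℝ f) x =
      accel (G₁ x) (fderiv ℝ G₁ x) (fderiv ℝ G₂ (f x)) (fderiv ℝ f x) := by
  have hd1 : HasFDerivAt G₁ (fderiv ℝ G₁ x) x :=
    ((h₁.contDiffOn.contDiffAt (h₁.isOpen.mem_nhds hx)).differentiableAt (by simp)).hasFDerivAt
  have hd2 : HasFDerivAt G₂ (fderiv ℝ G₂ (f x)) (f x) :=
    ((h₂.contDiffOn.contDiffAt (h₂.isOpen.mem_nhds hfx)).differentiableAt (by simp)).hasFDerivAt
  have hdf : HasFDerivAt f (fderiv ℝ f x) x := (hf.differentiableAt (by simp)).hasFDerivAt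
  have hdf' : HasFDerivAt (fderiv ℝ f) (fderiv ℝ (fderiv ℝ f) x) x :=
    ((hf.fderiv_right (m := 1) (by norm_num)).differentiableAt (by simp)).hasFDerivAt
  have hsymm : IsSymmSndFDerivAt ℝ f x := hf.isSymmSndFDerivAt (by simp)
  set L := fderiv ℝ f x
  set D := fderiv ℝ (fderiv ℝ f) x
  have hx0 := hiso.self_of_nhds
  have key : ∀ u v w, (fderiv ℝ G₁ x - pullTri (fderiv ℝ G₂ (f x)) L) u v w =
      G₂ (f x) (D u v) (L w) + G₂ (f x) (D u w) (L v) := by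
    intro u v w
    have e1 : HasFDerivAt (fun z ↦ G₂ (f z) (fderiv ℝ f z v) (fderiv ℝ f z w)) _ x :=
      ((hd2.comp x hdf).clm_apply (hdf'.clm_apply (hasFDerivAt_const v x))).clm_apply
        (hdf'.clm_apply (hasFDerivAt_const w x))
    have e2 : HasFDerivAt (fun z ↦ G₁ z v w) _ x :=
      (hd1.clm_apply (hasFDerivAt_const v x)).clm_apply (hasFDerivAt_const w x)
    have e3 := e1.unique (e2.congr_of_eventuallyEq (hiso.mono fun z hz ↦ hz v w))
    have e4 := DFunLike.congr_fun e3 u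
    simp at e4
    have := h₂.symm (f x) hfx (L v) (D u w)
    simp only [sub_apply, pullTri_apply]
    linarith
  have hinj : Function.Injective L := by
    refine (injective_iff_map_eq_zero L).2 fun v hv ↦ h₁.eq_zero hx fun w ↦ ?_
    rw [← hx0 v w]
    simp [L] at hv
    simp [hv]
  have hsurj : Function.Surjective L := (LinearMap.injective_iff_surjective (f := L.toLinearMap)).1 hinj
  ext1 u
  ext1 v
  rw [accel_apply]
  obtain ⟨a, ha⟩ := hsurj (D u v)
  rw [← ha]
  congr 1
  have h3 : G₁ x a = koszul (fderiv ℝ G₁ x - pullTri (fderiv ℝ G₂ (f x)) L) u v := by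
    ext w
    rw [koszul_apply, key, key, key, hsymm.eq v u, hsymm.eq w u, hsymm.eq w v, ← hx0 a w]
    change G₂ (f x) (L a) (L w) = _
    rw [ha]
    ring
  rw [← h3, (h₁.nondeg x hx).inverse_apply_self]

/-- Continuity of `accel` in the one-jet gives bounds on compact sets; its smoothness drives the
bootstrapping for limits of isometries. -/
theorem contDiffOn_accel [CompleteSpace E] {G₁ G₂ : E → E →L[ℝ] E →L[ℝ] ℝ}
    {U₁ U₂ : Set E} (h₁ : IsMetricOn G₁ U₁) (h₂ : IsMetricOn G₂ U₂) :
    ContDiffOn ℝ ∞ (fun z : E × E × (E →L[ℝ] E) ↦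
      accel (G₁ z.1) (fderiv ℝ G₁ z.1) (fderiv ℝ G₂ z.2.1) z.2.2) (U₁ ×ˢ U₂ ×ˢ univ) := by
  rintro ⟨x, y, L⟩ ⟨hx, hy, -⟩
  apply ContDiffAt.contDiffWithinAt
  have c1 : ContDiffAt ℝ ∞ G₁ x := h₁.contDiffOn.contDiffAt (h₁.isOpen.mem_nhds hx)
  have c2 : ContDiffAt ℝ ∞ G₂ y := h₂.contDiffOn.contDiffAt (h₂.isOpen.mem_nhds hy)
  have d1 : ContDiffAt ℝ ∞ (fun z : E × E × (E →L[ℝ] E) ↦ fderiv ℝ G₁ z.1) (x, y, L) :=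
    (c1.fderiv_right (m := ∞) (by simp)).comp (x, y, L) contDiffAt_fst
  have d2 : ContDiffAt ℝ ∞ (fun z : E × E × (E →L[ℝ] E) ↦ fderiv ℝ G₂ z.2.1) (x, y, L) :=
    ContDiffAt.comp (g := fderiv ℝ G₂) (x, y, L) (c2.fderiv_right (m := ∞) (by simp))
      (contDiffAt_fst.comp (x, y, L) contDiffAt_snd)
  have d3 : ContDiffAt ℝ ∞ (fun z : E × E × (E →L[ℝ] E) ↦ z.2.2) (x, y, L) :=
    contDiffAt_snd.comp (x, y, L) contDiffAt_snd
  have d4 : ContDiffAt ℝ ∞ (fun z : E × E × (E →L[ℝ] E) ↦ (G₁ z.1).inverse) (x, y, L) :=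
    ((h₁.nondeg x hx).contDiffAt_map_inverse).comp (x, y, L) (c1.comp (x, y, L) contDiffAt_fst)
  have d5 : ContDiffAt ℝ ∞ (fun z : E × E × (E →L[ℝ] E) ↦
      pullTri (fderiv ℝ G₂ z.2.1) z.2.2) (x, y, L) := by
    unfold pullTri
    refine ContDiffAt.clm_comp ?_ (ContDiffAt.clm_comp ?_ (d2.clm_comp d3))
    · exact (ContinuousLinearMap.contDiff _).contDiffAt.comp _
        ((ContinuousLinearMap.contDiff _).contDiffAt.comp _ d3)
    · exact (ContinuousLinearMap.contDiff _).contDiffAt.comp _ d3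
  have d6 : ContDiff ℝ ∞ (koszul (E := E)) := by
    unfold koszul
    have hf : ContDiff ℝ ∞ (fun T : E →L[ℝ] E →L[ℝ] E →L[ℝ] ℝ ↦ T.flip) :=
      (ContinuousLinearMap.flipₗᵢ ℝ E E (E →L[ℝ] ℝ)).contDiff
    exact ContDiff.const_smul (1 / 2 : ℝ) ((contDiff_id.add hf).sub (contDiff_const.clm_comp hf))
  unfold accel
  refine ContDiffAt.clm_comp ?_ (d6.contDiffAt.comp _ (d1.sub d5))
  exact (ContinuousLinearMap.contDiff _).contDiffAt.comp _ (d3.clm_comp d4)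

end Local

/-! ### Spreading a bound on the one-jet of an isometry over a ball of controlled size. -/

section Local

variable {E : Type*} [NormedAddCommGroup E] [NormedSpace ℝ E]

theorem two_le_infty : (2 : WithTop ℕ∞) ≤ ∞ := WithTop.coe_le_coe.2 le_top

/-- `f` is an isometry, with open domain `W ⊆ U₁`, from the metric `G₁` on `U₁` to the metric `G₂`
on `U₂`, and it leaves every compact subset of `U₂` at the boundary of `W` in `U₁`. -/
structure IsLocIso (G₁ : E → E →L[ℝ] E →L[ℝ] ℝ) (U₁ : Set E) (G₂ : E → E →L[ℝ] E →L[ℝ] ℝ)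
    (U₂ : Set E) (W : Set E) (f : E → E) : Prop where
  isOpen : IsOpen W
  subset : W ⊆ U₁
  mapsTo : MapsTo f W U₂
  contDiffOn : ContDiffOn ℝ ∞ f W
  isometric : ∀ x ∈ W, ∀ v w, G₂ (f x) (fderiv ℝ f x v) (fderiv ℝ f x w) = G₁ x v w
  proper : ∀ K ⊆ U₂, IsCompact K → ∀ x ∈ U₁, x ∈ closure (W ∩ f ⁻¹' K) → x ∈ W ∩ f ⁻¹' K

variable {G₁ G₂ : E → E →L[ℝ] E →L[ℝ] ℝ} {U₁ U₂ : Set E}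

theorem IsLocIso.contDiffAt {W : Set E} {f : E → E} (hf : IsLocIso G₁ U₁ G₂ U₂ W f) {x : E}
    (hx : x ∈ W) : ContDiffAt ℝ ∞ f x :=
  hf.contDiffOn.contDiffAt (hf.isOpen.mem_nhds hx)

theorem IsLocIso.hasFDerivAt {W : Set E} {f : E → E} (hf : IsLocIso G₁ U₁ G₂ U₂ W f) {x : E}
    (hx : x ∈ W) : HasFDerivAt f (fderiv ℝ f x) x :=
  ((hf.contDiffAt hx).differentiableAt (by simp)).hasFDerivAt

variable [FiniteDimensional ℝ E]

theorem IsLocIso.hasFDerivAt_fderiv {W : Set E} {f : E → E} (hf : IsLocIso G₁ U₁ G₂ U₂ W f)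
    (h₁ : IsMetricOn G₁ U₁) (h₂ : IsMetricOn G₂ U₂) {x : E} (hx : x ∈ W) :
    HasFDerivAt (fderiv ℝ f)
      (accel (G₁ x) (fderiv ℝ G₁ x) (fderiv ℝ G₂ (f x)) (fderiv ℝ f x)) x := by
  rw [← fderiv_fderiv_eq_accel h₁ h₂ (hf.subset hx) (hf.mapsTo hx)
    ((hf.contDiffAt hx).of_le two_le_infty)
    ((hf.isOpen.eventually_mem hx).mono fun z hz ↦ hf.isometric z hz)]
  exact (((hf.contDiffAt hx).fderiv_right (m := ∞) (by simp)).differentiableAt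
    (by simp)).hasFDerivAt

theorem exists_accel_bound (h₁ : IsMetricOn G₁ U₁) (h₂ : IsMetricOn G₂ U₂) {x₀ y₀ : E} {r ρ : ℝ}
    (hx₀ : closedBall x₀ r ⊆ U₁) (hy₀ : closedBall y₀ ρ ⊆ U₂) (C : ℝ) :
    ∃ B, 0 < B ∧ ∀ x ∈ closedBall x₀ r, ∀ y ∈ closedBall y₀ ρ, ∀ L : E →L[ℝ] E, ‖L‖ ≤ C →
      ‖accel (G₁ x) (fderiv ℝ G₁ x) (fderiv ℝ G₂ y) L‖ ≤ B := by
  have hcomp : IsCompact (closedBall x₀ r ×ˢ closedBall y₀ ρ ×ˢ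
      closedBall (0 : E →L[ℝ] E) C) :=
    (isCompact_closedBall _ _).prod ((isCompact_closedBall _ _).prod (isCompact_closedBall _ _))
  obtain ⟨B, hB⟩ := hcomp.exists_bound_of_continuousOn ((contDiffOn_accel h₁ h₂).continuousOn.mono
    (prod_mono hx₀ (prod_mono hy₀ (subset_univ _))))
  refine ⟨max B 1, by positivity, fun x hx y hy L hL ↦ (hB (x, y, L) ⟨hx, hy, ?_⟩).trans
    (le_max_left _ _)⟩
  simpa using hL

/-- Isometries with bounded one-jet at a point have bounded two-jets in a neighbourhood whose size
depends only on the bound. -/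
theorem exists_propagation (h₁ : IsMetricOn G₁ U₁) (h₂ : IsMetricOn G₂ U₂) {x₀ y₀ : E} {ρ : ℝ}
    (hρ : 0 < ρ) (hx₀ : closedBall x₀ ρ ⊆ U₁) (hy₀ : closedBall y₀ ρ ⊆ U₂) (C : ℝ) :
    ∃ r B, 0 < r ∧ r ≤ ρ ∧ 0 < B ∧ ∀ W f, IsLocIso G₁ U₁ G₂ U₂ W f →
      ∀ x₁ ∈ ball x₀ r, x₁ ∈ W → f x₁ ∈ ball y₀ r → ‖fderiv ℝ f x₁‖ ≤ C →
      ∀ x ∈ ball x₀ r, x ∈ W ∧ f x ∈ closedBall y₀ ρ ∧ ‖fderiv ℝ f x‖ ≤ C + 1 ∧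
        ‖fderiv ℝ (fderiv ℝ f) x‖ ≤ B := by
  -- For negative `C` the hypothesis on the derivative is void, so the radius for `0` serves.
  wlog hC : 0 ≤ C generalizing C
  · obtain ⟨r, B, hr, hrρ, hB, -⟩ := this 0 le_rfl
    exact ⟨r, B, hr, hrρ, hB, fun W f hf x₁ h1 h2 h3 h4 ↦
      absurd ((norm_nonneg _).trans h4) hC⟩
  obtain ⟨B, hB, hBb⟩ := exists_accel_bound h₁ h₂ hx₀ hy₀ (C + 1)
  -- Two points of the ball are less than `2 * r` apart. The first inequality keeps `f` in the
  -- `ρ`-ball: its value starts within `r` of `y₀` and moves by at most `(C + 1) * (2 * r)`. The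
  -- second keeps the derivative below `C + 1`: it varies by at most `B * (2 * r)`.
  obtain ⟨r, hr, hr1, hr2⟩ : ∃ r, 0 < r ∧ r * (2 * C + 3) < ρ ∧ r * (2 * B) < 1 := by
    refine ⟨min (ρ / (2 * (2 * C + 3))) (1 / (4 * B)), by positivity, ?_, ?_⟩
    · calc _ ≤ (ρ / (2 * (2 * C + 3))) * (2 * C + 3) := by gcongr; exact min_le_left _ _
        _ = ρ / 2 := by field_simp
        _ < ρ := by linarith
    · calc _ ≤ (1 / (4 * B)) * (2 * B) := by gcongr; exact min_le_right _ _
        _ = 1 / 2 := by field_simp; norm_num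
        _ < 1 := by norm_num
  have hrρ : r ≤ ρ := by nlinarith
  refine ⟨r, B, hr, hrρ, hB, fun W f hf x₁ hx₁ hx₁W hfx₁ hC₁ x hx ↦ ?_⟩
  set γ : ℝ → E := fun t ↦ AffineMap.lineMap (k := ℝ) x₁ x t with hγ
  have hγc : Continuous γ := AffineMap.lineMap_continuous
  have hγb : ∀ t ∈ Icc (0 : ℝ) 1, γ t ∈ ball x₀ r := fun t ht ↦
    (convex_ball x₀ r).segment_subset hx₁ hx (by
      rw [segment_eq_image_lineMap]; exact mem_image_of_mem _ ht)
  have hdist : ‖x - x₁‖ < 2 * r := by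
    rw [mem_ball, dist_eq_norm] at hx hx₁
    calc ‖x - x₁‖ = ‖(x - x₀) - (x₁ - x₀)‖ := by congr 1; abel
      _ ≤ ‖x - x₀‖ + ‖x₁ - x₀‖ := norm_sub_le _ _
      _ < 2 * r := by linarith
  -- Continuity method along the segment from `x₁` to `x`. Properness makes `Good` closed in `U₁`;
  -- the estimates improve its inequalities to strict ones, so it is also a neighbourhood of the
  -- point reached.
  set Good : Set E := {z | z ∈ W ∧ f z ∈ closedBall y₀ ρ ∧ ‖fderiv ℝ f z‖ ≤ C + 1} with hGood
  have hdc : ∀ z ∈ W, ContinuousAt (fderiv ℝ f) z := fun z hz ↦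
    ((hf.contDiffAt hz).fderiv_right (m := ∞) (by simp)).continuousAt
  have hGclosed : ∀ z ∈ U₁, z ∈ closure Good → z ∈ Good := by
    intro z hz hzc
    have hz1 : z ∈ W ∩ f ⁻¹' closedBall y₀ ρ := hf.proper _ hy₀ (isCompact_closedBall _ _) z hz
      (closure_mono (show Good ⊆ W ∩ f ⁻¹' closedBall y₀ ρ from fun w hw ↦ ⟨hw.1, hw.2.1⟩) hzc)
    refine ⟨hz1.1, hz1.2, ?_⟩
    obtain ⟨u, hu, hul⟩ := mem_closure_iff_seq_limit.1 hzc
    exact le_of_tendsto ((hdc z hz1.1).tendsto.comp hul).norm (Eventually.of_forall fun k ↦ (hu k).2.2)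
  have hest : ∀ t ∈ Icc (0 : ℝ) 1, (∀ s ∈ Icc (0 : ℝ) t, γ s ∈ Good) →
      ‖f (γ t) - f x₁‖ ≤ (C + 1) * (2 * r) ∧ ‖fderiv ℝ f (γ t) - fderiv ℝ f x₁‖ ≤ B * (2 * r) := by
    intro t ht hs
    have hseg : ∀ z ∈ segment ℝ x₁ (γ t), z ∈ Good ∧ z ∈ ball x₀ r := by
      intro z hz
      rw [segment_eq_image_lineMap] at hz
      obtain ⟨s, hs', rfl⟩ := hz
      have : AffineMap.lineMap x₁ (γ t) s = γ (s * t) := by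
        simp [hγ, AffineMap.lineMap_apply, mul_smul]
      rw [this]
      have h1 : s * t ∈ Icc (0 : ℝ) t := ⟨mul_nonneg hs'.1 ht.1, mul_le_of_le_one_left ht.1 hs'.2⟩
      exact ⟨hs _ h1, hγb _ ⟨h1.1, h1.2.trans ht.2⟩⟩
    have hd : ‖γ t - x₁‖ ≤ 2 * r := by
      have : γ t - x₁ = t • (x - x₁) := by simp [hγ, AffineMap.lineMap_apply]
      rw [this, norm_smul, Real.norm_of_nonneg ht.1]
      nlinarith [ht.2, norm_nonneg (x - x₁), ht.1]
    constructor
    · refine ((convex_segment x₁ (γ t)).norm_image_sub_le_of_norm_hasFDerivWithin_le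
        (fun z hz ↦ (hf.hasFDerivAt (hseg z hz).1.1).hasFDerivWithinAt)
        (fun z hz ↦ (hseg z hz).1.2.2) (left_mem_segment _ _ _) (right_mem_segment _ _ _)).trans ?_
      gcongr
    · refine ((convex_segment x₁ (γ t)).norm_image_sub_le_of_norm_hasFDerivWithin_le
        (fun z hz ↦ (hf.hasFDerivAt_fderiv h₁ h₂ (hseg z hz).1.1).hasFDerivWithinAt)
        (fun z hz ↦ hBb z (ball_subset_closedBall.trans (closedBall_subset_closedBall hrρ)
          (hseg z hz).2) _ (hseg z hz).1.2.1 _ (hseg z hz).1.2.2)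
        (left_mem_segment _ _ _) (right_mem_segment _ _ _)).trans ?_
      gcongr
  have hx₁G : x₁ ∈ Good :=
    ⟨hx₁W, ball_subset_closedBall (ball_subset_ball hrρ hfx₁), by linarith⟩
  have hall : Icc (0 : ℝ) 1 ⊆ γ ⁻¹' Good := by
    refine IsClosed.Icc_subset_of_forall_mem_nhdsGT_of_Icc_subset ?_ (by simpa [hγ]) ?_
    · refine isClosed_of_closure_subset fun t ht ↦ ?_
      have ht' : t ∈ Icc (0 : ℝ) 1 := isClosed_Icc.closure_subset (closure_mono inter_subset_right ht)
      refine ⟨hGclosed _ (hx₀ (ball_subset_closedBall.trans (closedBall_subset_closedBall hrρ)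
        (hγb t ht'))) ?_, ht'⟩
      exact closure_mono (image_subset_iff.2 inter_subset_left)
        (image_closure_subset_closure_image hγc (mem_image_of_mem γ ht))
    · intro t ht hs
      have htI : t ∈ Icc (0 : ℝ) 1 := ⟨ht.1, ht.2.le⟩
      obtain ⟨e1, e2⟩ := hest t htI hs
      have hW : γ t ∈ W := (hs ⟨ht.1, le_rfl⟩).1
      have hfb : f (γ t) ∈ ball y₀ ρ := by
        rw [mem_ball, dist_eq_norm] at hfx₁ ⊢
        calc ‖f (γ t) - y₀‖ = ‖(f (γ t) - f x₁) + (f x₁ - y₀)‖ := by congr 1; abel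
          _ ≤ ‖f (γ t) - f x₁‖ + ‖f x₁ - y₀‖ := norm_add_le _ _
          _ < (C + 1) * (2 * r) + r := by linarith
          _ ≤ ρ := by linarith
      have hdb : ‖fderiv ℝ f (γ t)‖ < C + 1 := by
        calc ‖fderiv ℝ f (γ t)‖ = ‖(fderiv ℝ f (γ t) - fderiv ℝ f x₁) + fderiv ℝ f x₁‖ := by
              congr 1; abel
          _ ≤ ‖fderiv ℝ f (γ t) - fderiv ℝ f x₁‖ + ‖fderiv ℝ f x₁‖ := norm_add_le _ _
          _ < C + 1 := by linarith
      have hG : Good ∈ 𝓝 (γ t) := by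
        filter_upwards [hf.isOpen.mem_nhds hW,
          (hf.contDiffAt hW).continuousAt.preimage_mem_nhds (isOpen_ball.mem_nhds hfb),
          (hdc _ hW).norm.eventually_lt_const hdb] with z z1 z2 z3
        exact ⟨z1, ball_subset_closedBall z2, z3.le⟩
      exact nhdsWithin_le_nhds (hγc.continuousAt.preimage_mem_nhds hG)
  have hxG : x ∈ Good := by simpa [hγ] using hall (right_mem_Icc.2 zero_le_one)
  refine ⟨hxG.1, hxG.2.1, hxG.2.2, ?_⟩
  rw [(hf.hasFDerivAt_fderiv h₁ h₂ hxG.1).fderiv]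
  exact hBb x (ball_subset_closedBall.trans (closedBall_subset_closedBall hrρ) hx) _ hxG.2.1 _ hxG.2.2

end Local

/-! ### Uniform limits of isometries are smooth isometries. -/

section Local

variable {E : Type*} [NormedAddCommGroup E] [NormedSpace ℝ E]

theorem tendsto_clm_apply {ι F : Type*} [NormedAddCommGroup F] [NormedSpace ℝ F] {l : Filter ι}
    {a : ι → E →L[ℝ] F} {A : E →L[ℝ] F} {b : ι → E} {v : E} (ha : Tendsto a l (𝓝 A))
    (hb : Tendsto b l (𝓝 v)) : Tendsto (fun i ↦ a i (b i)) l (𝓝 (A v)) :=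
  (isBoundedBilinearMap_apply.continuous.tendsto (A, v)).comp (ha.prodMk_nhds hb)

/-- Interpolation: a function with a small sup norm and Lipschitz derivative has small
derivative. -/
theorem norm_fderiv_le_of_lipschitz_fderiv {d : E → E} {d' : E → E →L[ℝ] E} {x₀ : E} {r ε B h : ℝ}
    (hd : ∀ x ∈ ball x₀ r, HasFDerivAt d (d' x) x) (hε : ∀ x ∈ ball x₀ r, ‖d x‖ ≤ ε)
    (hB : ∀ x ∈ ball x₀ r, ∀ y ∈ ball x₀ r, ‖d' x - d' y‖ ≤ B * ‖x - y‖) (hB0 : 0 ≤ B)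
    (hh : 0 < h) (hhr : h ≤ r / 2) {x : E} (hx : x ∈ ball x₀ (r / 2)) :
    ‖d' x‖ ≤ 2 * ε / h + B * h := by
  have hxr : ball x h ⊆ ball x₀ r := ball_subset_ball' (by rw [mem_ball] at hx; linarith)
  have hxx : x ∈ ball x₀ r := hxr (mem_ball_self hh)
  have hε0 : 0 ≤ ε := (norm_nonneg _).trans (hε x hxx)
  have hB' : 0 ≤ 2 * ε / h + B * h := by positivity
  refine ContinuousLinearMap.opNorm_le_of_unit_norm (𝕜 := ℝ) hB' fun u hu ↦ ?_
  set v := h • u with hv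
  have hvn : ‖v‖ = h := by rw [hv, norm_smul, hu, Real.norm_of_nonneg hh.le, mul_one]
  have hxv : x + v ∈ ball x₀ r := by
    rw [mem_ball, dist_eq_norm] at hx ⊢
    calc ‖x + v - x₀‖ = ‖(x - x₀) + v‖ := by congr 1; abel
      _ ≤ ‖x - x₀‖ + ‖v‖ := norm_add_le _ _
      _ < r := by linarith
  have hseg : segment ℝ x (x + v) ⊆ ball x₀ r := (convex_ball x₀ r).segment_subset hxx hxv
  -- Taylor expansion with step `h`: the remainder is at most `B * h ^ 2` and the increment of `d`
  -- at most `2 * ε`, so division by `h` gives the bound.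
  have h1 : ‖d (x + v) - d x - d' x (x + v - x)‖ ≤ B * h * ‖x + v - x‖ := by
    refine (convex_segment x (x + v)).norm_image_sub_le_of_norm_hasFDerivWithin_le'
      (fun z hz ↦ (hd z (hseg hz)).hasFDerivWithinAt) (fun z hz ↦ ?_)
      (left_mem_segment _ _ _) (right_mem_segment _ _ _)
    refine (hB z (hseg hz) x hxx).trans ?_
    gcongr
    obtain ⟨t, ht, rfl⟩ := (segment_eq_image' ℝ x (x + v)) ▸ hz
    simp only [add_sub_cancel_left, norm_smul, hvn, Real.norm_of_nonneg ht.1]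
    exact mul_le_of_le_one_left hh.le ht.2
  rw [add_sub_cancel_left, hvn] at h1
  have h2 : ‖d' x v‖ ≤ 2 * ε + B * h * h := by
    calc ‖d' x v‖ = ‖d (x + v) - d x - (d (x + v) - d x - d' x v)‖ := by congr 1; abel
      _ ≤ ‖d (x + v) - d x‖ + ‖d (x + v) - d x - d' x v‖ := norm_sub_le _ _
      _ ≤ (‖d (x + v)‖ + ‖d x‖) + B * h * h := by gcongr; exact norm_sub_le _ _
      _ ≤ 2 * ε + B * h * h := by linarith [hε _ hxv, hε _ hxx]
  rw [hv, map_smul, norm_smul, Real.norm_of_nonneg hh.le] at h2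
  have h3 : ‖d' x u‖ ≤ (2 * ε + B * h * h) / h := by rw [le_div_iff₀ hh]; linarith
  refine h3.trans (le_of_eq ?_)
  field_simp

/-- The interpolation inequality is applied to `f m - f k`, whose derivative is Lipschitz with
constant `2 * B`; the smaller ball leaves room for the step. -/
theorem uniformCauchySeqOn_fderiv {f : ℕ → E → E} {x₀ : E} {r B : ℝ} (hr : 0 < r) (hB : 0 ≤ B)
    (hf : ∀ j, ∀ x ∈ ball x₀ r, HasFDerivAt (f j) (fderiv ℝ (f j) x) x)
    (hf' : ∀ j, ∀ x ∈ ball x₀ r, ∃ D : E →L[ℝ] E →L[ℝ] E, HasFDerivAt (fderiv ℝ (f j)) D x ∧ ‖D‖ ≤ B)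
    (hc : UniformCauchySeqOn f atTop (ball x₀ r)) :
    UniformCauchySeqOn (fun j ↦ fderiv ℝ (f j)) atTop (ball x₀ (r / 2)) := by
  rw [Metric.uniformCauchySeqOn_iff] at hc ⊢
  intro δ hδ
  -- With sup norm at most `δ * h / 8`, each of the two terms of the interpolation bound is at most
  -- `δ / 4`. The `+ 1` keeps the denominator positive when `B = 0`.
  set h := min (r / 2) (δ / (8 * B + 1)) with hh
  have hh0 : 0 < h := by positivity
  obtain ⟨N, hN⟩ := hc (δ * h / 8) (by positivity)
  refine ⟨N, fun m hm k hk x hx ↦ ?_⟩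
  rw [dist_eq_norm]
  have hlip : ∀ j, ∀ x ∈ ball x₀ r, ∀ y ∈ ball x₀ r,
      ‖fderiv ℝ (f j) x - fderiv ℝ (f j) y‖ ≤ B * ‖x - y‖ := by
    intro j x hx y hy
    choose! D hD using hf' j
    exact (convex_ball x₀ r).norm_image_sub_le_of_norm_hasFDerivWithin_le
      (fun z hz ↦ (hD z hz).1.hasFDerivWithinAt) (fun z hz ↦ (hD z hz).2) hy hx
  have := norm_fderiv_le_of_lipschitz_fderiv (d := fun x ↦ f m x - f k x)
    (d' := fun x ↦ fderiv ℝ (f m) x - fderiv ℝ (f k) x) (B := 2 * B) (ε := δ * h / 8)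
    (fun x hx ↦ (hf m x hx).sub (hf k x hx))
    (fun x hx ↦ by have := hN m hm k hk x hx; rw [dist_eq_norm] at this; exact this.le)
    (fun x hx y hy ↦ by
      have h1 := hlip m x hx y hy
      have h2 := hlip k x hx y hy
      calc _ = ‖(fderiv ℝ (f m) x - fderiv ℝ (f m) y) - (fderiv ℝ (f k) x - fderiv ℝ (f k) y)‖ := by
            congr 1; abel
        _ ≤ _ := (norm_sub_le _ _).trans (by linarith))
    (by positivity) hh0 (min_le_left _ _) hx
  have e1 : 2 * (δ * h / 8) / h = δ / 4 := by field_simp; norm_num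
  have e2 : 2 * B * h ≤ δ / 4 := by
    calc 2 * B * h ≤ 2 * B * (δ / (8 * B + 1)) := by gcongr; exact min_le_right _ _
      _ ≤ δ / 4 := by
        rw [mul_div_assoc', div_le_div_iff₀ (by positivity) (by norm_num)]
        nlinarith
  linarith

variable [FiniteDimensional ℝ E] {G₁ G₂ : E → E →L[ℝ] E →L[ℝ] ℝ} {U₁ U₂ : Set E}

/-- A uniform limit of isometries with bounded derivatives is a smooth isometry. -/
theorem limit_isometric (h₁ : IsMetricOn G₁ U₁) (h₂ : IsMetricOn G₂ U₂) {x₀ y₀ : E} {r ρ C : ℝ}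
    (hr : 0 < r) (hx₀ : closedBall x₀ r ⊆ U₁) (hy₀ : closedBall y₀ ρ ⊆ U₂)
    {W : ℕ → Set E} {f : ℕ → E → E} {g : E → E} (hf : ∀ j, IsLocIso G₁ U₁ G₂ U₂ (W j) (f j))
    (hW : ∀ j, ball x₀ r ⊆ W j) (hfb : ∀ j, ∀ x ∈ ball x₀ r, f j x ∈ closedBall y₀ ρ)
    (hC : ∀ j, ∀ x ∈ ball x₀ r, ‖fderiv ℝ (f j) x‖ ≤ C)
    (hlim : TendstoUniformlyOn f g atTop (ball x₀ r)) :
    ContDiffOn ℝ ∞ g (ball x₀ (r / 2)) ∧ ∀ x ∈ ball x₀ (r / 2), ∀ v w,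
      G₂ (g x) (fderiv ℝ g x v) (fderiv ℝ g x w) = G₁ x v w := by
  have hsub : ball x₀ (r / 2) ⊆ ball x₀ r := ball_subset_ball (by linarith)
  obtain ⟨B, hB, hBb⟩ := exists_accel_bound h₁ h₂ hx₀ hy₀ C
  have hcau := uniformCauchySeqOn_fderiv hr hB.le
    (fun j x hx ↦ (hf j).hasFDerivAt (hW j hx))
    (fun j x hx ↦ ⟨_, (hf j).hasFDerivAt_fderiv h₁ h₂ (hW j hx),
      hBb x (ball_subset_closedBall hx) _ (hfb j x hx) _ (hC j x hx)⟩) hlim.uniformCauchySeqOn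
  have hex : ∀ x ∈ ball x₀ (r / 2), ∃ L, Tendsto (fun j ↦ fderiv ℝ (f j) x) atTop (𝓝 L) :=
    fun x hx ↦ cauchySeq_tendsto_of_complete (hcau.cauchySeq hx)
  choose! L hL using hex
  have hunif : TendstoUniformlyOn (fun j ↦ fderiv ℝ (f j)) L atTop (ball x₀ (r / 2)) :=
    hcau.tendstoUniformlyOn_of_tendsto hL
  have hpt : ∀ x ∈ ball x₀ (r / 2), Tendsto (fun j ↦ f j x) atTop (𝓝 (g x)) :=
    fun x hx ↦ hlim.tendsto_at (hsub hx)
  have hg : ∀ x ∈ ball x₀ (r / 2), HasFDerivAt g (L x) x := fun x hx ↦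
    hasFDerivAt_of_tendstoUniformlyOn isOpen_ball hunif
      (fun j y hy ↦ (hf j).hasFDerivAt (hW j (hsub hy))) hpt hx
  have hgy : ∀ x ∈ ball x₀ (r / 2), g x ∈ closedBall y₀ ρ := fun x hx ↦
    isClosed_closedBall.mem_of_tendsto (hpt x hx) (Eventually.of_forall fun j ↦ hfb j x (hsub hx))
  set A : E × E × (E →L[ℝ] E) → E →L[ℝ] E →L[ℝ] E := fun z ↦
    accel (G₁ z.1) (fderiv ℝ G₁ z.1) (fderiv ℝ G₂ z.2.1) z.2.2 with hA
  have hAs : ContDiffOn ℝ ∞ A (U₁ ×ˢ U₂ ×ˢ univ) := contDiffOn_accel h₁ h₂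
  have hgc : ContinuousOn g (ball x₀ (r / 2)) := fun x hx ↦
    (hg x hx).continuousAt.continuousWithinAt
  have hLc : ContinuousOn L (ball x₀ (r / 2)) := hunif.continuousOn
    (Frequently.of_forall fun j x hx ↦
      ((hf j).hasFDerivAt_fderiv h₁ h₂ (hW j (hsub hx))).continuousAt.continuousWithinAt)
  have hmem : ∀ x ∈ ball x₀ (r / 2), (x, g x, L x) ∈ U₁ ×ˢ U₂ ×ˢ (univ : Set (E →L[ℝ] E)) :=
    fun x hx ↦ ⟨hx₀ (ball_subset_closedBall (hsub hx)), hy₀ (hgy x hx), mem_univ _⟩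
  -- The derivative of `fderiv ℝ (f j)` is `A` along the one-jet of `f j`. These one-jets converge
  -- locally uniformly, so the second-order equation passes to the limit.
  have hL' : ∀ x ∈ ball x₀ (r / 2), HasFDerivAt L (A (x, g x, L x)) x := by
    intro x hx
    have hxn : ball x₀ (r / 2) ∈ 𝓝 x := isOpen_ball.mem_nhds hx
    have hAc : ContinuousAt A (x, g x, L x) :=
      (hAs.contDiffAt ((h₁.isOpen.prod (h₂.isOpen.prod isOpen_univ)).mem_nhds
        (hmem x hx))).continuousAt
    have hgx : ContinuousAt g x := hgc.continuousAt hxn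
    have hLx : ContinuousAt L x := hLc.continuousAt hxn
    have u1 : Tendsto (fun p : ℕ × E ↦ f p.1 p.2) (atTop ×ˢ 𝓝 x) (𝓝 (g x)) :=
      (hgx.tendsto.comp tendsto_snd).congr_uniformity (tendstoUniformlyOnFilter_iff_tendsto.1
        ((hlim.mono hsub).tendstoUniformlyOnFilter.mono_right (le_principal_iff.2 hxn)))
    have u2 : Tendsto (fun p : ℕ × E ↦ fderiv ℝ (f p.1) p.2) (atTop ×ˢ 𝓝 x) (𝓝 (L x)) :=
      (hLx.tendsto.comp tendsto_snd).congr_uniformity (tendstoUniformlyOnFilter_iff_tendsto.1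
        (hunif.tendstoUniformlyOnFilter.mono_right (le_principal_iff.2 hxn)))
    have u3 : Tendsto (fun p : ℕ × E ↦ A (p.2, f p.1 p.2, fderiv ℝ (f p.1) p.2)) (atTop ×ˢ 𝓝 x)
        (𝓝 (A (x, g x, L x))) :=
      hAc.tendsto.comp (tendsto_snd.prodMk_nhds (u1.prodMk_nhds u2))
    have u4 : Tendsto (fun p : ℕ × E ↦ A (p.2, g p.2, L p.2)) (atTop ×ˢ 𝓝 x)
        (𝓝 (A (x, g x, L x))) :=
      hAc.tendsto.comp (tendsto_snd.prodMk_nhds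
        ((hgx.tendsto.comp tendsto_snd).prodMk_nhds (hLx.tendsto.comp tendsto_snd)))
    refine hasFDerivAt_of_tendstoUniformlyOnFilter (l := atTop) (f := fun j ↦ fderiv ℝ (f j))
      (f' := fun j z ↦ A (z, f j z, fderiv ℝ (f j) z)) (g' := fun z ↦ A (z, g z, L z))
      (tendstoUniformlyOnFilter_iff_tendsto.2
        ((u4.prodMk_nhds u3).mono_right (nhds_le_uniformity _))) ?_ (mem_of_superset hxn hL)
    filter_upwards [prod_mem_prod univ_mem hxn] with p hp
    exact (hf p.1).hasFDerivAt_fderiv h₁ h₂ (hW p.1 (hsub hp.2))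
  -- Bootstrapping: `g' = L` and `L' = A (x, g, L)`, so `C^k` regularity of the pair implies
  -- `C^(k+1)`.
  have hsmooth : ∀ k : ℕ, ContDiffOn ℝ k g (ball x₀ (r / 2)) ∧ ContDiffOn ℝ k L (ball x₀ (r / 2)) := by
    intro k
    induction k with
    | zero => exact ⟨contDiffOn_zero.2 hgc, contDiffOn_zero.2 hLc⟩
    | succ k ih =>
      have hstep : ∀ {F : Type _} [NormedAddCommGroup F] [NormedSpace ℝ F] (u : E → F)
          (u' : E → E →L[ℝ] F), (∀ x ∈ ball x₀ (r / 2), HasFDerivAt u (u' x) x) →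
          ContDiffOn ℝ k u' (ball x₀ (r / 2)) → ContDiffOn ℝ (k + 1 : ℕ) u (ball x₀ (r / 2)) := by
        intro F _ _ u u' hu hu'
        push_cast
        rw [contDiffOn_succ_iff_fderiv_of_isOpen isOpen_ball]
        exact ⟨fun x hx ↦ (hu x hx).differentiableAt.differentiableWithinAt, by simp,
          hu'.congr fun x hx ↦ (hu x hx).fderiv⟩
      refine ⟨hstep g L hg ih.2, hstep L _ hL' ?_⟩
      exact (hAs.of_le (by exact_mod_cast le_top)).comp
        (contDiffOn_id.prodMk (ih.1.prodMk ih.2)) hmem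
  refine ⟨contDiffOn_infty.2 fun k ↦ (hsmooth k).1, fun x hx v w ↦ ?_⟩
  rw [(hg x hx).fderiv]
  have t1 : Tendsto (fun j ↦ G₂ (f j x)) atTop (𝓝 (G₂ (g x))) :=
    ((h₂.contDiffOn.contDiffAt (h₂.isOpen.mem_nhds
      (hy₀ (hgy x hx)))).continuousAt.tendsto).comp (hpt x hx)
  have t2 : ∀ v, Tendsto (fun j ↦ fderiv ℝ (f j) x v) atTop (𝓝 (L x v)) := fun v ↦
    tendsto_clm_apply (hL x hx) tendsto_const_nhds
  refine tendsto_nhds_unique (tendsto_clm_apply (tendsto_clm_apply t1 (t2 v)) (t2 w)) ?_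
  refine tendsto_const_nhds.congr fun j ↦ ((hf j).isometric x (hW j (hsub hx)) v w).symm

end Local

/-! ### The metric in charts. -/

section Charts

variable {n : ℕ} {M : Type*} [TopologicalSpace M]
  [ChartedSpace (EuclideanSpace ℝ (Fin n)) M]

/-- The derivative of the inverse of the chart at `q`. -/
def chartD (q : M) (x : EuclideanSpace ℝ (Fin n)) :
    EuclideanSpace ℝ (Fin n) →L[ℝ] EuclideanSpace ℝ (Fin n) :=
  mfderiv 𝓘(ℝ, EuclideanSpace ℝ (Fin n)) (𝓡 n) (extChartAt (𝓡 n) q).symm x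

/-- The derivative of a self-map of `M`, as a map of the model space. -/
def mder (f : M → M) (p : M) : EuclideanSpace ℝ (Fin n) →L[ℝ] EuclideanSpace ℝ (Fin n) :=
  mfderiv (𝓡 n) (𝓡 n) f p

/-- The expression of `f` in the charts at `q` and `q'`. -/
def rep (f : M → M) (q q' : M) : EuclideanSpace ℝ (Fin n) → EuclideanSpace ℝ (Fin n) :=
  fun x ↦ extChartAt (𝓡 n) q' (f ((extChartAt (𝓡 n) q).symm x))

/-- The domain of the expression of `f` in the charts at `q` and `q'`. -/
def repDomain (f : M → M) (q q' : M) : Set (EuclideanSpace ℝ (Fin n)) :=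
  {x | x ∈ (extChartAt (𝓡 n) q).target ∧
    f ((extChartAt (𝓡 n) q).symm x) ∈ (extChartAt (𝓡 n) q').source}

variable [IsManifold (𝓡 n) ∞ M]

/-- The metric at `p` as a bilinear form on the model space. -/
def LorentzMetric.bil (g : LorentzMetric n M) (p : M) :
    EuclideanSpace ℝ (Fin n) →L[ℝ] EuclideanSpace ℝ (Fin n) →L[ℝ] ℝ :=
  g.form p

/-- The metric in the chart at `q`. -/
def chartForm (g : LorentzMetric n M) (q : M) (x : EuclideanSpace ℝ (Fin n)) :
    EuclideanSpace ℝ (Fin n) →L[ℝ] EuclideanSpace ℝ (Fin n) →L[ℝ] ℝ :=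
  (g.bil ((extChartAt (𝓡 n) q).symm x)).bilinearComp (chartD q x) (chartD q x)

@[simp]
theorem chartForm_apply (g : LorentzMetric n M) (q : M) (x v w : EuclideanSpace ℝ (Fin n)) :
    chartForm g q x v w =
      g.bil ((extChartAt (𝓡 n) q).symm x) (chartD q x v) (chartD q x w) := rfl

theorem mdifferentiableAt_extChartAt_symm' (q : M) {x : EuclideanSpace ℝ (Fin n)}
    (hx : x ∈ (extChartAt (𝓡 n) q).target) :
    MDifferentiableAt 𝓘(ℝ, EuclideanSpace ℝ (Fin n)) (𝓡 n) (extChartAt (𝓡 n) q).symm x :=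
  (((contMDiffOn_extChartAt_symm (n := ∞) q).contMDiffAt
    ((isOpen_extChartAt_target q).mem_nhds hx))).mdifferentiableAt (by simp)

theorem contMDiffAt_extChartAt_symm' (q : M) {x : EuclideanSpace ℝ (Fin n)}
    (hx : x ∈ (extChartAt (𝓡 n) q).target) :
    ContMDiffAt 𝓘(ℝ, EuclideanSpace ℝ (Fin n)) (𝓡 n) ∞ (extChartAt (𝓡 n) q).symm x :=
  (contMDiffOn_extChartAt_symm (n := ∞) q).contMDiffAt ((isOpen_extChartAt_target q).mem_nhds hx)

theorem contMDiffAt_extChartAt_source (q : M) {p : M} (hp : p ∈ (extChartAt (𝓡 n) q).source) :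
    ContMDiffAt (𝓡 n) 𝓘(ℝ, EuclideanSpace ℝ (Fin n)) ∞ (extChartAt (𝓡 n) q) p :=
  contMDiffAt_extChartAt' (by rwa [extChartAt_source] at hp)

theorem isInvertible_chartD (q : M) {x : EuclideanSpace ℝ (Fin n)}
    (hx : x ∈ (extChartAt (𝓡 n) q).target) : (chartD q x).IsInvertible := by
  have : IsManifold (𝓡 n) 1 M := .of_le (n := ∞) (by simp)
  have h := isInvertible_mfderivWithin_extChartAt_symm (I := 𝓡 n) hx
  rw [show range (𝓡 n) = univ from (𝓡 n).range_eq_univ, mfderivWithin_univ] at h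
  exact h

theorem LorentzMetric.bil_symm (g : LorentzMetric n M) (p : M) (v w : EuclideanSpace ℝ (Fin n)) :
    g.bil p v w = g.bil p w v := g.symm p v w

theorem LorentzMetric.bil_eq_zero (g : LorentzMetric n M) (p : M) {v : EuclideanSpace ℝ (Fin n)}
    (hv : ∀ w, g.bil p v w = 0) : v = 0 := by
  obtain ⟨b, i₀, hb⟩ := g.signature p
  let b' : Module.Basis (Fin n) ℝ (EuclideanSpace ℝ (Fin n)) := b
  have hb' : ∀ i j, g.bil p (b' i) (b' j) = if i = j then (if i = i₀ then -1 else 1) else 0 := hb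
  have hsum : v = ∑ i, b'.repr v i • b' i := (b'.sum_repr v).symm
  have h0 : ∀ j, b'.repr v j = 0 := by
    intro j
    have h1 := hv (b' j)
    rw [hsum] at h1
    simp only [map_sum, map_smul, FunLike.coe_sum, Finset.sum_apply,
      FunLike.coe_smul, Pi.smul_apply, hb', smul_eq_mul] at h1
    simp only [mul_ite, mul_zero, Finset.sum_ite_eq', Finset.mem_univ, if_true] at h1
    split_ifs at h1 <;> linarith
  rw [hsum]
  simp [h0]

/-- Smoothness is tested on constant vectors: their images under the derivative of the inverse chart
are smooth vector fields along it, to which the smooth form of `g` applies. -/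
theorem isMetricOn_chartForm (g : LorentzMetric n M) (q : M) :
    IsMetricOn (chartForm g q) (extChartAt (𝓡 n) q).target where
  isOpen := isOpen_extChartAt_target q
  symm x _ v w := by simp [g.bil_symm]
  nondeg x hx := by
    have hinj : Function.Injective (chartForm g q x) := by
      refine (injective_iff_map_eq_zero _).2 fun v hv ↦ ?_
      have h1 : chartD q x v = 0 := g.bil_eq_zero _ fun w ↦ by
        obtain ⟨w', rfl⟩ := (isInvertible_chartD q hx).surjective w
        exact DFunLike.congr_fun hv w'
      exact (isInvertible_chartD q hx).injective (h1.trans (map_zero _).symm)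
    let L : EuclideanSpace ℝ (Fin n) ≃ₗ[ℝ] (EuclideanSpace ℝ (Fin n) →L[ℝ] ℝ) :=
      LinearMap.linearEquivOfInjective (chartForm g q x).toLinearMap hinj (by
        rw [← (LinearMap.toContinuousLinearMap (𝕜 := ℝ) (E := EuclideanSpace ℝ (Fin n))
          (F' := ℝ)).finrank_eq]
        exact Subspace.dual_finrank_eq.symm)
    exact ⟨L.toContinuousLinearEquiv, rfl⟩
  contDiffOn := by
    have : IsManifold (𝓡 n) 1 M := .of_le (n := ∞) (by simp)
    rw [contDiffOn_clm_apply]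
    intro v
    rw [contDiffOn_clm_apply]
    intro w x hx
    have hvec : ∀ v : EuclideanSpace ℝ (Fin n), ContMDiffOn 𝓘(ℝ, EuclideanSpace ℝ (Fin n))
        (𝓡 n).tangent ∞ (fun x ↦ (Bundle.TotalSpace.mk' (EuclideanSpace ℝ (Fin n))
          (E := (TangentSpace (𝓡 n) : M → Type _)) ((extChartAt (𝓡 n) q).symm x) (chartD q x v)))
        (extChartAt (𝓡 n) q).target := by
      intro v
      have h1 := (contMDiffOn_extChartAt_symm (I := 𝓡 n) (n := ∞) q).contMDiffOn_tangentMapWithin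
        (m := ∞) (by simp) (isOpen_extChartAt_target q).uniqueMDiffOn
      have h2 : ContMDiff 𝓘(ℝ, EuclideanSpace ℝ (Fin n))
          (𝓘(ℝ, EuclideanSpace ℝ (Fin n))).tangent ∞ (fun x ↦ (⟨x, v⟩ :
            TangentBundle 𝓘(ℝ, EuclideanSpace ℝ (Fin n)) (EuclideanSpace ℝ (Fin n)))) :=
        contMDiff_vectorSpace_iff_contDiff.2 contDiff_const
      refine (h1.comp h2.contMDiffOn (fun x hx ↦ hx)).congr fun x hx ↦ ?_
      simp only [tangentMapWithin, Function.comp]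
      rw [mfderivWithin_of_isOpen (isOpen_extChartAt_target q) hx]
      rfl
    have h3 : ContMDiffWithinAt 𝓘(ℝ, EuclideanSpace ℝ (Fin n)) ((𝓡 n).prod 𝓘(ℝ)) ∞
        (fun x ↦ Bundle.TotalSpace.mk' ℝ (E := Bundle.Trivial M ℝ) ((extChartAt (𝓡 n) q).symm x)
          (g.form ((extChartAt (𝓡 n) q).symm x) (chartD q x v) (chartD q x w)))
        (extChartAt (𝓡 n) q).target x := by
      apply ContMDiffWithinAt.clm_bundle_apply₂ (F₁ := EuclideanSpace ℝ (Fin n))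
        (F₂ := EuclideanSpace ℝ (Fin n))
      · exact ContMDiffAt.comp_contMDiffWithinAt x g.contMDiff.contMDiffAt
          (contMDiffOn_extChartAt_symm (n := ∞) q x hx)
      · exact hvec v x hx
      · exact hvec w x hx
    rw [← contMDiffWithinAt_iff_contDiffWithinAt]
    rw [Bundle.contMDiffWithinAt_totalSpace] at h3
    exact h3.2

end Charts

/-! ### Self-maps of the manifold in charts. -/

section Charts

variable {n : ℕ} {M : Type*} [TopologicalSpace M]
  [ChartedSpace (EuclideanSpace ℝ (Fin n)) M]

theorem isOpen_repDomain {f : M → M} (hf : Continuous f) (q q' : M) :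
    IsOpen (repDomain (n := n) f q q') :=
  (hf.comp_continuousOn (continuousOn_extChartAt_symm q)).isOpen_inter_preimage
    (isOpen_extChartAt_target q) (isOpen_extChartAt_source q')

theorem extChartAt_symm_rep {f : M → M} {q q' : M} {x : EuclideanSpace ℝ (Fin n)}
    (hx : x ∈ repDomain f q q') :
    (extChartAt (𝓡 n) q').symm (rep f q q' x) = f ((extChartAt (𝓡 n) q).symm x) :=
  (extChartAt (𝓡 n) q').left_inv hx.2

theorem rep_mem_target {f : M → M} {q q' : M} {x : EuclideanSpace ℝ (Fin n)}
    (hx : x ∈ repDomain f q q') : rep f q q' x ∈ (extChartAt (𝓡 n) q').target :=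
  (extChartAt (𝓡 n) q').map_source hx.2

/-- This is the properness required by `IsLocIso`. The image of `K` in `M` is compact, hence closed,
so it contains the limit of values of `f`; that limit therefore still lies in the target chart. -/
theorem isClosed_repDomain_inter [T2Space M] {f : M → M} (hf : Continuous f) (q q' : M)
    {K : Set (EuclideanSpace ℝ (Fin n))} (hK : K ⊆ (extChartAt (𝓡 n) q').target)
    (hKc : IsCompact K) {x : EuclideanSpace ℝ (Fin n)} (hx : x ∈ (extChartAt (𝓡 n) q).target)
    (hxc : x ∈ closure (repDomain f q q' ∩ rep f q q' ⁻¹' K)) :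
    x ∈ repDomain f q q' ∩ rep f q q' ⁻¹' K := by
  have hcl : IsClosed ((extChartAt (𝓡 n) q').symm '' K) :=
    (hKc.image_of_continuousOn ((continuousOn_extChartAt_symm q').mono hK)).isClosed
  have hmem : f ((extChartAt (𝓡 n) q).symm x) ∈ (extChartAt (𝓡 n) q').symm '' K := by
    rw [mem_closure_iff_clusterPt, ClusterPt] at hxc
    have := hxc
    have hcont : ContinuousAt (fun z ↦ f ((extChartAt (𝓡 n) q).symm z)) x :=
      hf.continuousAt.comp (continuousAt_extChartAt_symm'' hx)
    refine hcl.mem_of_tendsto (hcont.tendsto.mono_left inf_le_left :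
      Tendsto _ (𝓝 x ⊓ 𝓟 (repDomain f q q' ∩ rep f q q' ⁻¹' K)) _) ?_
    filter_upwards [mem_inf_of_right (mem_principal_self _)] with z hz
    exact ⟨rep f q q' z, hz.2, extChartAt_symm_rep hz.1⟩
  obtain ⟨y, hy, hyf⟩ := hmem
  have h1 : x ∈ repDomain f q q' := ⟨hx, by
    rw [← hyf]; exact (extChartAt (𝓡 n) q').map_target (hK hy)⟩
  refine ⟨h1, ?_⟩
  change extChartAt (𝓡 n) q' (f ((extChartAt (𝓡 n) q).symm x)) ∈ K
  rw [← hyf, (extChartAt (𝓡 n) q').right_inv (hK hy)]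
  exact hy

variable [IsManifold (𝓡 n) ∞ M]

theorem contDiffAt_rep {f : M → M} {q q' : M} {x : EuclideanSpace ℝ (Fin n)}
    (hx : x ∈ repDomain f q q')
    (hf : ContMDiffAt (𝓡 n) (𝓡 n) ∞ f ((extChartAt (𝓡 n) q).symm x)) :
    ContDiffAt ℝ ∞ (rep f q q') x := by
  rw [← contMDiffAt_iff_contDiffAt]
  exact (contMDiffAt_extChartAt_source q' hx.2).comp x
    (hf.comp x (contMDiffAt_extChartAt_symm' q hx.1))

theorem chartD_comp_fderiv_rep {f : M → M} (hf : Continuous f) {q q' : M}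
    {x : EuclideanSpace ℝ (Fin n)} (hx : x ∈ repDomain f q q')
    (hfx : ContMDiffAt (𝓡 n) (𝓡 n) ∞ f ((extChartAt (𝓡 n) q).symm x)) :
    (chartD q' (rep f q q' x)).comp (fderiv ℝ (rep f q q') x) =
      (mder f ((extChartAt (𝓡 n) q).symm x)).comp (chartD q x) := by
  have h1 : HasMFDerivAt 𝓘(ℝ, EuclideanSpace ℝ (Fin n)) 𝓘(ℝ, EuclideanSpace ℝ (Fin n))
      (rep f q q') x (fderiv ℝ (rep f q q') x) :=
    ((contDiffAt_rep hx hfx).differentiableAt (by simp)).hasFDerivAt.hasMFDerivAt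
  have h2 := (mdifferentiableAt_extChartAt_symm' q' (rep_mem_target hx)).hasMFDerivAt.comp x h1
  have h3 := (hfx.mdifferentiableAt (by simp)).hasMFDerivAt.comp x
    (mdifferentiableAt_extChartAt_symm' q hx.1).hasMFDerivAt
  have h4 : (extChartAt (𝓡 n) q').symm ∘ rep f q q' =ᶠ[𝓝 x] f ∘ (extChartAt (𝓡 n) q).symm :=
    ((isOpen_repDomain hf q q').eventually_mem hx).mono fun z hz ↦ extChartAt_symm_rep hz
  exact hasMFDerivAt_unique (h2.congr_of_eventuallyEq h4.symm) h3

theorem chartForm_rep (g : LorentzMetric n M) {f : M → M} (hf : Continuous f) {q q' : M}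
    {x : EuclideanSpace ℝ (Fin n)} (hx : x ∈ repDomain f q q')
    (hfx : ContMDiffAt (𝓡 n) (𝓡 n) ∞ f ((extChartAt (𝓡 n) q).symm x))
    (v w : EuclideanSpace ℝ (Fin n)) :
    chartForm g q' (rep f q q' x) (fderiv ℝ (rep f q q') x v) (fderiv ℝ (rep f q q') x w) =
      g.bil (f ((extChartAt (𝓡 n) q).symm x))
        (mder f ((extChartAt (𝓡 n) q).symm x) (chartD q x v))
        (mder f ((extChartAt (𝓡 n) q).symm x) (chartD q x w)) := by
  have h := fun v ↦ DFunLike.congr_fun (chartD_comp_fderiv_rep hf hx hfx) v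
  simp only [ContinuousLinearMap.comp_apply] at h
  rw [chartForm_apply, h, h, extChartAt_symm_rep hx]

theorem contMDiff_isometry {g : LorentzMetric n M} (Φ : isometryGroup g) :
    ContMDiff (𝓡 n) (𝓡 n) ∞ (Φ.1 : M → M) := Φ.2.1

theorem bil_mder_isometry {g : LorentzMetric n M} (Φ : isometryGroup g) (p : M)
    (v w : EuclideanSpace ℝ (Fin n)) :
    g.bil (Φ.1 p) (mder Φ.1 p v) (mder Φ.1 p w) = g.bil p v w := Φ.2.2.2 p v w

theorem isLocIso_rep [T2Space M] {g : LorentzMetric n M} (Φ : isometryGroup g)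
    (q q' : M) :
    IsLocIso (chartForm g q) (extChartAt (𝓡 n) q).target (chartForm g q')
      (extChartAt (𝓡 n) q').target (repDomain Φ.1 q q') (rep Φ.1 q q') where
  isOpen := isOpen_repDomain Φ.1.continuous q q'
  subset _ hx := hx.1
  mapsTo _ hx := rep_mem_target hx
  contDiffOn _ hx := (contDiffAt_rep hx (contMDiff_isometry Φ).contMDiffAt).contDiffWithinAt
  isometric x hx v w := by
    rw [chartForm_rep g Φ.1.continuous hx (contMDiff_isometry Φ).contMDiffAt, bil_mder_isometry]
    rfl
  proper _ hK hKc _ hx hxc := isClosed_repDomain_inter Φ.1.continuous q q' hK hKc hx hxc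

theorem contMDiffAt_of_contDiffAt_rep {f : M → M} (hf : Continuous f) {q q' : M}
    {x : EuclideanSpace ℝ (Fin n)} (hx : x ∈ repDomain f q q')
    (hr : ContDiffAt ℝ ∞ (rep f q q') x) :
    ContMDiffAt (𝓡 n) (𝓡 n) ∞ f ((extChartAt (𝓡 n) q).symm x) := by
  set p := (extChartAt (𝓡 n) q).symm x with hp
  have hps : p ∈ (extChartAt (𝓡 n) q).source := (extChartAt (𝓡 n) q).map_target hx.1
  have hcp : extChartAt (𝓡 n) q p = x := (extChartAt (𝓡 n) q).right_inv hx.1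
  have h1 : ContMDiffAt (𝓡 n) (𝓡 n) ∞
      ((extChartAt (𝓡 n) q').symm ∘ (rep f q q' ∘ extChartAt (𝓡 n) q)) p := by
    have a1 := contMDiffAt_extChartAt_symm' q' (rep_mem_target hx)
    have a2 : ContMDiffAt 𝓘(ℝ, EuclideanSpace ℝ (Fin n)) 𝓘(ℝ, EuclideanSpace ℝ (Fin n)) ∞
      (rep f q q') x := contMDiffAt_iff_contDiffAt.2 hr
    have a3 := contMDiffAt_extChartAt_source q hps
    rw [← hcp] at a1 a2
    exact a1.comp p (a2.comp p a3)
  refine h1.congr_of_eventuallyEq ?_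
  filter_upwards [(isOpen_extChartAt_source (I := 𝓡 n) q).eventually_mem hps,
    hf.continuousAt.preimage_mem_nhds ((isOpen_extChartAt_source (I := 𝓡 n) q').mem_nhds hx.2)]
    with z hz hz'
  simp only [Function.comp, rep]
  rw [(extChartAt (𝓡 n) q).left_inv hz, (extChartAt (𝓡 n) q').left_inv hz']

theorem form_mfderiv_eq_of_rep (g : LorentzMetric n M) {f : M → M} (hf : Continuous f) {q q' : M}
    {x : EuclideanSpace ℝ (Fin n)} (hx : x ∈ repDomain f q q')
    (hfx : ContMDiffAt (𝓡 n) (𝓡 n) ∞ f ((extChartAt (𝓡 n) q).symm x))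
    (hiso : ∀ v w, chartForm g q' (rep f q q' x) (fderiv ℝ (rep f q q') x v)
      (fderiv ℝ (rep f q q') x w) = chartForm g q x v w) (v w : EuclideanSpace ℝ (Fin n)) :
    g.bil (f ((extChartAt (𝓡 n) q).symm x)) (mder f ((extChartAt (𝓡 n) q).symm x) v)
      (mder f ((extChartAt (𝓡 n) q).symm x) w) = g.bil ((extChartAt (𝓡 n) q).symm x) v w := by
  obtain ⟨v, rfl⟩ := (isInvertible_chartD q hx.1).surjective v
  obtain ⟨w, rfl⟩ := (isInvertible_chartD q hx.1).surjective w
  rw [← chartForm_rep g hf hx hfx, hiso]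
  rfl

end Charts

/-! ### One-jets of self-maps, measured through an immersion into a normed space. -/

section Jets

variable {n : ℕ} {M : Type*} [TopologicalSpace M]
  [ChartedSpace (EuclideanSpace ℝ (Fin n)) M]
  {F : Type*} [NormedAddCommGroup F] [NormedSpace ℝ F]

/-- The expression of `h : M → F` in the chart at `q`. -/
def chartFun (h : M → F) (q : M) : EuclideanSpace ℝ (Fin n) → F :=
  fun x ↦ h ((extChartAt (𝓡 n) q).symm x)

/-- The derivative of `h : M → F`, as a map on the model space. -/
def fder (h : M → F) (p : M) : EuclideanSpace ℝ (Fin n) →L[ℝ] F :=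
  mfderiv (𝓡 n) 𝓘(ℝ, F) h p

theorem fderiv_rep_id {q : M} {x : EuclideanSpace ℝ (Fin n)}
    (hx : x ∈ (extChartAt (𝓡 n) q).target) :
    fderiv ℝ (rep (id : M → M) q q) x = ContinuousLinearMap.id ℝ _ := by
  refine ((hasFDerivAt_id x).congr_of_eventuallyEq ?_).fderiv
  filter_upwards [(isOpen_extChartAt_target q).eventually_mem hx] with z hz
  exact (extChartAt (𝓡 n) q).right_inv hz

variable [IsManifold (𝓡 n) ∞ M]

theorem contDiffAt_chartFun {h : M → F} (hh : ContMDiff (𝓡 n) 𝓘(ℝ, F) ∞ h) {q : M}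
    {x : EuclideanSpace ℝ (Fin n)} (hx : x ∈ (extChartAt (𝓡 n) q).target) :
    ContDiffAt ℝ ∞ (chartFun h q) x := by
  rw [← contMDiffAt_iff_contDiffAt]
  exact hh.contMDiffAt.comp x (contMDiffAt_extChartAt_symm' q hx)

theorem continuousOn_fderiv_chartFun {h : M → F} (hh : ContMDiff (𝓡 n) 𝓘(ℝ, F) ∞ h) (q : M) :
    ContinuousOn (fderiv ℝ (chartFun (n := n) h q)) (extChartAt (𝓡 n) q).target := fun _ hx ↦
  ((contDiffAt_chartFun hh hx).fderiv_right (m := ∞) (by simp)).continuousAt.continuousWithinAt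

theorem fderiv_chartFun {h : M → F} (hh : ContMDiff (𝓡 n) 𝓘(ℝ, F) ∞ h) {q : M}
    {x : EuclideanSpace ℝ (Fin n)} (hx : x ∈ (extChartAt (𝓡 n) q).target) :
    fderiv ℝ (chartFun h q) x = (fder h ((extChartAt (𝓡 n) q).symm x)).comp (chartD q x) := by
  have h1 := (hh.mdifferentiable (by simp) ((extChartAt (𝓡 n) q).symm x)).hasMFDerivAt.comp x
    (mdifferentiableAt_extChartAt_symm' q hx).hasMFDerivAt
  have h2 : HasFDerivAt (chartFun h q)
      ((fder h ((extChartAt (𝓡 n) q).symm x)).comp (chartD q x)) x :=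
    hasMFDerivAt_iff_hasFDerivAt.1 h1
  exact h2.fderiv

theorem fderiv_chartFun_comp {h : M → F} (hh : ContMDiff (𝓡 n) 𝓘(ℝ, F) ∞ h) {f : M → M}
    (hf : ContMDiff (𝓡 n) (𝓡 n) ∞ f) {q q' : M} {x : EuclideanSpace ℝ (Fin n)}
    (hx : x ∈ repDomain f q q') :
    fderiv ℝ (chartFun (h ∘ f) q) x =
      (fderiv ℝ (chartFun h q') (rep f q q' x)).comp (fderiv ℝ (rep f q q') x) := by
  have h1 := ((contDiffAt_chartFun hh (rep_mem_target hx)).differentiableAt (by simp)).hasFDerivAt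
  have h2 := ((contDiffAt_rep hx hf.contMDiffAt).differentiableAt (by simp)).hasFDerivAt
  refine ((h1.comp x h2).congr_of_eventuallyEq ?_).fderiv
  filter_upwards [(isOpen_repDomain hf.continuous q q').eventually_mem hx] with z hz
  simp only [chartFun, Function.comp, extChartAt_symm_rep hz]

theorem fderiv_rep_comp {f₁ f₂ : M → M} (hf₁ : ContMDiff (𝓡 n) (𝓡 n) ∞ f₁)
    (hf₂ : ContMDiff (𝓡 n) (𝓡 n) ∞ f₂) {q q' q'' : M} {x : EuclideanSpace ℝ (Fin n)}
    (hx : x ∈ repDomain f₁ q q') (hx' : rep f₁ q q' x ∈ repDomain f₂ q' q'') :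
    x ∈ repDomain (f₂ ∘ f₁) q q'' ∧ rep (f₂ ∘ f₁) q q'' x = rep f₂ q' q'' (rep f₁ q q' x) ∧
    fderiv ℝ (rep (f₂ ∘ f₁) q q'') x =
      (fderiv ℝ (rep f₂ q' q'') (rep f₁ q q' x)).comp (fderiv ℝ (rep f₁ q q') x) := by
  have e1 : ∀ z ∈ repDomain (n := n) f₁ q q', rep (f₂ ∘ f₁) q q'' z = rep f₂ q' q'' (rep f₁ q q' z) := by
    intro z hz
    simp only [rep, Function.comp]
    rw [(extChartAt (𝓡 n) q').left_inv hz.2]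
  refine ⟨⟨hx.1, ?_⟩, e1 x hx, ?_⟩
  · have := hx'.2
    rwa [extChartAt_symm_rep hx] at this
  · have h1 := ((contDiffAt_rep hx' hf₂.contMDiffAt).differentiableAt (by simp)).hasFDerivAt
    have h2 := ((contDiffAt_rep hx hf₁.contMDiffAt).differentiableAt (by simp)).hasFDerivAt
    refine ((h1.comp x h2).congr_of_eventuallyEq ?_).fderiv
    filter_upwards [(isOpen_repDomain hf₁.continuous q q').eventually_mem hx] with z hz
    exact e1 z hz

theorem injective_fderiv_chartFun {h : M → F} (hh : ContMDiff (𝓡 n) 𝓘(ℝ, F) ∞ h)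
    (hinj : ∀ p, Function.Injective (fder (n := n) h p)) {q : M}
    {x : EuclideanSpace ℝ (Fin n)} (hx : x ∈ (extChartAt (𝓡 n) q).target) :
    Function.Injective (fderiv ℝ (chartFun h q) x) := by
  rw [fderiv_chartFun hh hx]
  exact (hinj _).comp (isInvertible_chartD q hx).injective

/-- An immersion has a locally bounded left inverse of its derivative. -/
theorem exists_norm_le_fderiv_chartFun {h : M → F} (hh : ContMDiff (𝓡 n) 𝓘(ℝ, F) ∞ h)
    (hinj : ∀ p, Function.Injective (fder (n := n) h p)) {q : M}
    {x₀ : EuclideanSpace ℝ (Fin n)} (hx₀ : x₀ ∈ (extChartAt (𝓡 n) q).target) :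
    ∃ ρ κ : ℝ, 0 < ρ ∧ 0 < κ ∧ closedBall x₀ ρ ⊆ (extChartAt (𝓡 n) q).target ∧
      ∀ x ∈ closedBall x₀ ρ, ∀ v, ‖v‖ ≤ κ * ‖fderiv ℝ (chartFun h q) x v‖ := by
  obtain ⟨K, hK, hKa⟩ := (fderiv ℝ (chartFun h q) x₀).toLinearMap.exists_antilipschitzWith
    (LinearMap.ker_eq_bot.2 (injective_fderiv_chartFun hh hinj hx₀))
  have hK' : (0 : ℝ) < K := hK
  have hKb : ∀ v, ‖v‖ ≤ K * ‖fderiv ℝ (chartFun h q) x₀ v‖ := fun v ↦ by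
    have := hKa.le_mul_dist v 0
    simpa using this
  have hc : ContinuousAt (fderiv ℝ (chartFun h q)) x₀ :=
    (continuousOn_fderiv_chartFun hh q).continuousAt ((isOpen_extChartAt_target q).mem_nhds hx₀)
  have hev : ∀ᶠ x in 𝓝 x₀, x ∈ (extChartAt (𝓡 n) q).target ∧
      ‖fderiv ℝ (chartFun h q) x - fderiv ℝ (chartFun h q) x₀‖ < 1 / (2 * K) :=
    ((isOpen_extChartAt_target q).eventually_mem hx₀).and (by
      have := Metric.tendsto_nhds.1 hc (1 / (2 * K)) (by positivity)
      simpa only [dist_eq_norm] using this)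
  -- A perturbation of size `1 / (2 * K)` costs at most half of the lower bound at `x₀`, which is
  -- why `2 * K` serves nearby.
  obtain ⟨ρ, hρ, hb⟩ := Metric.nhds_basis_closedBall.eventually_iff.1 hev
  refine ⟨ρ, 2 * K, hρ, by positivity, fun x hx ↦ (hb hx).1, fun x hx v ↦ ?_⟩
  have h1 : ‖fderiv ℝ (chartFun h q) x₀ v‖ ≤ ‖fderiv ℝ (chartFun h q) x v‖ + 1 / (2 * K) * ‖v‖ := by
    have h2 := (fderiv ℝ (chartFun h q) x - fderiv ℝ (chartFun h q) x₀).le_of_opNorm_le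
      (hb hx).2.le v
    calc ‖fderiv ℝ (chartFun h q) x₀ v‖ = ‖fderiv ℝ (chartFun h q) x v -
          (fderiv ℝ (chartFun h q) x - fderiv ℝ (chartFun h q) x₀) v‖ := by simp
      _ ≤ _ := (norm_sub_le _ _).trans (by gcongr)
  have h3 := (hKb v).trans (mul_le_mul_of_nonneg_left h1 hK'.le)
  have h4 : (K : ℝ) * (1 / (2 * K) * ‖v‖) = ‖v‖ / 2 := by field_simp
  nlinarith

end Jets

/-! ### The derivative of the inverse isometry. -/

section Propagation

variable {n : ℕ} {M : Type*} [TopologicalSpace M]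
  [ChartedSpace (EuclideanSpace ℝ (Fin n)) M] [IsManifold (𝓡 n) ∞ M]
  {F : Type*} [NormedAddCommGroup F] [NormedSpace ℝ F] {g : LorentzMetric n M}

theorem fderiv_rep_inv_comp (Φ : isometryGroup g) {q q' : M} {x : EuclideanSpace ℝ (Fin n)}
    (hx : x ∈ repDomain Φ.1 q q') :
    rep Φ.1 q q' x ∈ repDomain (Φ⁻¹).1 q' q ∧ rep (Φ⁻¹).1 q' q (rep Φ.1 q q' x) = x ∧
    (fderiv ℝ (rep (Φ⁻¹).1 q' q) (rep Φ.1 q q' x)).comp (fderiv ℝ (rep Φ.1 q q') x) =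
      ContinuousLinearMap.id ℝ _ := by
  have hinv : ((Φ⁻¹).1 : M → M) ∘ Φ.1 = id := by ext z; exact Φ.1.symm_apply_apply z
  have h0 : (Φ⁻¹).1 (Φ.1 ((extChartAt (𝓡 n) q).symm x)) = (extChartAt (𝓡 n) q).symm x :=
    congrFun hinv _
  have hx' : rep Φ.1 q q' x ∈ repDomain (Φ⁻¹).1 q' q := by
    refine ⟨rep_mem_target hx, ?_⟩
    rw [extChartAt_symm_rep hx, h0]
    exact (extChartAt (𝓡 n) q).map_target hx.1
  obtain ⟨-, h2, h3⟩ := fderiv_rep_comp (contMDiff_isometry Φ) (contMDiff_isometry Φ⁻¹) hx hx'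
  rw [hinv] at h2 h3
  rw [← h2, ← h3, fderiv_rep_id hx.1]
  exact ⟨hx', (extChartAt (𝓡 n) q).right_inv hx.1, rfl⟩

/-- The inverse of the differential of an isometry is its adjoint for the two metrics, `G₁⁻¹ Lᵗ G₂`.
A bound on `L` thus bounds the inverse with no separate hypothesis. -/
theorem norm_fderiv_rep_inv_le [T2Space M] (Φ : isometryGroup g) {q q' : M}
    {x : EuclideanSpace ℝ (Fin n)} (hx : x ∈ repDomain Φ.1 q q') :
    ‖fderiv ℝ (rep (Φ⁻¹).1 q' q) (rep Φ.1 q q' x)‖ ≤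
      ‖(chartForm g q x).inverse‖ * (‖chartForm g q' (rep Φ.1 q q' x)‖ *
        ‖fderiv ℝ (rep Φ.1 q q') x‖) := by
  obtain ⟨h1, h2, -⟩ := fderiv_rep_inv_comp Φ hx
  obtain ⟨-, -, h3⟩ := fderiv_rep_inv_comp Φ⁻¹ h1
  rw [inv_inv, h2] at h3
  set T := fderiv ℝ (rep (Φ⁻¹).1 q' q) (rep Φ.1 q q' x)
  set L := fderiv ℝ (rep Φ.1 q q') x with hL
  refine T.opNorm_le_bound (by positivity) fun u ↦ ?_
  have h4 : L (T u) = u := DFunLike.congr_fun h3 u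
  have h5 : chartForm g q x (T u) = (chartForm g q' (rep Φ.1 q q' x) u).comp L := by
    ext w
    have h6 := (isLocIso_rep Φ q q').isometric x hx (T u) w
    rw [← hL, h4] at h6
    exact h6.symm
  have h7 : T u = (chartForm g q x).inverse ((chartForm g q' (rep Φ.1 q q' x) u).comp L) := by
    rw [← h5, ((isMetricOn_chartForm g q).nondeg x hx.1).inverse_apply_self]
  calc ‖T u‖ ≤ ‖(chartForm g q x).inverse‖ * ‖(chartForm g q' (rep Φ.1 q q' x) u).comp L‖ := by
        rw [h7]; exact ContinuousLinearMap.le_opNorm _ _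
    _ ≤ ‖(chartForm g q x).inverse‖ * (‖chartForm g q' (rep Φ.1 q q' x)‖ * ‖u‖ * ‖L‖) := by
        gcongr
        exact (ContinuousLinearMap.opNorm_comp_le _ _).trans
          (by gcongr; exact ContinuousLinearMap.le_opNorm _ _)
    _ = _ := by ring

end Propagation

/-! ### From bounded jets at one point to locally uniform bounds everywhere. -/

section Propagation

variable {n : ℕ} {M : Type*} [TopologicalSpace M]
  [ChartedSpace (EuclideanSpace ℝ (Fin n)) M] [IsManifold (𝓡 n) ∞ M]
  {F : Type*} [NormedAddCommGroup F] [NormedSpace ℝ F] {g : LorentzMetric n M}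

/-- The one-jets at `p` of the members of `G`, seen through `e`, are bounded. -/
def JetsBounded (G : Subgroup (isometryGroup g)) (e : M → F) (p : M) : Prop :=
  ∃ C, ∀ Φ ∈ G, ‖fder (n := n) (e ∘ Φ.1) p‖ ≤ C

/-- The two derivatives differ by `chartD q x`, which is invertible and does not depend on `Φ`. -/
theorem jetsBounded_iff (G : Subgroup (isometryGroup g)) {e : M → F}
    (he : ContMDiff (𝓡 n) 𝓘(ℝ, F) ∞ e) {q : M} {x : EuclideanSpace ℝ (Fin n)}
    (hx : x ∈ (extChartAt (𝓡 n) q).target) :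
    JetsBounded G e ((extChartAt (𝓡 n) q).symm x) ↔
      ∃ C, ∀ Φ ∈ G, ‖fderiv ℝ (chartFun (e ∘ Φ.1) q) x‖ ≤ C := by
  have key : ∀ Φ : isometryGroup g, fderiv ℝ (chartFun (e ∘ Φ.1) q) x =
      (fder (e ∘ Φ.1) ((extChartAt (𝓡 n) q).symm x)).comp (chartD q x) := fun Φ ↦
    fderiv_chartFun (he.comp (contMDiff_isometry Φ)) hx
  constructor
  · rintro ⟨C, hC⟩
    refine ⟨C * ‖chartD q x‖, fun Φ hΦ ↦ ?_⟩
    rw [key]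
    exact (ContinuousLinearMap.opNorm_comp_le _ _).trans (by gcongr; exact hC Φ hΦ)
  · rintro ⟨C, hC⟩
    refine ⟨C * ‖(chartD q x).inverse‖, fun Φ hΦ ↦ ?_⟩
    have h1 : fder (n := n) (e ∘ Φ.1) ((extChartAt (𝓡 n) q).symm x) =
        (fderiv ℝ (chartFun (e ∘ Φ.1) q) x).comp (chartD q x).inverse := by
      rw [key]
      ext v
      obtain ⟨w, rfl⟩ := (isInvertible_chartD q hx).surjective v
      simp [(isInvertible_chartD q hx).inverse_apply_self]
    rw [h1]
    exact (ContinuousLinearMap.opNorm_comp_le _ _).trans (by gcongr; exact hC Φ hΦ)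

variable [T2Space M] [CompactSpace M] [FirstCountableTopology M]

/-- In a sequence of isometries with bounded jets at a point, some member differs from infinitely
many others by an isometry whose jet at that point is almost trivial. -/
theorem exists_frequently_near_identity {e : M → F} (he : ContMDiff (𝓡 n) 𝓘(ℝ, F) ∞ e)
    (hinj : ∀ p, Function.Injective (fder (n := n) e p)) {q : M} {x : EuclideanSpace ℝ (Fin n)}
    (hx : x ∈ (extChartAt (𝓡 n) q).target) (Φ : ℕ → isometryGroup g) {C : ℝ}
    (hC : ∀ j, ‖fderiv ℝ (chartFun (e ∘ (Φ j).1) q) x‖ ≤ C) {η : ℝ} (hη : 0 < η) :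
    ∃ k, ∃ᶠ j in atTop, x ∈ repDomain (((Φ k)⁻¹ * Φ j).1 : M → M) q q ∧
      ‖rep (((Φ k)⁻¹ * Φ j).1 : M → M) q q x - x‖ < η ∧
      ‖fderiv ℝ (rep (((Φ k)⁻¹ * Φ j).1 : M → M) q q) x‖ ≤ 2 := by
  have hC0 : 0 ≤ C := (norm_nonneg _).trans (hC 0)
  -- Compactness of `M` makes the images of the base point converge along a subsequence. The
  -- immersion `e` turns the bound on `e ∘ Φ j` into a bound on the derivative in charts, so a
  -- further subsequence of one-jets converges.
  obtain ⟨y, φ, hφ, hy⟩ := CompactSpace.tendsto_subseq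
    (fun j ↦ (Φ j).1 ((extChartAt (𝓡 n) q).symm x))
  set y₀ := extChartAt (𝓡 n) y y with hy₀
  have hy₀t : y₀ ∈ (extChartAt (𝓡 n) y).target := mem_extChartAt_target y
  obtain ⟨ρ₁, κ, hρ₁, hκ, hball₁, hκb⟩ := exists_norm_le_fderiv_chartFun he hinj hy₀t
  obtain ⟨ρ₃, hρ₃, hball₃⟩ := Metric.nhds_basis_closedBall.mem_iff.1
    ((isOpen_extChartAt_target (I := 𝓡 n) q).mem_nhds hx)
  have ha : Tendsto (fun j ↦ rep (Φ (φ j)).1 q y x) atTop (𝓝 y₀) :=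
    (continuousAt_extChartAt (I := 𝓡 n) y).tendsto.comp hy
  have hdom : ∀ᶠ j in atTop, x ∈ repDomain (Φ (φ j)).1 q y :=
    (hy.eventually ((isOpen_extChartAt_source (I := 𝓡 n) y).eventually_mem
      (mem_extChartAt_source y))).mono fun j hj ↦ ⟨hx, hj⟩
  have hL : ∀ᶠ j in atTop, x ∈ repDomain (Φ (φ j)).1 q y ∧ rep (Φ (φ j)).1 q y x ∈ closedBall y₀ ρ₁ ∧
      ‖fderiv ℝ (rep (Φ (φ j)).1 q y) x‖ ≤ κ * C := by
    filter_upwards [hdom, ha.eventually (closedBall_mem_nhds y₀ hρ₁)] with j hj hj'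
    refine ⟨hj, hj', ContinuousLinearMap.opNorm_le_bound _ (by positivity) fun v ↦ ?_⟩
    refine (hκb _ hj' _).trans ?_
    have h1 := fderiv_chartFun_comp he (contMDiff_isometry (Φ (φ j))) hj
    have h2 := DFunLike.congr_fun h1 v
    rw [ContinuousLinearMap.comp_apply] at h2
    rw [← h2, mul_assoc]
    gcongr
    exact ContinuousLinearMap.le_of_opNorm_le _ (hC _) v
  obtain ⟨L, -, ψ, hψ, hLψ⟩ := tendsto_subseq_of_frequently_bounded
    (isBounded_closedBall (x := (0 : EuclideanSpace ℝ (Fin n) →L[ℝ] EuclideanSpace ℝ (Fin n)))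
      (r := κ * C)) (x := fun j ↦ fderiv ℝ (rep (Φ (φ j)).1 q y) x)
    (hL.mono fun j hj ↦ by simpa using hj.2.2).frequently
  obtain ⟨S, hS⟩ := (isCompact_closedBall y₀ ρ₁).exists_bound_of_continuousOn
    ((isMetricOn_chartForm g y).contDiffOn.continuousOn.mono hball₁)
  have hS0 : 0 ≤ S := (norm_nonneg _).trans (hS y₀ (mem_closedBall_self hρ₁.le))
  set C₁ := ‖(chartForm g q x).inverse‖ * (S * (κ * C)) with hC₁
  have hC₁0 : 0 ≤ C₁ := by positivity
  have hρ₂ : 0 < min ρ₁ ρ₃ := lt_min hρ₁ hρ₃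
  -- Propagation is for `(Φ k)⁻¹`: in the composition it is evaluated at the image of `x` under `Φ
  -- j`, which is only close to the image under `Φ k`.
  obtain ⟨r, B, hr, -, hB, hprop⟩ := exists_propagation (isMetricOn_chartForm g y)
    (isMetricOn_chartForm g q) hρ₂
    ((closedBall_subset_closedBall (min_le_left _ _)).trans hball₁)
    ((closedBall_subset_closedBall (min_le_right _ _)).trans hball₃) C₁
  -- Here `δ` bounds the distance between the one-jets of `Φ j` and `Φ k`. The first condition
  -- controls the displacement of `x`; the other two bound the errors in `θ'(aj) Lj = id + (θ'(aj) -
  -- θ'(ak)) Lj + θ'(ak) (Lj - Lk)`, where `θ` represents `(Φ k)⁻¹`.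
  obtain ⟨δ, hδ, hδ1, hδ2, hδ3⟩ : ∃ δ > 0, (C₁ + 1) * δ < η ∧ B * δ * (κ * C) ≤ 1 / 2 ∧
      C₁ * δ ≤ 1 / 2 := by
    have h1 : Tendsto (fun δ : ℝ ↦ (C₁ + 1) * δ) (𝓝[>] 0) (𝓝 ((C₁ + 1) * 0)) :=
      (Continuous.tendsto (by fun_prop) 0).mono_left nhdsWithin_le_nhds
    have h2 : Tendsto (fun δ : ℝ ↦ B * δ * (κ * C)) (𝓝[>] 0) (𝓝 (B * 0 * (κ * C))) :=
      (Continuous.tendsto (by fun_prop) 0).mono_left nhdsWithin_le_nhds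
    have h3 : Tendsto (fun δ : ℝ ↦ C₁ * δ) (𝓝[>] 0) (𝓝 (C₁ * 0)) :=
      (Continuous.tendsto (by fun_prop) 0).mono_left nhdsWithin_le_nhds
    obtain ⟨δ, hδ, h4, h5, h6⟩ := (eventually_mem_nhdsWithin.and
      ((h1.eventually_lt_const (by simpa using hη)).and
      ((h2.eventually_lt_const (show B * 0 * (κ * C) < 1 / 2 by simp)).and
      (h3.eventually_lt_const (show C₁ * 0 < 1 / 2 by simp))))).exists
    exact ⟨δ, hδ, h4, h5.le, h6.le⟩
  have hev : ∀ᶠ j in atTop, (x ∈ repDomain (Φ (φ (ψ j))).1 q y ∧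
      rep (Φ (φ (ψ j))).1 q y x ∈ closedBall y₀ ρ₁ ∧
      ‖fderiv ℝ (rep (Φ (φ (ψ j))).1 q y) x‖ ≤ κ * C) ∧
      rep (Φ (φ (ψ j))).1 q y x ∈ ball y₀ r ∧
      dist (rep (Φ (φ (ψ j))).1 q y x) y₀ < δ / 2 ∧
      dist (fderiv ℝ (rep (Φ (φ (ψ j))).1 q y) x) L < δ / 2 :=
    (hψ.tendsto_atTop.eventually hL).and (((ha.comp hψ.tendsto_atTop).eventually
      (ball_mem_nhds y₀ hr)).and ((Metric.tendsto_nhds.1 (ha.comp hψ.tendsto_atTop) _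
      (half_pos hδ)).and (Metric.tendsto_nhds.1 hLψ _ (half_pos hδ))))
  obtain ⟨N, hN⟩ := eventually_atTop.1 hev
  refine ⟨φ (ψ N), (hφ.tendsto_atTop.comp hψ.tendsto_atTop).frequently
    (eventually_atTop.2 ⟨N, fun j hj ↦ ?_⟩).frequently⟩
  obtain ⟨⟨hk1, hk2, hk3⟩, hk4, hk5, hk6⟩ := hN N le_rfl
  obtain ⟨⟨hj1, hj2, hj3⟩, hj4, hj5, hj6⟩ := hN j hj
  simp only [Function.comp]
  set Φk := Φ (φ (ψ N))
  set Φj := Φ (φ (ψ j))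
  obtain ⟨t1, t2, t3⟩ := fderiv_rep_inv_comp Φk hk1
  have t4 := norm_fderiv_rep_inv_le Φk hk1
  set ak := rep Φk.1 q y x with hak
  set aj := rep Φj.1 q y x with haj
  set Lk := fderiv ℝ (rep Φk.1 q y) x
  set Lj := fderiv ℝ (rep Φj.1 q y) x
  set θ := rep (n := n) (Φk⁻¹).1 y q with hθ
  have hdist : ‖aj - ak‖ ≤ δ := by
    rw [← dist_eq_norm]
    exact (dist_triangle_right _ _ y₀).trans (by linarith)
  have hdistL : ‖Lj - Lk‖ ≤ δ := by
    rw [← dist_eq_norm]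
    exact (dist_triangle_right _ _ L).trans (by linarith)
  have hθk : ‖fderiv ℝ θ ak‖ ≤ C₁ := by
    refine t4.trans ?_
    rw [hC₁]
    gcongr
    exact hS _ hk2
  have hiso := isLocIso_rep Φk⁻¹ y q
  have hp := hprop _ _ hiso ak hk4 t1 (show θ ak ∈ ball x r by rw [t2]; exact mem_ball_self hr) hθk
  have hθd : ‖fderiv ℝ θ aj - fderiv ℝ θ ak‖ ≤ B * δ := by
    refine ((convex_ball y₀ r).norm_image_sub_le_of_norm_fderiv_le
      (fun z hz ↦ (hiso.hasFDerivAt_fderiv (isMetricOn_chartForm g y) (isMetricOn_chartForm g q)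
        (hp z hz).1).differentiableAt) (fun z hz ↦ (hp z hz).2.2.2) hk4 hj4).trans ?_
    gcongr
  have hθd0 : ‖θ aj - θ ak‖ ≤ (C₁ + 1) * δ := by
    refine ((convex_ball y₀ r).norm_image_sub_le_of_norm_fderiv_le
      (fun z hz ↦ (hiso.hasFDerivAt (hp z hz).1).differentiableAt)
      (fun z hz ↦ (hp z hz).2.2.1) hk4 hj4).trans ?_
    gcongr
  obtain ⟨s1, s2, s3⟩ := fderiv_rep_comp (contMDiff_isometry Φj) (contMDiff_isometry Φk⁻¹) hj1
    (hp aj hj4).1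
  change x ∈ repDomain ((Φk⁻¹).1 ∘ Φj.1) q q ∧ ‖rep ((Φk⁻¹).1 ∘ Φj.1) q q x - x‖ < η ∧
    ‖fderiv ℝ (rep ((Φk⁻¹).1 ∘ Φj.1) q q) x‖ ≤ 2
  refine ⟨s1, ?_, ?_⟩
  · rw [s2]
    rw [t2] at hθd0
    exact hθd0.trans_lt hδ1
  · rw [s3]
    have e1 : (fderiv ℝ θ aj).comp Lj = (fderiv ℝ θ aj - fderiv ℝ θ ak).comp Lj +
        (fderiv ℝ θ ak).comp (Lj - Lk) + ContinuousLinearMap.id ℝ _ := by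
      rw [← t3]
      ext v
      simp
    change ‖(fderiv ℝ θ aj).comp Lj‖ ≤ 2
    rw [e1]
    calc _ ≤ ‖(fderiv ℝ θ aj - fderiv ℝ θ ak).comp Lj‖ + ‖(fderiv ℝ θ ak).comp (Lj - Lk)‖ +
          ‖ContinuousLinearMap.id ℝ (EuclideanSpace ℝ (Fin n))‖ := norm_add₃_le
      _ ≤ B * δ * (κ * C) + C₁ * δ + 1 := by
        gcongr
        · exact (ContinuousLinearMap.opNorm_comp_le _ _).trans (by gcongr)
        · exact (ContinuousLinearMap.opNorm_comp_le _ _).trans (by gcongr)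
        · exact ContinuousLinearMap.norm_id_le
      _ ≤ 2 := by linarith

/-- Every point has a neighbourhood on which boundedness of the jets at one point implies uniform
boundedness. -/
theorem exists_jets_uniform (G : Subgroup (isometryGroup g)) {e : M → F}
    (he : ContMDiff (𝓡 n) 𝓘(ℝ, F) ∞ e) (hinj : ∀ p, Function.Injective (fder (n := n) e p))
    (q : M) : ∃ r > 0, ball (extChartAt (𝓡 n) q q) r ⊆ (extChartAt (𝓡 n) q).target ∧
      ∀ x ∈ ball (extChartAt (𝓡 n) q q) r,
        JetsBounded G e ((extChartAt (𝓡 n) q).symm x) →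
        ∃ C, ∀ z ∈ ball (extChartAt (𝓡 n) q q) r, ∀ Φ ∈ G,
          ‖fderiv ℝ (chartFun (e ∘ Φ.1) q) z‖ ≤ C := by
  set x₀ := extChartAt (𝓡 n) q q with hx₀
  obtain ⟨ρ, hρ, hball⟩ := Metric.nhds_basis_closedBall.mem_iff.1
    ((isOpen_extChartAt_target (I := 𝓡 n) q).mem_nhds (mem_extChartAt_target q))
  -- The radius is chosen for the fixed bound `2`. It must not depend on the bound for `G` at `x`,
  -- for otherwise the set of points with bounded jets could fail to be closed.
  obtain ⟨r, B, hr, hrρ, -, hprop⟩ := exists_propagation (isMetricOn_chartForm g q)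
    (isMetricOn_chartForm g q) hρ hball hball 2
  have hsub : ball x₀ r ⊆ (extChartAt (𝓡 n) q).target :=
    ball_subset_closedBall.trans ((closedBall_subset_closedBall hrρ).trans hball)
  refine ⟨r, hr, hsub, fun x hx hJ ↦ ?_⟩
  obtain ⟨C, hC⟩ := (jetsBounded_iff G he (hsub hx)).1 hJ
  -- Factor `Φ j = Φ k * Ψ` with `k` fixed. The jet of `Ψ` is bounded by `2` at `x`, hence by `3` on
  -- the ball, while `e ∘ Φ k` is a single map with derivative bounded by `S`. So `3 * S` bounds the
  -- jet of `Φ j` for arbitrarily large `j`.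
  by_contra! hcon
  choose z hz Φ hΦ hbig using fun j : ℕ ↦ hcon j
  obtain ⟨k, hk⟩ := exists_frequently_near_identity he hinj (hsub hx) Φ (fun j ↦ hC _ (hΦ j))
    (η := r - dist x x₀) (by rw [mem_ball] at hx; linarith)
  obtain ⟨S, hS⟩ := (isCompact_closedBall x₀ ρ).exists_bound_of_continuousOn
    ((continuousOn_fderiv_chartFun (he.comp (contMDiff_isometry (Φ k))) q).mono hball)
  obtain ⟨N, hN⟩ := exists_nat_gt (S * 3)
  obtain ⟨j, hNj, h1, h2, h3⟩ := (frequently_atTop.1 hk) N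
  set Ψ := (Φ k)⁻¹ * Φ j with hΨ
  have h4 : rep Ψ.1 q q x ∈ ball x₀ r := by
    rw [mem_ball]
    refine (dist_triangle _ x _).trans_lt ?_
    rw [dist_eq_norm]
    linarith
  obtain ⟨p1, p2, p3, -⟩ := hprop _ _ (isLocIso_rep Ψ q q) x hx h1 h4 h3 (z j) (hz j)
  have h5 := fderiv_chartFun_comp (he.comp (contMDiff_isometry (Φ k))) (contMDiff_isometry Ψ) p1
  have h6 : (e ∘ (Φ k).1) ∘ Ψ.1 = e ∘ (Φ j).1 := by
    have : Φ k * Ψ = Φ j := by rw [hΨ]; group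
    rw [← this]
    rfl
  rw [h6] at h5
  have h7 := hbig j
  rw [h5] at h7
  have h8 := (ContinuousLinearMap.opNorm_comp_le (fderiv ℝ (chartFun (e ∘ (Φ k).1) q)
    (rep Ψ.1 q q (z j))) (fderiv ℝ (rep Ψ.1 q q) (z j))).trans
    (mul_le_mul (hS _ p2) p3 (norm_nonneg _) ((norm_nonneg _).trans (hS _ p2)))
  have h9 : (N : ℝ) ≤ j := by exact_mod_cast hNj
  norm_num at h8
  linarith

/-- On a connected manifold, boundedness of the jets at one point implies local uniform
boundedness everywhere. -/
theorem exists_jets_uniform_of_jetsBounded [ConnectedSpace M] (G : Subgroup (isometryGroup g))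
    {e : M → F} (he : ContMDiff (𝓡 n) 𝓘(ℝ, F) ∞ e)
    (hinj : ∀ p, Function.Injective (fder (n := n) e p)) {p₀ : M} (hp₀ : JetsBounded G e p₀)
    (q : M) : ∃ r > 0, ball (extChartAt (𝓡 n) q q) r ⊆ (extChartAt (𝓡 n) q).target ∧
      ∃ C, ∀ z ∈ ball (extChartAt (𝓡 n) q q) r, ∀ Φ ∈ G,
          ‖fderiv ℝ (chartFun (e ∘ Φ.1) q) z‖ ≤ C := by
  -- The neighbourhood works from any of its points to any other, so it yields both openness and
  -- closedness of the set of points with bounded jets.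
  have hnear : ∀ q : M, ∃ U ∈ 𝓝 q, ∀ p ∈ U, JetsBounded G e p → ∀ p' ∈ U, JetsBounded G e p' := by
    intro q
    obtain ⟨r, hr, hsub, h⟩ := exists_jets_uniform G he hinj q
    refine ⟨(extChartAt (𝓡 n) q).source ∩ extChartAt (𝓡 n) q ⁻¹' ball (extChartAt (𝓡 n) q q) r,
      inter_mem (extChartAt_source_mem_nhds q)
        ((continuousAt_extChartAt q).preimage_mem_nhds (ball_mem_nhds _ hr)), ?_⟩
    rintro p ⟨hp, hpr⟩ hJ p' ⟨hp', hpr'⟩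
    rw [← (extChartAt (𝓡 n) q).left_inv hp] at hJ
    rw [← (extChartAt (𝓡 n) q).left_inv hp']
    obtain ⟨C, hC⟩ := h _ hpr hJ
    exact (jetsBounded_iff G he (hsub hpr')).2 ⟨C, fun Φ hΦ ↦ hC _ hpr' Φ hΦ⟩
  have hclopen : IsClopen {p | JetsBounded G e p} := by
    constructor
    · rw [isClosed_iff_frequently]
      intro q hq
      obtain ⟨U, hU, h⟩ := hnear q
      obtain ⟨p, hpJ, hpU⟩ := (hq.and_eventually hU).exists
      exact h p hpU hpJ q (mem_of_mem_nhds hU)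
    · rw [isOpen_iff_mem_nhds]
      intro q hq
      obtain ⟨U, hU, h⟩ := hnear q
      exact mem_of_superset hU fun p hp ↦ h q (mem_of_mem_nhds hU) hq p hp
  have huniv : {p | JetsBounded G e p} = univ := hclopen.eq_univ ⟨p₀, hp₀⟩
  obtain ⟨r, hr, hsub, h⟩ := exists_jets_uniform G he hinj q
  refine ⟨r, hr, hsub, h _ (mem_ball_self hr) ?_⟩
  rw [extChartAt_to_inv]
  exact (huniv ▸ mem_univ q : q ∈ {p | JetsBounded G e p})

end Propagation

/-! ### Closed groups of isometries with bounded jets are compact. -/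

section Compactness

variable {n : ℕ} {M : Type*} [MetricSpace M]
  [ChartedSpace (EuclideanSpace ℝ (Fin n)) M] [IsManifold (𝓡 n) ∞ M]
  [CompactSpace M]
  {F : Type*} [NormedAddCommGroup F] [NormedSpace ℝ F] {g : LorentzMetric n M}

/-- An isometry as a continuous map. -/
def toCM (Φ : isometryGroup g) : C(M, M) := ⟨Φ.1, Φ.1.continuous⟩

theorem exists_tendsto_subseq (G : Subgroup (isometryGroup g))
    (hG : Equicontinuous (fun Φ : G ↦ (Φ.1.1 : M → M))) (Φ : ℕ → isometryGroup g)
    (hΦ : ∀ j, Φ j ∈ G) :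
    ∃ (f : C(M, M)) (φ : ℕ → ℕ), StrictMono φ ∧ Tendsto (fun j ↦ toCM (Φ (φ j))) atTop (𝓝 f) := by
  set ι := ContinuousMap.isometryEquivBoundedOfCompact M M
  set A : Set (BoundedContinuousFunction M M) := (fun Φ : isometryGroup g ↦ ι (toCM Φ)) '' G
  have hA : IsCompact (closure A) := by
    refine BoundedContinuousFunction.arzela_ascoli univ isCompact_univ A
      (fun _ _ _ ↦ mem_univ _) ?_
    intro x U hU
    filter_upwards [hG x U hU] with y hy a
    obtain ⟨_, Ψ, hΨ, rfl⟩ := a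
    exact hy ⟨Ψ, hΨ⟩
  obtain ⟨a, -, φ, hφ, ha⟩ := hA.tendsto_subseq (x := fun j ↦ ι (toCM (Φ j)))
    (fun j ↦ subset_closure (mem_image_of_mem _ (hΦ j)))
  refine ⟨ι.symm a, φ, hφ, ?_⟩
  have := (ι.symm.continuous.tendsto a).comp ha
  refine this.congr fun j ↦ ?_
  simp

variable [ConnectedSpace M]

/-- A uniform limit of isometries from a group with bounded jets is a smooth isometry. -/
theorem limit_isometry (G : Subgroup (isometryGroup g)) {e : M → F}
    (he : ContMDiff (𝓡 n) 𝓘(ℝ, F) ∞ e) (hinj : ∀ p, Function.Injective (fder (n := n) e p))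
    {p₀ : M} (hp₀ : JetsBounded G e p₀) {Φ : ℕ → isometryGroup g} (hΦ : ∀ j, Φ j ∈ G)
    {f : C(M, M)} (hf : Tendsto (fun j ↦ toCM (Φ j)) atTop (𝓝 f)) (p : M) :
    ContMDiffAt (𝓡 n) (𝓡 n) ∞ f p ∧
      ∀ v w, g.bil (f p) (mder f p v) (mder f p w) = g.bil p v w := by
  set x₀ := extChartAt (𝓡 n) p p with hx₀
  set y₀ := extChartAt (𝓡 n) (f p) (f p) with hy₀
  obtain ⟨r₁, hr₁, hsub₁, C, hC⟩ := exists_jets_uniform_of_jetsBounded G he hinj hp₀ p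
  obtain ⟨ρ, κ, hρ, hκ, hball, hκb⟩ :=
    exists_norm_le_fderiv_chartFun he hinj (mem_extChartAt_target (I := 𝓡 n) (f p))
  have hx₀t : x₀ ∈ (extChartAt (𝓡 n) p).target := mem_extChartAt_target p
  have hsymm : (extChartAt (𝓡 n) p).symm x₀ = p := extChartAt_to_inv p
  set V := (extChartAt (𝓡 n) (f p)).source ∩ extChartAt (𝓡 n) (f p) ⁻¹' ball y₀ ρ with hV
  have hVo : IsOpen V := (continuousOn_extChartAt (f p)).isOpen_inter_preimage
    (isOpen_extChartAt_source (f p)) isOpen_ball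
  have hpV : f p ∈ V := ⟨mem_extChartAt_source (f p), mem_ball_self hρ⟩
  obtain ⟨r, hr, hrr, hrt, hrV⟩ : ∃ r > 0, r ≤ r₁ ∧ closedBall x₀ r ⊆ (extChartAt (𝓡 n) p).target ∧
      ∀ x ∈ closedBall x₀ r, f ((extChartAt (𝓡 n) p).symm x) ∈ V := by
    have hc : ContinuousAt (fun x ↦ f ((extChartAt (𝓡 n) p).symm x)) x₀ :=
      f.continuous.continuousAt.comp (continuousAt_extChartAt_symm'' hx₀t)
    have hev : ∀ᶠ x in 𝓝 x₀, x ∈ (extChartAt (𝓡 n) p).target ∧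
        f ((extChartAt (𝓡 n) p).symm x) ∈ V :=
      ((isOpen_extChartAt_target p).eventually_mem hx₀t).and
        (hc.eventually (hVo.mem_nhds (show f ((extChartAt (𝓡 n) p).symm x₀) ∈ V by rw [hsymm]; exact hpV)))
    obtain ⟨s, hs, h⟩ := Metric.nhds_basis_closedBall.eventually_iff.1 hev
    refine ⟨min s r₁, lt_min hs hr₁, min_le_right _ _, fun x hx ↦ ?_, fun x hx ↦ ?_⟩
    · exact (h (closedBall_subset_closedBall (min_le_left _ _) hx)).1
    · exact (h (closedBall_subset_closedBall (min_le_left _ _) hx)).2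
  set K := (extChartAt (𝓡 n) p).symm '' closedBall x₀ r with hK
  have hKc : IsCompact K := (isCompact_closedBall x₀ r).image_of_continuousOn
    ((continuousOn_extChartAt_symm p).mono hrt)
  have hmaps : ∀ᶠ j in atTop, MapsTo (toCM (Φ j)) K V :=
    hf.eventually (ContinuousMap.eventually_mapsTo hKc hVo
      (by rintro _ ⟨x, hx, rfl⟩; exact hrV x hx))
  -- Shifting the index by `N` puts every map of the sequence in the same pair of charts over the
  -- whole ball.
  obtain ⟨N, hN⟩ := eventually_atTop.1 hmaps
  have hdom : ∀ j, ∀ x ∈ closedBall x₀ r, x ∈ repDomain (Φ (j + N)).1 p (f p) ∧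
      rep (Φ (j + N)).1 p (f p) x ∈ closedBall y₀ ρ := by
    intro j x hx
    have := hN (j + N) (Nat.le_add_left _ _) (mem_image_of_mem _ hx)
    exact ⟨⟨hrt hx, this.1⟩, ball_subset_closedBall this.2⟩
  have hbd : ∀ j, ∀ x ∈ ball x₀ r, ‖fderiv ℝ (rep (Φ (j + N)).1 p (f p)) x‖ ≤ κ * C := by
    intro j x hx
    have hxc := ball_subset_closedBall hx
    have hC0 : 0 ≤ C := (norm_nonneg _).trans (hC x (ball_subset_ball hrr hx) _ (hΦ 0))
    refine ContinuousLinearMap.opNorm_le_bound _ (by positivity) fun v ↦ ?_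
    refine (hκb _ (hdom j x hxc).2 _).trans ?_
    have h2 := DFunLike.congr_fun (fderiv_chartFun_comp he (contMDiff_isometry (Φ (j + N)))
      (hdom j x hxc).1) v
    rw [ContinuousLinearMap.comp_apply] at h2
    rw [← h2, mul_assoc]
    gcongr
    exact ContinuousLinearMap.le_of_opNorm_le _ (hC x (ball_subset_ball hrr hx) _ (hΦ _)) v
  have hlim : TendstoUniformlyOn (fun j ↦ rep (Φ (j + N)).1 p (f p)) (rep f p (f p)) atTop
      (ball x₀ r) := by
    have hK' : IsCompact ((extChartAt (𝓡 n) (f p)).symm '' closedBall y₀ ρ) :=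
      (isCompact_closedBall y₀ ρ).image_of_continuousOn
        ((continuousOn_extChartAt_symm (f p)).mono hball)
    have hVK : ∀ z ∈ V, z ∈ (extChartAt (𝓡 n) (f p)).symm '' closedBall y₀ ρ := fun z hz ↦
      ⟨_, ball_subset_closedBall hz.2, (extChartAt (𝓡 n) (f p)).left_inv hz.1⟩
    have huc : UniformContinuousOn (extChartAt (𝓡 n) (f p))
        ((extChartAt (𝓡 n) (f p)).symm '' closedBall y₀ ρ) :=
      hK'.uniformContinuousOn_of_continuous ((continuousOn_extChartAt (f p)).mono (by
        rintro _ ⟨y, hy, rfl⟩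
        exact (extChartAt (𝓡 n) (f p)).map_target (hball hy)))
    rw [Metric.uniformContinuousOn_iff] at huc
    rw [Metric.tendstoUniformlyOn_iff]
    intro ε hε
    obtain ⟨δ, hδ, h⟩ := huc ε hε
    have h1 := Metric.tendsto_nhds.1 (hf.comp (tendsto_add_atTop_nat N)) δ hδ
    filter_upwards [h1] with j hj x hx
    have hxc := ball_subset_closedBall hx
    refine h _ (hVK _ (hrV x hxc)) _
      (hVK _ (hN (j + N) (Nat.le_add_left _ _) (mem_image_of_mem _ hxc))) ?_
    rw [dist_comm]
    exact (ContinuousMap.dist_apply_le_dist _).trans_lt hj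
  obtain ⟨hs, hi⟩ := limit_isometric (isMetricOn_chartForm g p) (isMetricOn_chartForm g (f p)) hr
    hrt hball (fun j ↦ isLocIso_rep (Φ (j + N)) p (f p))
    (fun j x hx ↦ (hdom j x (ball_subset_closedBall hx)).1)
    (fun j x hx ↦ (hdom j x (ball_subset_closedBall hx)).2) hbd hlim
  have hmem : x₀ ∈ ball x₀ (r / 2) := mem_ball_self (half_pos hr)
  have hx₀d : x₀ ∈ repDomain f p (f p) := ⟨hx₀t, by rw [hsymm]; exact hpV.1⟩
  have h1 := contMDiffAt_of_contDiffAt_rep f.continuous hx₀d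
    (hs.contDiffAt (isOpen_ball.mem_nhds hmem))
  have h2 := form_mfderiv_eq_of_rep g f.continuous hx₀d h1 (hi x₀ hmem)
  rw [hsymm] at h1 h2
  exact ⟨h1, h2⟩

/-- Distances in `M` are norms of differences of values of `e`, so the mean value inequality for `e
∘ Φ` on a chart ball gives a Lipschitz estimate independent of `Φ`. -/
theorem equicontinuous_of_jetsBounded (G : Subgroup (isometryGroup g)) {e : M → F}
    (he : ContMDiff (𝓡 n) 𝓘(ℝ, F) ∞ e) (hinj : ∀ p, Function.Injective (fder (n := n) e p))
    (hd : ∀ p q, dist p q = dist (e p) (e q)) {p₀ : M} (hp₀ : JetsBounded G e p₀) :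
    Equicontinuous (fun Φ : G ↦ (Φ.1.1 : M → M)) := by
  intro q
  rw [Metric.equicontinuousAt_iff_right]
  intro ε hε
  obtain ⟨r, hr, hsub, C, hC⟩ := exists_jets_uniform_of_jetsBounded G he hinj hp₀ q
  have h1 : Tendsto (fun p ↦ C * ‖extChartAt (𝓡 n) q p - extChartAt (𝓡 n) q q‖) (𝓝 q)
      (𝓝 (C * ‖extChartAt (𝓡 n) q q - extChartAt (𝓡 n) q q‖)) :=
    (((continuousAt_extChartAt (I := 𝓡 n) q).tendsto.sub_const _).norm).const_mul C
  filter_upwards [h1.eventually_lt_const (show _ < ε by simpa using hε),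
    extChartAt_source_mem_nhds (I := 𝓡 n) q,
    (continuousAt_extChartAt (I := 𝓡 n) q).preimage_mem_nhds (ball_mem_nhds _ hr)] with p hp hps hpb Φ
  rw [hd, dist_comm, dist_eq_norm]
  refine lt_of_le_of_lt ?_ hp
  have h2 := (convex_ball (extChartAt (𝓡 n) q q) r).norm_image_sub_le_of_norm_fderiv_le
    (f := chartFun (e ∘ Φ.1.1) q) (fun z hz ↦ (contDiffAt_chartFun
      (he.comp (contMDiff_isometry Φ.1)) (hsub hz)).differentiableAt (by simp))
    (fun z hz ↦ hC z hz Φ.1 Φ.2) (mem_ball_self hr) hpb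
  simp only [chartFun, Function.comp, (extChartAt (𝓡 n) q).left_inv hps, extChartAt_to_inv] at h2
  exact h2

/-- A closed group of isometries whose jets are bounded at one point is compact. -/
theorem isCompact_of_jetsBounded (G : Subgroup (isometryGroup g))
    (hclosed : IsClosed (G : Set (isometryGroup g))) {e : M → F}
    (he : ContMDiff (𝓡 n) 𝓘(ℝ, F) ∞ e) (hinj : ∀ p, Function.Injective (fder (n := n) e p))
    (hd : ∀ p q, dist p q = dist (e p) (e q)) {p₀ : M} (hp₀ : JetsBounded G e p₀) :
    IsCompact (G : Set (isometryGroup g)) := by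
  have hind : IsInducing (toCM : isometryGroup g → C(M, M)) := ⟨rfl⟩
  have heq := equicontinuous_of_jetsBounded G he hinj hd hp₀
  rw [hind.isCompact_iff]
  refine IsSeqCompact.isCompact fun u hu ↦ ?_
  choose Φ hΦ hΦu using hu
  obtain ⟨f, φ, hφ, hf⟩ := exists_tendsto_subseq G heq Φ hΦ
  -- A uniform limit of homeomorphisms need not be one. The inverses also subconverge, and
  -- continuity of composition makes their limit inverse to `f`.
  obtain ⟨f', ψ, hψ, hf'⟩ := exists_tendsto_subseq G heq (fun j ↦ (Φ (φ j))⁻¹)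
    (fun j ↦ G.inv_mem (hΦ _))
  have hf₂ : Tendsto (fun j ↦ toCM (Φ (φ (ψ j)))) atTop (𝓝 f) := hf.comp hψ.tendsto_atTop
  have hl : f'.comp f = ContinuousMap.id M := by
    refine tendsto_nhds_unique (hf'.compCM hf₂) (tendsto_const_nhds.congr fun j ↦ ?_)
    ext z
    exact ((Φ (φ (ψ j))).1.symm_apply_apply z).symm
  have hr : f.comp f' = ContinuousMap.id M := by
    refine tendsto_nhds_unique (hf₂.compCM hf') (tendsto_const_nhds.congr fun j ↦ ?_)
    ext z
    exact ((Φ (φ (ψ j))).1.apply_symm_apply z).symm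
  let Ψ : M ≃ₜ M :=
    { toFun := f
      invFun := f'
      left_inv := fun z ↦ DFunLike.congr_fun hl z
      right_inv := fun z ↦ DFunLike.congr_fun hr z
      continuous_toFun := f.continuous
      continuous_invFun := f'.continuous }
  have hlim := limit_isometry G he hinj hp₀ (fun j ↦ hΦ (φ (ψ j))) hf₂
  have hlim' := limit_isometry G he hinj hp₀ (fun j ↦ G.inv_mem (hΦ (φ (ψ j)))) hf'
  have hΨ : Ψ ∈ isometryGroup g :=
    ⟨fun p ↦ (hlim p).1, fun p ↦ (hlim' p).1, fun p v w ↦ (hlim p).2 v w⟩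
  have htend : Tendsto (fun j ↦ Φ (φ (ψ j))) atTop (𝓝 (⟨Ψ, hΨ⟩ : isometryGroup g)) := by
    rw [hind.tendsto_nhds_iff]
    exact hf₂
  refine ⟨f, ⟨⟨Ψ, hΨ⟩, hclosed.mem_of_tendsto htend (Eventually.of_forall fun j ↦ hΦ _), rfl⟩,
    φ ∘ ψ, hφ.comp hψ, ?_⟩
  exact hf₂.congr fun j ↦ hΦu _

end Compactness

/-! ### The Killing equation, proportional Killing fields, and curves with common points. -/

section KillingLocal

variable {E : Type*} [NormedAddCommGroup E] [NormedSpace ℝ E]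

/-- The generator of a local flow `H`. -/
def generator (H : ℝ × E → E) (x : E) : E := fderiv ℝ H (0, x) (1, 0)

theorem hasFDerivAt_generator {H : ℝ × E → E} {x₀ : E} (hH : ContDiffAt ℝ ∞ H (0, x₀)) :
    HasFDerivAt (generator H) (((fderiv ℝ (fderiv ℝ H) (0, x₀)).flip (1, 0)).comp
      (ContinuousLinearMap.inr ℝ ℝ E)) x₀ := by
  have h1 : HasFDerivAt (fderiv ℝ H) (fderiv ℝ (fderiv ℝ H) (0, x₀)) (0, x₀) :=
    ((hH.fderiv_right (m := ∞) (by simp)).differentiableAt (by simp)).hasFDerivAt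
  have h2 : HasFDerivAt (fun x : E ↦ ((0 : ℝ), x)) (ContinuousLinearMap.inr ℝ ℝ E) x₀ :=
    hasFDerivAt_prodMk_right 0 x₀
  have h3 := (h1.comp x₀ h2).clm_apply (hasFDerivAt_const ((1 : ℝ), (0 : E)) x₀)
  refine h3.congr_fderiv ?_
  ext v
  simp

theorem contDiffAt_generator {H : ℝ × E → E} {x₀ : E} (hH : ContDiffAt ℝ ∞ H (0, x₀)) :
    ContDiffAt ℝ ∞ (generator H) x₀ := by
  have h1 : ContDiffAt ℝ ∞ (fderiv ℝ H) (0, x₀) := hH.fderiv_right (m := ∞) (by simp)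
  exact (h1.comp x₀ (contDiffAt_const.prodMk contDiffAt_id)).clm_apply contDiffAt_const

/-- The Killing equation for the generator of a local flow by isometries. -/
theorem killing_of_flow {G : E → E →L[ℝ] E →L[ℝ] ℝ} {H : ℝ × E → E} {x₀ : E}
    (hG : DifferentiableAt ℝ G x₀)
    (hH : ContDiffAt ℝ ∞ H (0, x₀)) (h0 : ∀ᶠ x in 𝓝 x₀, H (0, x) = x)
    (hiso : ∀ᶠ t in 𝓝 (0 : ℝ), ∀ v w,
      G (H (t, x₀)) (fderiv ℝ H (t, x₀) (0, v)) (fderiv ℝ H (t, x₀) (0, w)) = G x₀ v w) (v w : E) :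
    fderiv ℝ G x₀ (generator H x₀) v w + G x₀ (fderiv ℝ (generator H) x₀ v) w +
      G x₀ v (fderiv ℝ (generator H) x₀ w) = 0 := by
  have h1 : HasFDerivAt (fderiv ℝ H) (fderiv ℝ (fderiv ℝ H) (0, x₀)) (0, x₀) :=
    ((hH.fderiv_right (m := ∞) (by simp)).differentiableAt (by simp)).hasFDerivAt
  have h2 : HasDerivAt (fun t : ℝ ↦ (t, x₀)) ((1 : ℝ), (0 : E)) 0 :=
    (hasDerivAt_id (0 : ℝ)).prodMk (hasDerivAt_const 0 x₀)
  have hsymm : IsSymmSndFDerivAt ℝ H (0, x₀) := hH.isSymmSndFDerivAt (by simpa using two_le_infty)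
  -- Symmetry of the second derivative of `H` exchanges the time derivative with the space
  -- derivative.
  have hA : ∀ v : E, HasDerivAt (fun t : ℝ ↦ fderiv ℝ H (t, x₀) (0, v))
      (fderiv ℝ (generator H) x₀ v) 0 := by
    intro v
    have h3 : HasDerivAt (fun t : ℝ ↦ fderiv ℝ H (t, x₀)) (fderiv ℝ (fderiv ℝ H) (0, x₀) (1, 0)) 0 :=
      HasFDerivAt.comp_hasDerivAt (f := fun t : ℝ ↦ (t, x₀)) (0 : ℝ) h1 h2
    have h4 := (ContinuousLinearMap.apply ℝ E ((0 : ℝ), v)).hasFDerivAt.comp_hasDerivAt (0 : ℝ) h3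
    rw [(hasFDerivAt_generator hH).fderiv]
    refine h4.congr_deriv ?_
    exact hsymm.eq (1, 0) (0, v)
  have hA0 : ∀ v : E, fderiv ℝ H (0, x₀) (0, v) = v := by
    intro v
    have h3 : HasFDerivAt (fun x : E ↦ ((0 : ℝ), x)) (ContinuousLinearMap.inr ℝ ℝ E) x₀ :=
      hasFDerivAt_prodMk_right 0 x₀
    have h4 := (hH.differentiableAt (by simp)).hasFDerivAt.comp x₀ h3
    have h5 : HasFDerivAt (fun x : E ↦ x) (ContinuousLinearMap.id ℝ E) x₀ := hasFDerivAt_id x₀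
    exact DFunLike.congr_fun (h4.unique (h5.congr_of_eventuallyEq h0)) v
  have hHd : HasDerivAt (fun t : ℝ ↦ H (t, x₀)) (generator H x₀) 0 :=
    (hH.differentiableAt (by simp)).hasFDerivAt.comp_hasDerivAt (0 : ℝ) h2
  have hGd : HasDerivAt (fun t : ℝ ↦ G (H (t, x₀))) (fderiv ℝ G x₀ (generator H x₀)) 0 := by
    have := h0.self_of_nhds
    refine HasFDerivAt.comp_hasDerivAt (0 : ℝ) ?_ hHd
    rw [this]
    exact hG.hasFDerivAt
  have h6 := (hGd.clm_apply (hA v)).clm_apply (hA w)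
  have h7 := h6.unique ((hasDerivAt_const (0 : ℝ) (G x₀ v w)).congr_of_eventuallyEq
    (hiso.mono fun t ht ↦ ht v w))
  simpa [hA0, h0.self_of_nhds] using h7

/-- If `X` and `f • X` satisfy the Killing equation then `df = 0`. -/
theorem fderiv_eq_zero_of_killing {A : E →L[ℝ] E →L[ℝ] ℝ} {A' : E →L[ℝ] E →L[ℝ] E →L[ℝ] ℝ}
    {X X' : E → E} {f : E → ℝ} {x₀ : E} (hA : ∀ v w, A v w = A w v) (hX0 : A (X x₀) ≠ 0)
    (hX : DifferentiableAt ℝ X x₀) (hf : DifferentiableAt ℝ f x₀)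
    (hX' : X' =ᶠ[𝓝 x₀] fun x ↦ f x • X x)
    (hk : ∀ v w, A' (X x₀) v w + A (fderiv ℝ X x₀ v) w + A v (fderiv ℝ X x₀ w) = 0)
    (hk' : ∀ v w, A' (X' x₀) v w + A (fderiv ℝ X' x₀ v) w + A v (fderiv ℝ X' x₀ w) = 0) :
    fderiv ℝ f x₀ = 0 := by
  have hd : ∀ v, fderiv ℝ X' x₀ v = f x₀ • fderiv ℝ X x₀ v + fderiv ℝ f x₀ v • X x₀ := by
    intro v
    rw [hX'.fderiv_eq, (hf.hasFDerivAt.fun_smul hX.hasFDerivAt).fderiv]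
    simp
  -- The second Killing equation minus `f x₀` times the first leaves `df ⊗ X♭ + X♭ ⊗ df = 0`; it is
  -- then evaluated at a vector on which `X♭` does not vanish.
  have key : ∀ v w, fderiv ℝ f x₀ v * A (X x₀) w + fderiv ℝ f x₀ w * A (X x₀) v = 0 := by
    intro v w
    have h1 := hk v w
    have h2 := hk' v w
    rw [hd, hd, hX'.self_of_nhds] at h2
    simp only [map_add, map_smul, add_apply, smul_apply, smul_eq_mul, hA v (X x₀)] at h2
    linear_combination h2 - f x₀ * h1
  obtain ⟨u, hu⟩ : ∃ u, A (X x₀) u ≠ 0 := by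
    by_contra! h
    exact hX0 (by ext u; simp [h u])
  have hfu : fderiv ℝ f x₀ u = 0 := by
    have h1 := key u u
    have h2 : 2 * (fderiv ℝ f x₀ u * A (X x₀) u) = 0 := by linarith
    have h3 : fderiv ℝ f x₀ u * A (X x₀) u = 0 := by linarith
    exact (mul_eq_zero.1 h3).resolve_right hu
  ext v
  have h1 := key v u
  rw [hfu, zero_mul, add_zero] at h1
  simpa using (mul_eq_zero.1 h1).resolve_right hu

/-- Curves that meet at parameters accumulating at `0` have parallel velocities at `0`. -/
theorem eq_smul_of_frequently_eq {E : Type*} [NormedAddCommGroup E] [InnerProductSpace ℝ E]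
    {ι : Type*} {l : Filter ι} [l.NeBot] {α β : ℝ → E} {a b : E} {h s : ι → ℝ}
    (hα : HasDerivAt α a 0) (hβ : HasDerivAt β b 0) (hb : b ≠ 0) (h0 : α 0 = β 0)
    (hh : Tendsto h l (𝓝 0)) (hs : Tendsto s l (𝓝 0)) (hne : ∀ᶠ i in l, h i ≠ 0)
    (heq : ∀ᶠ i in l, α (h i) = β (s i)) : a = (inner ℝ b a / inner ℝ b b) • b := by
  have hA : Tendsto (fun i ↦ dslope α 0 (h i)) l (𝓝 a) := by
    have h1 := (continuousAt_dslope_same.2 hα.differentiableAt).tendsto.comp hh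
    rwa [dslope_same, hα.deriv] at h1
  -- As `dslope` is the derivative at coinciding points, `s i = 0` needs no separate case.
  have hB : Tendsto (fun i ↦ dslope β 0 (s i)) l (𝓝 b) := by
    have h1 := (continuousAt_dslope_same.2 hβ.differentiableAt).tendsto.comp hs
    rwa [dslope_same, hβ.deriv] at h1
  have hbb : inner ℝ b b ≠ 0 := inner_self_ne_zero.2 hb
  -- The coefficient is written as an orthogonal projection, continuous in both vectors, so
  -- convergence of `s i / h i` need not be known beforehand.
  have hR : Tendsto (fun i ↦ (inner ℝ (dslope β 0 (s i)) (dslope α 0 (h i)) /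
      inner ℝ (dslope β 0 (s i)) (dslope β 0 (s i))) • dslope β 0 (s i)) l
      (𝓝 ((inner ℝ b a / inner ℝ b b) • b)) :=
    ((hB.inner hA).div (hB.inner hB) hbb).smul hB
  refine tendsto_nhds_unique hA (hR.congr' ?_)
  filter_upwards [hne, heq, (hB.inner hB).eventually_ne hbb] with i hi1 hi2 hi3
  have e1 : h i • dslope α 0 (h i) = α (h i) - α 0 := by simpa using sub_smul_dslope α 0 (h i)
  have e2 : s i • dslope β 0 (s i) = β (s i) - β 0 := by simpa using sub_smul_dslope β 0 (s i)
  have e3 : dslope α 0 (h i) = (s i / h i) • dslope β 0 (s i) := by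
    rw [hi2, h0, ← e2] at e1
    rw [div_eq_inv_mul, mul_smul, ← e1, smul_smul, inv_mul_cancel₀ hi1, one_smul]
  rw [e3, real_inner_smul_right, mul_div_assoc, div_self hi3, mul_one]

/-- The graph of a function on a second countable space has only countably many isolated points. -/
theorem countable_isolated_graph (σ : ℝ → ℝ) :
    {t | ∃ U ∈ 𝓝 (t, σ t), ∀ t', (t', σ t') ∈ U → t' = t}.Countable := by
  set S := {t | ∃ U ∈ 𝓝 (t, σ t), ∀ t', (t', σ t') ∈ U → t' = t}
  have hb : ∀ t ∈ S, ∃ B ∈ TopologicalSpace.countableBasis (ℝ × ℝ), (t, σ t) ∈ B ∧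
      ∀ t', (t', σ t') ∈ B → t' = t := by
    rintro t ⟨U, hU, h⟩
    obtain ⟨B, hB, htB, hBU⟩ := (TopologicalSpace.isBasis_countableBasis (ℝ × ℝ)).mem_nhds_iff.1 hU
    exact ⟨B, hB, htB, fun t' ht' ↦ h t' (hBU ht')⟩
  choose! B hB htB hBt using hb
  refine MapsTo.countable_of_injOn (f := B) (fun t ht ↦ hB t ht) (fun t ht t' ht' h ↦ ?_)
    (TopologicalSpace.countable_countableBasis (ℝ × ℝ))
  exact hBt t' ht' t (h ▸ htB t ht)

end KillingLocal

section Ratio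

variable {E : Type*} [NormedAddCommGroup E] [InnerProductSpace ℝ E]

theorem differentiableAt_inner_div_inner {X X' : E → E} {z : E} (hX : DifferentiableAt ℝ X z)
    (hX' : DifferentiableAt ℝ X' z) (h0 : X z ≠ 0) :
    DifferentiableAt ℝ (fun y ↦ (inner ℝ (X y) (X' y) / inner ℝ (X y) (X y) : ℝ)) z := by
  have h1 : DifferentiableAt ℝ (fun y ↦ (inner ℝ (X y) (X' y) : ℝ)) z := hX.inner ℝ hX'
  have h2 : DifferentiableAt ℝ (fun y ↦ (inner ℝ (X y) (X y) : ℝ)) z := hX.inner ℝ hX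
  have h3 : (inner ℝ (X z) (X z) : ℝ) ≠ 0 := inner_self_ne_zero.2 h0
  simp only [div_eq_mul_inv]
  exact h1.mul (h2.inv h3)

end Ratio

/-! ### Isometric flows with the same orbits have proportional generators. -/

section Flows

variable {n : ℕ} {M : Type*} [TopologicalSpace M]
  [ChartedSpace (EuclideanSpace ℝ (Fin n)) M]

/-- The initial velocity of a flow. -/
def vel (φ : Flow ℝ M) (p : M) : EuclideanSpace ℝ (Fin n) :=
  (mfderiv 𝓘(ℝ, ℝ) (𝓡 n) (fun t : ℝ ↦ φ t p) 0 : ℝ →L[ℝ] EuclideanSpace ℝ (Fin n)) 1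

/-- A flow in the chart at `q`. -/
def flowRep (φ : Flow ℝ M) (q : M) (z : ℝ × EuclideanSpace ℝ (Fin n)) :
    EuclideanSpace ℝ (Fin n) :=
  rep (φ z.1) q q z.2

theorem flowRep_zero (φ : Flow ℝ M) {q : M} {x : EuclideanSpace ℝ (Fin n)}
    (hx : x ∈ (extChartAt (𝓡 n) q).target) : flowRep φ q (0, x) = x := by
  simp only [flowRep, rep, φ.map_zero_apply]
  exact (extChartAt (𝓡 n) q).right_inv hx

theorem mem_repDomain_zero (φ : Flow ℝ M) {q : M} {x : EuclideanSpace ℝ (Fin n)}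
    (hx : x ∈ (extChartAt (𝓡 n) q).target) : x ∈ repDomain (φ 0) q q :=
  ⟨hx, by rw [φ.map_zero_apply]; exact (extChartAt (𝓡 n) q).map_target hx⟩

theorem eventually_mem_repDomain (φ : Flow ℝ M) {q : M} {x : EuclideanSpace ℝ (Fin n)}
    (hx : x ∈ (extChartAt (𝓡 n) q).target) : ∀ᶠ t in 𝓝 (0 : ℝ), x ∈ repDomain (φ t) q q := by
  have hc : Continuous fun t : ℝ ↦ φ t ((extChartAt (𝓡 n) q).symm x) := by fun_prop
  exact (hc.continuousAt.eventually ((isOpen_extChartAt_source (I := 𝓡 n) q).eventually_mem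
    (mem_repDomain_zero φ hx).2)).mono fun t ht ↦ ⟨hx, ht⟩

variable [IsManifold (𝓡 n) ∞ M]

/-- A smooth flow by isometries. -/
structure IsIsometricFlow (g : LorentzMetric n M) (φ : Flow ℝ M) : Prop where
  contMDiff : ContMDiff (𝓘(ℝ, ℝ).prod (𝓡 n)) (𝓡 n) ∞ (fun x : ℝ × M ↦ φ x.1 x.2)
  isometric (t : ℝ) : ∃ Φ : isometryGroup g, (Φ.1 : M → M) = φ t

variable {g : LorentzMetric n M} {φ ψ : Flow ℝ M}

theorem IsIsometricFlow.contDiffAt_flowRep (hφ : IsIsometricFlow g φ) {q : M} {t : ℝ}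
    {x : EuclideanSpace ℝ (Fin n)} (hx : x ∈ repDomain (φ t) q q) :
    ContDiffAt ℝ ∞ (flowRep φ q) (t, x) := by
  rw [← contMDiffAt_iff_contDiffAt]
  have h1 : ContMDiffAt 𝓘(ℝ, ℝ × EuclideanSpace ℝ (Fin n)) 𝓘(ℝ, ℝ) ∞
      (Prod.fst : ℝ × EuclideanSpace ℝ (Fin n) → ℝ) (t, x) :=
    contMDiffAt_iff_contDiffAt.2 contDiffAt_fst
  have h2 : ContMDiffAt 𝓘(ℝ, ℝ × EuclideanSpace ℝ (Fin n)) 𝓘(ℝ, EuclideanSpace ℝ (Fin n)) ∞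
      (Prod.snd : ℝ × EuclideanSpace ℝ (Fin n) → EuclideanSpace ℝ (Fin n)) (t, x) :=
    contMDiffAt_iff_contDiffAt.2 contDiffAt_snd
  have h3 : ContMDiffAt 𝓘(ℝ, ℝ × EuclideanSpace ℝ (Fin n)) (𝓡 n) ∞
      (fun z : ℝ × EuclideanSpace ℝ (Fin n) ↦ (extChartAt (𝓡 n) q).symm z.2) (t, x) :=
    (contMDiffAt_extChartAt_symm' q hx.1).comp (t, x) h2
  have h4 := hφ.contMDiff.contMDiffAt.comp (t, x) (h1.prodMk h3)
  exact (contMDiffAt_extChartAt_source q hx.2).comp (t, x) h4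

theorem IsIsometricFlow.fderiv_flowRep (hφ : IsIsometricFlow g φ) {q : M} {t : ℝ}
    {x : EuclideanSpace ℝ (Fin n)} (hx : x ∈ repDomain (φ t) q q)
    (v : EuclideanSpace ℝ (Fin n)) :
    fderiv ℝ (flowRep φ q) (t, x) (0, v) = fderiv ℝ (rep (φ t) q q) x v := by
  have h1 := ((hφ.contDiffAt_flowRep hx).differentiableAt (by simp)).hasFDerivAt
  have h2 : HasFDerivAt (fun z : EuclideanSpace ℝ (Fin n) ↦ (t, z))
    (ContinuousLinearMap.inr ℝ ℝ (EuclideanSpace ℝ (Fin n))) x := hasFDerivAt_prodMk_right t x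
  have h3 : HasFDerivAt (rep (φ t) q q) _ x := h1.comp x h2
  rw [h3.fderiv]
  simp

theorem IsIsometricFlow.hasDerivAt_flowRep (hφ : IsIsometricFlow g φ) {q : M}
    {x : EuclideanSpace ℝ (Fin n)} (hx : x ∈ (extChartAt (𝓡 n) q).target) :
    HasDerivAt (fun t : ℝ ↦ flowRep φ q (t, x)) (generator (flowRep φ q) x) 0 := by
  have h1 := ((hφ.contDiffAt_flowRep (mem_repDomain_zero φ hx)).differentiableAt
    (by simp)).hasFDerivAt
  have h2 : HasDerivAt (fun t : ℝ ↦ (t, x)) ((1 : ℝ), (0 : EuclideanSpace ℝ (Fin n))) 0 :=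
    (hasDerivAt_id (0 : ℝ)).prodMk (hasDerivAt_const 0 x)
  exact HasFDerivAt.comp_hasDerivAt (f := fun t : ℝ ↦ (t, x)) (0 : ℝ) h1 h2

theorem IsIsometricFlow.chartD_generator (hφ : IsIsometricFlow g φ) {q : M}
    {x : EuclideanSpace ℝ (Fin n)} (hx : x ∈ (extChartAt (𝓡 n) q).target) :
    chartD q x (generator (flowRep φ q) x) = vel φ ((extChartAt (𝓡 n) q).symm x) := by
  have h1 : HasMFDerivAt 𝓘(ℝ, ℝ) 𝓘(ℝ, EuclideanSpace ℝ (Fin n))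
      (fun t : ℝ ↦ flowRep φ q (t, x)) 0 _ :=
    (hφ.hasDerivAt_flowRep hx).hasFDerivAt.hasMFDerivAt
  have h2 : HasMFDerivAt 𝓘(ℝ, EuclideanSpace ℝ (Fin n)) (𝓡 n) (extChartAt (𝓡 n) q).symm
      (flowRep φ q (0, x)) (chartD q (flowRep φ q (0, x))) :=
    (mdifferentiableAt_extChartAt_symm' q (by rwa [flowRep_zero φ hx])).hasMFDerivAt
  have h3 := h2.comp (0 : ℝ) h1
  have h4 : (fun t : ℝ ↦ φ t ((extChartAt (𝓡 n) q).symm x)) =ᶠ[𝓝 0]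
      (extChartAt (𝓡 n) q).symm ∘ fun t : ℝ ↦ flowRep φ q (t, x) :=
    (eventually_mem_repDomain φ hx).mono fun t ht ↦ (extChartAt_symm_rep ht).symm
  have h5 := (h3.congr_of_eventuallyEq h4).mfderiv
  have h6 : vel φ ((extChartAt (𝓡 n) q).symm x) =
      ((chartD q (flowRep φ q (0, x))).comp
        (ContinuousLinearMap.toSpanSingleton ℝ (generator (flowRep φ q) x))) 1 :=
    DFunLike.congr_fun h5 (1 : ℝ)
  rw [h6, flowRep_zero φ hx]
  simp

theorem IsIsometricFlow.contDiffAt_generator (hφ : IsIsometricFlow g φ) {q : M}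
    {x : EuclideanSpace ℝ (Fin n)} (hx : x ∈ (extChartAt (𝓡 n) q).target) :
    ContDiffAt ℝ ∞ (generator (flowRep φ q)) x :=
  LorentzFibration.contDiffAt_generator (hφ.contDiffAt_flowRep (mem_repDomain_zero φ hx))

theorem IsIsometricFlow.killing [T2Space M] (hφ : IsIsometricFlow g φ) {q : M}
    {x : EuclideanSpace ℝ (Fin n)} (hx : x ∈ (extChartAt (𝓡 n) q).target)
    (v w : EuclideanSpace ℝ (Fin n)) :
    fderiv ℝ (chartForm g q) x (generator (flowRep φ q) x) v w +
      chartForm g q x (fderiv ℝ (generator (flowRep φ q)) x v) w +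
      chartForm g q x v (fderiv ℝ (generator (flowRep φ q)) x w) = 0 := by
  have hG := isMetricOn_chartForm g q
  refine killing_of_flow ((hG.contDiffOn.contDiffAt (hG.isOpen.mem_nhds hx)).differentiableAt
    (by simp)) (hφ.contDiffAt_flowRep (mem_repDomain_zero φ hx)) ?_ ?_ v w
  · filter_upwards [(isOpen_extChartAt_target q).eventually_mem hx] with z hz
    exact flowRep_zero φ hz
  · filter_upwards [eventually_mem_repDomain φ hx] with t ht v w
    rw [hφ.fderiv_flowRep ht, hφ.fderiv_flowRep ht]
    obtain ⟨Φ, hΦ⟩ := hφ.isometric t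
    rw [← hΦ] at ht ⊢
    have := (isLocIso_rep Φ q q).isometric x ht v w
    rw [hΦ] at this ⊢
    exact this

/-- If the orbits of `ψ` lie in the orbits of `φ`, then the generators are parallel. -/
theorem generator_parallel (hφ : IsIsometricFlow g φ) (hψ : IsIsometricFlow g ψ)
    (hne : ∀ p, vel (n := n) φ p ≠ 0) (horb : ∀ p t, ∃ s, ψ t p = φ s p) {q : M}
    {x : EuclideanSpace ℝ (Fin n)} (hx : x ∈ (extChartAt (𝓡 n) q).target) :
    generator (flowRep ψ q) x =
      (inner ℝ (generator (flowRep φ q) x) (generator (flowRep ψ q) x) /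
        inner ℝ (generator (flowRep φ q) x) (generator (flowRep φ q) x)) •
      generator (flowRep φ q) x := by
  have hXne : ∀ z ∈ (extChartAt (𝓡 n) q).target, generator (flowRep φ q) z ≠ 0 := by
    intro z hz h0
    have := hφ.chartD_generator hz
    rw [h0, map_zero] at this
    exact hne _ this.symm
  set X := generator (flowRep (n := n) φ q) with hX
  set X' := generator (flowRep (n := n) ψ q) with hX'
  set p := (extChartAt (𝓡 n) q).symm x with hp
  -- The time change `σ` is an arbitrary choice and need not be continuous. Still, all but countably
  -- many points of its graph are accumulation points of the graph, and this suffices to compare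
  -- velocities there.
  choose σ hσ using horb p
  have hψc : Continuous fun t : ℝ ↦ ψ t p := by fun_prop
  have hgood : ∀ t, (ψ t p) ∈ (extChartAt (𝓡 n) q).source →
      t ∉ {t | ∃ U ∈ 𝓝 (t, σ t), ∀ t', (t', σ t') ∈ U → t' = t} →
      X' (extChartAt (𝓡 n) q (ψ t p)) =
        (inner ℝ (X (extChartAt (𝓡 n) q (ψ t p))) (X' (extChartAt (𝓡 n) q (ψ t p))) /
        inner ℝ (X (extChartAt (𝓡 n) q (ψ t p))) (X (extChartAt (𝓡 n) q (ψ t p)))) •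
          X (extChartAt (𝓡 n) q (ψ t p)) := by
    intro t ht hiso
    set z := extChartAt (𝓡 n) q (ψ t p) with hz
    have hzt : z ∈ (extChartAt (𝓡 n) q).target := (extChartAt (𝓡 n) q).map_source ht
    have hzs : (extChartAt (𝓡 n) q).symm z = ψ t p := (extChartAt (𝓡 n) q).left_inv ht
    -- Along `l` one has `t' → t` with `t' ≠ t` and `σ t' → σ t`; it is nontrivial because `(t, σ
    -- t)` is not isolated in the graph.
    set l : Filter ℝ := comap (fun t' ↦ (t', σ t')) (𝓝 (t, σ t)) ⊓ 𝓟 {t}ᶜ with hl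
    have hlne : l.NeBot := by
      rw [hl, inf_principal_neBot_iff]
      intro V hV
      obtain ⟨U, hU, hUV⟩ := mem_comap.1 hV
      by_contra h
      exact hiso ⟨U, hU, fun t' ht' ↦ by
        by_contra hne'
        exact h ⟨t', hUV ht', hne'⟩⟩
    have hlt : Tendsto (fun t' ↦ (t', σ t')) l (𝓝 (t, σ t)) := tendsto_comap.mono_left inf_le_left
    have hl1 : Tendsto (fun t' ↦ t' - t) l (𝓝 0) := by
      have := ((continuous_fst.tendsto _).comp hlt).sub_const t
      simpa using this
    have hl2 : Tendsto (fun t' ↦ σ t' - σ t) l (𝓝 0) := by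
      have := ((continuous_snd.tendsto _).comp hlt).sub_const (σ t)
      simpa using this
    refine eq_smul_of_frequently_eq (hψ.hasDerivAt_flowRep hzt) (hφ.hasDerivAt_flowRep hzt)
      (hXne z hzt) (by rw [flowRep_zero ψ hzt, flowRep_zero φ hzt]) hl1 hl2 ?_ ?_
    · filter_upwards [mem_inf_of_right (mem_principal_self _)] with t' ht'
      exact sub_ne_zero.2 ht'
    · refine Eventually.of_forall fun t' ↦ ?_
      simp only [flowRep, rep, hzs]
      rw [← ψ.map_add, hσ t, ← φ.map_add, sub_add_cancel, sub_add_cancel, hσ t']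
  -- `P` is the component of `X'` orthogonal to `X`. It vanishes along the orbit for a dense set of
  -- times, hence at `x` by continuity.
  set P : EuclideanSpace ℝ (Fin n) → EuclideanSpace ℝ (Fin n) := fun z ↦
    X' z - (inner ℝ (X z) (X' z) / inner ℝ (X z) (X z)) • X z with hP
  have hXc : ContinuousAt X x := (hφ.contDiffAt_generator hx).continuousAt
  have hXc' : ContinuousAt X' x := (hψ.contDiffAt_generator hx).continuousAt
  have hcoef : ContinuousAt (fun z ↦ inner ℝ (X z) (X' z) / inner ℝ (X z) (X z) : _ → ℝ) x :=
    ContinuousAt.div₀ (hXc.inner hXc') (hXc.inner hXc) (inner_self_ne_zero.2 (hXne x hx))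
  have hPc : ContinuousAt P x := hXc'.sub (hcoef.smul hXc)
  have hps : p ∈ (extChartAt (𝓡 n) q).source := (extChartAt (𝓡 n) q).map_target hx
  have hψ0 : ψ 0 p = p := ψ.map_zero_apply p
  have hcx : extChartAt (𝓡 n) q (ψ 0 p) = x := by
    rw [hψ0]; exact (extChartAt (𝓡 n) q).right_inv hx
  have hzc : ContinuousAt (fun t : ℝ ↦ extChartAt (𝓡 n) q (ψ t p)) 0 :=
    ContinuousAt.comp (f := fun t : ℝ ↦ ψ t p) (continuousAt_extChartAt' (by rwa [hψ0]))
      hψc.continuousAt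
  have hlim : Tendsto (fun t : ℝ ↦ P (extChartAt (𝓡 n) q (ψ t p))) (𝓝 0) (𝓝 (P x)) := by
    have : ContinuousAt P (extChartAt (𝓡 n) q (ψ 0 p)) := by rwa [hcx]
    have h1 := (this.comp (f := fun t : ℝ ↦ extChartAt (𝓡 n) q (ψ t p)) hzc).tendsto
    have h2 : (P ∘ fun t : ℝ ↦ extChartAt (𝓡 n) q (ψ t p)) 0 = P x := congrArg P hcx
    rwa [h2] at h1
  have hdense := (countable_isolated_graph σ).dense_compl ℝ
  have hfreq : ∃ᶠ t in 𝓝 (0 : ℝ), P (extChartAt (𝓡 n) q (ψ t p)) = 0 := by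
    have h1 : ∃ᶠ t in 𝓝 (0 : ℝ), t ∈ {t | ∃ U ∈ 𝓝 (t, σ t), ∀ t', (t', σ t') ∈ U → t' = t}ᶜ :=
      mem_closure_iff_frequently.1 (hdense 0)
    refine (h1.and_eventually (hψc.continuousAt.eventually
      ((isOpen_extChartAt_source (I := 𝓡 n) q).eventually_mem
        (show ψ 0 p ∈ _ from hψ0.symm ▸ hps)))).mono ?_
    rintro t ⟨ht1, ht2⟩
    exact sub_eq_zero.2 (hgood t ht2 ht1)
  have h0 : P x = 0 := by
    by_contra hcon
    exact hfreq (hlim.eventually_ne hcon)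
  exact sub_eq_zero.1 h0

/-- If the orbits of `ψ` lie in the orbits of `φ`, then the velocity of `ψ` is a constant multiple
of that of `φ`. -/
theorem exists_vel_eq_smul [T2Space M] [ConnectedSpace M] (hφ : IsIsometricFlow g φ)
    (hψ : IsIsometricFlow g ψ) (hne : ∀ p, vel (n := n) φ p ≠ 0)
    (horb : ∀ p t, ∃ s, ψ t p = φ s p) :
    ∃ c : ℝ, ∀ p, vel (n := n) ψ p = c • vel φ p := by
  have hloc : ∀ q : M, ∃ c : ℝ, ∀ᶠ p in 𝓝 q, vel (n := n) ψ p = c • vel φ p := by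
    intro q
    set X := generator (flowRep (n := n) φ q) with hX
    set X' := generator (flowRep (n := n) ψ q) with hX'
    set f : EuclideanSpace ℝ (Fin n) → ℝ := fun z ↦ inner ℝ (X z) (X' z) / inner ℝ (X z) (X z)
      with hf
    obtain ⟨r, hr, hball⟩ := Metric.nhds_basis_ball.mem_iff.1
      ((isOpen_extChartAt_target (I := 𝓡 n) q).mem_nhds (mem_extChartAt_target q))
    have hXne : ∀ z ∈ (extChartAt (𝓡 n) q).target, X z ≠ 0 := by
      intro z hz h0
      have := hφ.chartD_generator hz
      rw [← hX, h0, map_zero] at this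
      exact hne _ this.symm
    have hpar : ∀ z ∈ (extChartAt (𝓡 n) q).target, X' z = f z • X z := fun z hz ↦
      generator_parallel hφ hψ hne horb hz
    have hfd : ∀ z ∈ (extChartAt (𝓡 n) q).target, DifferentiableAt ℝ f z := by
      intro z hz
      have h1 := (hφ.contDiffAt_generator hz).differentiableAt (by simp)
      have h2 := (hψ.contDiffAt_generator hz).differentiableAt (by simp)
      exact differentiableAt_inner_div_inner h1 h2 (hXne z hz)
    have hf0 : ∀ z ∈ (extChartAt (𝓡 n) q).target, fderiv ℝ f z = 0 := by
      intro z hz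
      refine fderiv_eq_zero_of_killing (X := X) (X' := X') ((isMetricOn_chartForm g q).symm z hz) ?_
        ((hφ.contDiffAt_generator hz).differentiableAt (by simp)) (hfd z hz) ?_
        (hφ.killing hz) (hψ.killing hz)
      · intro h0
        refine hXne z hz ((isMetricOn_chartForm g q).eq_zero hz fun w ↦ ?_)
        rw [h0]; rfl
      · filter_upwards [(isOpen_extChartAt_target q).eventually_mem hz] with z' hz'
        exact hpar z' hz'
    refine ⟨f (extChartAt (𝓡 n) q q), ?_⟩
    filter_upwards [extChartAt_source_mem_nhds (I := 𝓡 n) q,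
      (continuousAt_extChartAt (I := 𝓡 n) q).preimage_mem_nhds (ball_mem_nhds _ hr)] with p hp hpb
    have hpt := hball hpb
    have hconst : f (extChartAt (𝓡 n) q p) = f (extChartAt (𝓡 n) q q) :=
      (convex_ball _ r).is_const_of_fderivWithin_eq_zero (𝕜 := ℝ)
        (fun z hz ↦ (hfd z (hball hz)).differentiableWithinAt)
        (fun z hz ↦ by rw [fderivWithin_of_isOpen isOpen_ball hz]; exact hf0 z (hball hz))
        hpb (mem_ball_self hr)
    have h1 := hφ.chartD_generator hpt
    have h2 := hψ.chartD_generator hpt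
    rw [(extChartAt (𝓡 n) q).left_inv hp] at h1 h2
    rw [← h1, ← h2, ← hX, ← hX', hpar _ hpt, map_smul, hconst]
  choose c hc using hloc
  have hpt : ∀ p, vel (n := n) ψ p = c p • vel φ p := fun p ↦ (hc p).self_of_nhds
  have hlc : IsLocallyConstant c := by
    rw [IsLocallyConstant.iff_eventually_eq]
    intro q
    filter_upwards [hc q] with p hp
    rw [hpt p] at hp
    exact smul_left_injective ℝ (hne p) hp
  obtain ⟨p₀⟩ : Nonempty M := inferInstance
  exact ⟨c p₀, fun p ↦ by rw [hpt p, hlc.apply_eq_of_preconnectedSpace p p₀]⟩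

end Flows

/-! ### Comparison of quadratic forms. -/

section Comparison

variable {X E : Type*} [TopologicalSpace X] [NormedAddCommGroup E] [NormedSpace ℝ E]
  [FiniteDimensional ℝ E]

/-- A quadratic form that is positive definite at `x₀` dominates any other quadratic form,
uniformly near `x₀`. -/
theorem exists_eventually_le_mul {A Q : X → E → ℝ} {x₀ : X}
    (hA : ∀ v, ContinuousAt (fun z : X × E ↦ A z.1 z.2) (x₀, v))
    (hQ : ∀ v, ContinuousAt (fun z : X × E ↦ Q z.1 z.2) (x₀, v))
    (hA2 : ∀ x c v, A x (c • v) = c ^ 2 * A x v) (hQ2 : ∀ x c v, Q x (c • v) = c ^ 2 * Q x v)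
    (hpos : ∀ v, v ≠ 0 → 0 < Q x₀ v) :
    ∃ C, ∀ᶠ x in 𝓝 x₀, ∀ v, A x v ≤ C * Q x v := by
  have hAc : ∀ v, ContinuousAt (A x₀) v := fun v ↦
    ContinuousAt.comp (f := fun v : E ↦ (x₀, v)) (hA v) (by fun_prop)
  have hQc : ∀ v, ContinuousAt (Q x₀) v := fun v ↦
    ContinuousAt.comp (f := fun v : E ↦ (x₀, v)) (hQ v) (by fun_prop)
  have hne : ∀ v ∈ sphere (0 : E) 1, v ≠ 0 := fun v hv ↦ ne_of_mem_sphere hv one_ne_zero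
  -- `C` bounds the quotient on the unit sphere over `x₀`. The constant `C + 1` makes the inequality
  -- strict, hence stable near `x₀`; homogeneity extends it to all vectors.
  obtain ⟨C, hC⟩ := (isCompact_sphere (0 : E) 1).bddAbove_image
    (f := fun v ↦ A x₀ v / Q x₀ v) fun v hv ↦
      ((hAc v).div₀ (hQc v) (hpos v (hne v hv)).ne').continuousWithinAt
  refine ⟨C + 1, ?_⟩
  have hev : ∀ᶠ x in 𝓝 x₀, ∀ v ∈ sphere (0 : E) 1, A x v < (C + 1) * Q x v := by
    refine (isCompact_sphere (0 : E) 1).eventually_forall_of_forall_eventually fun v hv ↦ ?_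
    have h1 : A x₀ v < (C + 1) * Q x₀ v := by
      have h2 := hC (mem_image_of_mem _ hv)
      have h3 := hpos v (hne v hv)
      rw [div_le_iff₀ h3] at h2
      linarith
    exact (hA v).eventually_lt ((hQ v).const_mul (C + 1)) h1
  filter_upwards [hev] with x hx v
  rcases eq_or_ne v 0 with rfl | hv
  · have h1 := hA2 x 0 0
    have h2 := hQ2 x 0 0
    simp only [smul_zero] at h1 h2
    have h3 : A x 0 = 0 := by linarith
    have h4 : Q x 0 = 0 := by linarith
    rw [h3, h4, mul_zero]
  · have h1 := (hx (‖v‖⁻¹ • v) (by simp [norm_smul, hv])).le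
    rw [hA2, hQ2] at h1
    have h2 : 0 < ‖v‖⁻¹ ^ 2 := by positivity
    nlinarith

end Comparison

/-! ### The positive definite form obtained by reflecting the metric in a timelike vector. -/

section Definite

variable {n : ℕ} {M : Type*} [TopologicalSpace M]
  [ChartedSpace (EuclideanSpace ℝ (Fin n)) M] [IsManifold (𝓡 n) ∞ M]

/-- The reverse Cauchy–Schwarz inequality: the orthogonal complement of a timelike vector is
spacelike. -/
theorem LorentzMetric.bil_pos_of_orthogonal (g : LorentzMetric n M) (p : M)
    {k u : EuclideanSpace ℝ (Fin n)} (hk : g.bil p k k < 0) (hku : g.bil p k u = 0) (hu : u ≠ 0) :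
    0 < g.bil p u u := by
  obtain ⟨b, i₀, hb⟩ := g.signature p
  let b' : Module.Basis (Fin n) ℝ (EuclideanSpace ℝ (Fin n)) := b
  have hb' : ∀ i j, g.bil p (b' i) (b' j) = if i = j then (if i = i₀ then -1 else 1) else 0 := hb
  have hbil : ∀ v w, g.bil p v w = -(b'.repr v i₀ * b'.repr w i₀) +
      ∑ i ∈ Finset.univ.erase i₀, b'.repr v i * b'.repr w i := by
    intro v w
    have h1 : g.bil p v w = ∑ i, b'.repr v i * b'.repr w i * (if i = i₀ then -1 else 1) := by
      conv_lhs => rw [← b'.sum_repr v, ← b'.sum_repr w]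
      simp only [map_sum, map_smul, FunLike.coe_sum, Finset.sum_apply,
        FunLike.coe_smul, Pi.smul_apply, hb', smul_eq_mul]
      simp only [mul_ite, mul_zero, Finset.sum_ite_eq', Finset.mem_univ, if_true]
      refine Finset.sum_congr rfl fun i _ ↦ ?_
      split_ifs <;> ring
    rw [h1, ← Finset.add_sum_erase _ _ (Finset.mem_univ i₀)]
    congr 1
    · simp
    · refine Finset.sum_congr rfl fun i hi ↦ ?_
      rw [if_neg (Finset.ne_of_mem_erase hi), mul_one]
  rw [hbil] at hk hku ⊢
  -- Cauchy–Schwarz for the spacelike coordinates, with orthogonality, reads `(k₀ u₀)² ≤ T S`. This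
  -- contradicts `T < k₀²` and `0 < S ≤ u₀²`.
  have hcs := Finset.sum_mul_sq_le_sq_mul_sq (Finset.univ.erase i₀) (fun i ↦ b'.repr k i)
    fun i ↦ b'.repr u i
  set S := ∑ i ∈ Finset.univ.erase i₀, b'.repr u i * b'.repr u i with hS
  have hS0 : 0 ≤ S := Finset.sum_nonneg fun i _ ↦ mul_self_nonneg _
  simp only [pow_two] at hcs
  rw [← hS] at hcs
  set T := ∑ i ∈ Finset.univ.erase i₀, b'.repr k i * b'.repr k i
  have hT0 : 0 ≤ T := Finset.sum_nonneg fun i _ ↦ mul_self_nonneg _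
  set k₀ := b'.repr k i₀
  set u₀ := b'.repr u i₀ with hu₀
  have hku' : ∑ i ∈ Finset.univ.erase i₀, b'.repr k i * b'.repr u i = k₀ * u₀ := by linarith
  rw [hku'] at hcs
  have hSpos : 0 < S := by
    refine hS0.lt_of_ne' fun h0 ↦ hu ?_
    have h1 := (Finset.sum_eq_zero_iff_of_nonneg fun i _ ↦ mul_self_nonneg _).1 (hS ▸ h0)
    rw [h0, mul_zero] at hcs
    have h2 : k₀ * u₀ = 0 := mul_self_eq_zero.1 (hcs.antisymm (mul_self_nonneg _))
    have h3 : u₀ = 0 := by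
      rcases mul_eq_zero.1 h2 with h | h
      · rw [h] at hk; linarith
      · exact h
    rw [← b'.sum_repr u]
    refine Finset.sum_eq_zero fun i _ ↦ ?_
    rcases eq_or_ne i i₀ with rfl | hi
    · rw [← hu₀, h3, zero_smul]
    · rw [mul_self_eq_zero.1 (h1 i (Finset.mem_erase.2 ⟨hi, Finset.mem_univ _⟩)), zero_smul]
  by_contra hcon
  have h1 : S ≤ u₀ * u₀ := by linarith
  have h2 : T < k₀ * k₀ := by linarith
  have h3 : k₀ * u₀ * (k₀ * u₀) = (k₀ * k₀) * (u₀ * u₀) := by ring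
  have h4 : T * S < (k₀ * k₀) * S := mul_lt_mul_of_pos_right h2 hSpos
  have h5 : (k₀ * k₀) * S ≤ (k₀ * k₀) * (u₀ * u₀) :=
    mul_le_mul_of_nonneg_left h1 (mul_self_nonneg _)
  linarith

/-- The reflection of the metric `g` in the vector `k`. -/
def LorentzMetric.flip (g : LorentzMetric n M) (p : M) (k w : EuclideanSpace ℝ (Fin n)) : ℝ :=
  g.bil p w w - 2 / g.bil p k k * g.bil p k w ^ 2

/-- Splitting `w = (a / h) k + u` with `u` orthogonal to `k`, the reflection reverses the sign of
the `k`-part and gives `g(u, u) - a² / h`. Both terms are nonnegative, and they do not vanish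
together. -/
theorem LorentzMetric.flip_pos (g : LorentzMetric n M) (p : M)
    {k w : EuclideanSpace ℝ (Fin n)} (hk : g.bil p k k < 0) (hw : w ≠ 0) : 0 < g.flip p k w := by
  set h := g.bil p k k with hh
  set a := g.bil p k w with ha
  set u := w - (a / h) • k with hu
  have h1 : g.bil p k u = 0 := by
    rw [hu, map_sub, map_smul, ← hh, ← ha, smul_eq_mul, div_mul_cancel₀ _ hk.ne, sub_self]
  have h2 : g.flip p k w = g.bil p u u - a ^ 2 / h := by
    have h3 : g.bil p u u = g.bil p w w - a ^ 2 / h := by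
      have h4 : g.bil p u u = g.bil p w u := by
        rw [g.bil_symm p w u]
        nth_rewrite 2 [hu]
        rw [map_sub, map_smul, g.bil_symm p u k, h1, smul_zero, sub_zero]
      rw [h4, hu, map_sub, map_smul, g.bil_symm p w k, ← ha, smul_eq_mul]
      ring
    rw [h3, LorentzMetric.flip, ← hh, ← ha]
    ring
  have h5 : 0 ≤ -(a ^ 2 / h) := by
    rw [neg_nonneg]
    exact div_nonpos_of_nonneg_of_nonpos (sq_nonneg a) hk.le
  rw [h2]
  rcases eq_or_ne u 0 with h0 | h0
  · have ha0 : a ≠ 0 := by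
      intro ha0
      rw [hu, ha0, zero_div, zero_smul, sub_zero] at h0
      exact hw h0
    have h6 : a ^ 2 / h < 0 := div_neg_of_pos_of_neg (by positivity) hk
    rw [h0, map_zero]
    linarith
  · linarith [g.bil_pos_of_orthogonal p hk h1 h0]

theorem LorentzMetric.flip_zero (g : LorentzMetric n M) (p : M)
    (k : EuclideanSpace ℝ (Fin n)) : g.flip p k 0 = 0 := by
  simp [LorentzMetric.flip]

theorem LorentzMetric.flip_nonneg (g : LorentzMetric n M) (p : M)
    {k : EuclideanSpace ℝ (Fin n)} (hk : g.bil p k k < 0) (w : EuclideanSpace ℝ (Fin n)) :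
    0 ≤ g.flip p k w := by
  rcases eq_or_ne w 0 with rfl | hw
  · exact (g.flip_zero p k).ge
  · exact (g.flip_pos p hk hw).le

theorem LorentzMetric.flip_le (g : LorentzMetric n M) (p : M) (k : EuclideanSpace ℝ (Fin n)) :
    ∃ C, ∀ w, g.flip p k w ≤ C * ‖w‖ ^ 2 := by
  refine ⟨‖g.bil p‖ + |2 / g.bil p k k| * ‖g.bil p k‖ ^ 2, fun w ↦ ?_⟩
  have h1 : g.bil p w w ≤ ‖g.bil p‖ * ‖w‖ ^ 2 := by
    rw [pow_two, ← mul_assoc]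
    exact (le_abs_self _).trans ((g.bil p).le_opNorm₂ w w)
  have h2 : g.bil p k w ^ 2 ≤ (‖g.bil p k‖ * ‖w‖) ^ 2 := by
    rw [← sq_abs]
    have := (g.bil p k).le_opNorm w
    rw [Real.norm_eq_abs] at this
    gcongr
  have h3 : -(2 / g.bil p k k * g.bil p k w ^ 2) ≤
      |2 / g.bil p k k| * (‖g.bil p k‖ * ‖w‖) ^ 2 := by
    refine (neg_le_abs _).trans ?_
    rw [abs_mul, abs_of_nonneg (sq_nonneg (g.bil p k w))]
    gcongr
  rw [LorentzMetric.flip]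
  nlinarith

end Definite

/-! ### Orbits, the orbit space, and isometries that rescale the generator. -/

section Orbits

variable {n : ℕ} {M : Type*} [TopologicalSpace M]
  [ChartedSpace (EuclideanSpace ℝ (Fin n)) M]

/-- A vector field as a map to the model space. -/
def fieldFun (K : (p : M) → TangentSpace (𝓡 n) p) (p : M) : EuclideanSpace ℝ (Fin n) := K p

variable {φ φ' : Flow ℝ M}
  {K : (p : M) → TangentSpace (𝓡 n) p}

theorem IsFlowOf.vel_eq (hφ : IsFlowOf φ K) (p : M) : vel φ p = fieldFun K p := by
  have h1 := (hφ.isMIntegralCurve p 0).mfderiv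
  have h2 : vel φ p = (ContinuousLinearMap.smulRight (1 : ℝ →L[ℝ] ℝ) (fieldFun K (φ 0 p))) 1 :=
    DFunLike.congr_fun h1 (1 : ℝ)
  rw [h2, show φ 0 p = p from φ.map_zero_apply p]
  simp

variable [IsManifold (𝓡 n) ∞ M] {g : LorentzMetric n M} [T2Space M]

/-- Smoothness of a vector field. -/
def IsSmoothField (K : (p : M) → TangentSpace (𝓡 n) p) : Prop :=
  ContMDiff (𝓡 n) (𝓡 n).tangent ∞
    (fun p ↦ (Bundle.TotalSpace.mk p (K p) : TangentBundle (𝓡 n) M))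

/-- The orbit of `p` run at speed `c` is also an integral curve of `c • K`, so uniqueness of
integral curves applies. -/
theorem IsFlowOf.integralCurve_unique (hK : IsSmoothField K) {γ : ℝ → M} {c : ℝ} {p : M}
    (hφ : IsFlowOf φ K) (hγ : IsMIntegralCurve (I := 𝓡 n) γ (c • K)) (h0 : γ 0 = p) (t : ℝ) : γ t = φ (t * c) p := by
  have hm : IsManifold (𝓡 n) 1 M := .of_le (n := ∞) (by simp)
  have h1 := (hφ.isMIntegralCurve p).comp_mul c
  have h2 : ContMDiff (𝓡 n) (𝓡 n).tangent 1
      (fun p ↦ (Bundle.TotalSpace.mk p ((c • K) p) : TangentBundle (𝓡 n) M)) :=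
    (hK.of_le (by simp)).const_smul_section
  refine congrFun (isMIntegralCurve_Ioo_eq_of_contMDiff_boundaryless (t₀ := 0) h2 hγ h1 ?_) t
  simp only [Function.comp, zero_mul]
  rw [h0]
  exact (φ.map_zero_apply p).symm

theorem IsFlowOf.eq (hK : IsSmoothField K) (hφ : IsFlowOf φ K) (hφ' : IsFlowOf φ' K) (t : ℝ)
    (p : M) : φ' t p = φ t p := by
  have h1 : IsMIntegralCurve (I := 𝓡 n) (fun t : ℝ ↦ φ' t p) ((1 : ℝ) • K) := by
    rw [one_smul]; exact hφ'.isMIntegralCurve p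
  have := hφ.integralCurve_unique hK h1 (φ'.map_zero_apply p) t
  rwa [mul_one] at this

/-- Uniqueness of the flow removes the choice of flow in `oneParameterGroup`. By the group law the
relation is already an equivalence, so the quotient makes no further identifications. -/
theorem orbitProj_eq_iff (hK : IsSmoothField K) (hφ : IsFlowOf φ K)
    (hiso : ∀ t : ℝ, ∃ Φ : isometryGroup g, ∀ p, Φ.1 p = φ t p) {p q : M} :
    orbitProj g K p = orbitProj g K q ↔ ∃ t, φ t p = q := by
  have h1 : ∀ p q : M, (∃ Φ ∈ oneParameterGroup g K, Φ.1 p = q) ↔ ∃ t, φ t p = q := by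
    intro p q
    constructor
    · rintro ⟨Φ, ⟨φ', hφ', t, ht⟩, rfl⟩
      exact ⟨t, by rw [ht, hφ.eq hK hφ']⟩
    · rintro ⟨t, rfl⟩
      obtain ⟨Φ, hΦ⟩ := hiso t
      exact ⟨Φ, ⟨φ, hφ, t, hΦ⟩, hΦ p⟩
  have h2 : Equivalence fun p q : M ↦ ∃ Φ ∈ oneParameterGroup g K, Φ.1 p = q := by
    simp only [h1]
    refine ⟨fun p ↦ ⟨0, φ.map_zero_apply p⟩, ?_, ?_⟩
    · rintro p q ⟨t, rfl⟩
      exact ⟨-t, by rw [← φ.map_add, neg_add_cancel]; exact φ.map_zero_apply p⟩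
    · rintro p q r ⟨t, rfl⟩ ⟨s, rfl⟩
      exact ⟨s + t, φ.map_add _ _ _⟩
  rw [← h1, ← h2.eqvGen_iff]
  exact ⟨Quot.eqvGen_exact, Quot.eqvGen_sound⟩

/-- An isometry that scales the generator intertwines the flow with its rescaling. -/
theorem IsFlowOf.apply_flow (hK : IsSmoothField K) (hφ : IsFlowOf φ K) (Φ : isometryGroup g) {c : ℝ}
    (hc : ∀ p, mder Φ.1 p (fieldFun K p) = c • fieldFun K (Φ.1 p)) (t : ℝ) (p : M) :
    Φ.1 (φ t p) = φ (t * c) (Φ.1 p) := by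
  refine hφ.integralCurve_unique hK (γ := fun t ↦ Φ.1 (φ t p)) (c := c) ?_
    (congrArg Φ.1 (φ.map_zero_apply p)) t
  intro t
  have h0 : HasMFDerivAt (𝓡 n) (𝓡 n) (Φ.1 : M → M) (φ t p) (mder Φ.1 (φ t p)) :=
    ((contMDiff_isometry Φ).mdifferentiable (by simp) (φ t p)).hasMFDerivAt
  have h1 := HasMFDerivAt.comp (f := fun t : ℝ ↦ φ t p) t h0 (hφ.isMIntegralCurve p t)
  have h2 : (mder Φ.1 (φ t p)).comp
      (ContinuousLinearMap.smulRight (1 : ℝ →L[ℝ] ℝ) (fieldFun K (φ t p))) =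
      ContinuousLinearMap.smulRight (1 : ℝ →L[ℝ] ℝ) (c • fieldFun K (Φ.1 (φ t p))) := by
    ext : 1
    simp [hc]
  exact HasMFDerivAt.congr_mfderiv h1 h2

end Orbits

/-! ### Conjugating a flow by an isometry. -/

section Conjugation

variable {n : ℕ} {M : Type*} [TopologicalSpace M]
  [ChartedSpace (EuclideanSpace ℝ (Fin n)) M] [IsManifold (𝓡 n) ∞ M]
  {g : LorentzMetric n M} {φ : Flow ℝ M}

/-- The conjugate of a flow by a homeomorphism. -/
def conjFlow (φ : Flow ℝ M) (Φ : M ≃ₜ M) : Flow ℝ M where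
  toFun t p := Φ (φ t (Φ.symm p))
  cont' := by
    have h1 : Continuous fun x : ℝ × M ↦ φ x.1 (Φ.symm x.2) := by fun_prop
    exact Φ.continuous.comp h1
  map_add' s t p := by simp [φ.map_add]
  map_zero' p := by
    rw [show φ 0 (Φ.symm p) = Φ.symm p from φ.map_zero_apply _, Φ.apply_symm_apply]

theorem IsIsometricFlow.conjFlow (hφ : IsIsometricFlow g φ) (Φ : isometryGroup g) :
    IsIsometricFlow g (LorentzFibration.conjFlow φ Φ.1) where
  contMDiff := by
    have h1 : ContMDiff (𝓘(ℝ, ℝ).prod (𝓡 n)) (𝓡 n) ∞ fun x : ℝ × M ↦ Φ.1.symm x.2 :=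
      Φ.2.2.1.comp contMDiff_snd
    exact (contMDiff_isometry Φ).comp (hφ.contMDiff.comp (contMDiff_fst.prodMk h1))
  isometric t := by
    obtain ⟨Ψ, hΨ⟩ := hφ.isometric t
    refine ⟨Φ * Ψ * Φ⁻¹, ?_⟩
    funext p
    change Φ.1 (Ψ.1 (Φ.1.symm p)) = Φ.1 (φ t (Φ.1.symm p))
    rw [hΨ]

theorem IsIsometricFlow.vel_conjFlow (hφ : IsIsometricFlow g φ) (Φ : isometryGroup g) (p : M) :
    vel (n := n) (LorentzFibration.conjFlow φ Φ.1) (Φ.1 p) = mder Φ.1 p (vel φ p) := by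
  have h1 : ContMDiff 𝓘(ℝ, ℝ) (𝓡 n) ∞ fun t : ℝ ↦ φ t p :=
    hφ.contMDiff.comp (contMDiff_id.prodMk contMDiff_const)
  have h2 := ((contMDiff_isometry Φ).mdifferentiable (by simp) (φ 0 p)).hasMFDerivAt.comp (0 : ℝ)
    (h1.mdifferentiable (by simp) 0).hasMFDerivAt
  have h3 : (fun t : ℝ ↦ LorentzFibration.conjFlow φ Φ.1 t (Φ.1 p)) =
      (Φ.1 : M → M) ∘ fun t : ℝ ↦ φ t p := by
    funext t
    change Φ.1 (φ t (Φ.1.symm (Φ.1 p))) = _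
    rw [Φ.1.symm_apply_apply]
    rfl
  have h4 : vel (n := n) (LorentzFibration.conjFlow φ Φ.1) (Φ.1 p) = mder Φ.1 (φ 0 p) (vel φ p) := by
    rw [vel, h3, h2.mfderiv]
    rfl
  rw [h4, show φ 0 p = p from φ.map_zero_apply p]

end Conjugation

/-! ### Bounded jets at a minimum of the squared velocity. -/

section Stationary

variable {n : ℕ} {M : Type*} [TopologicalSpace M]
  [ChartedSpace (EuclideanSpace ℝ (Fin n)) M] [IsManifold (𝓡 n) ∞ M]
  {F : Type*} [NormedAddCommGroup F] [NormedSpace ℝ F]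
  {g : LorentzMetric n M} {φ : Flow ℝ M}

theorem continuousAt_chartForm (g : LorentzMetric n M) {q : M} {x : EuclideanSpace ℝ (Fin n)}
    (hx : x ∈ (extChartAt (𝓡 n) q).target) : ContinuousAt (chartForm g q) x :=
  ((isMetricOn_chartForm g q).contDiffOn.contDiffAt
    ((isMetricOn_chartForm g q).isOpen.mem_nhds hx)).continuousAt

/-- The squared length of the velocity of a flow. -/
def sqVel (g : LorentzMetric n M) (φ : Flow ℝ M) (p : M) : ℝ := g.bil p (vel φ p) (vel φ p)

theorem IsIsometricFlow.continuous_sqVel (hφ : IsIsometricFlow g φ) : Continuous (sqVel g φ) := by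
  rw [continuous_iff_continuousAt]
  intro q
  set f : EuclideanSpace ℝ (Fin n) → ℝ := fun x ↦
    chartForm g q x (generator (flowRep φ q) x) (generator (flowRep φ q) x) with hf
  have hx := mem_extChartAt_target (I := 𝓡 n) q
  have h1 : ContinuousAt f (extChartAt (𝓡 n) q q) := by
    have h2 := (hφ.contDiffAt_generator hx).continuousAt
    exact ((continuousAt_chartForm g hx).clm_apply h2).clm_apply h2
  refine (h1.comp (continuousAt_extChartAt (I := 𝓡 n) q)).congr ?_
  filter_upwards [extChartAt_source_mem_nhds (I := 𝓡 n) q] with p hp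
  have h3 := (extChartAt (𝓡 n) q).map_source hp
  simp only [hf, Function.comp, chartForm_apply]
  rw [hφ.chartD_generator h3, (extChartAt (𝓡 n) q).left_inv hp]
  rfl

/-- Near a point where the flow is timelike, the flipped metric controls the derivative of `e`. -/
theorem IsIsometricFlow.exists_fder_le_flip (hφ : IsIsometricFlow g φ) {e : M → F}
    (he : ContMDiff (𝓡 n) 𝓘(ℝ, F) ∞ e) {q : M} (hq : sqVel g φ q < 0) :
    ∃ C, ∀ᶠ p in 𝓝 q, ∀ w, ‖fder (n := n) e p w‖ ^ 2 ≤ C * g.flip p (vel φ p) w := by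
  set X := generator (flowRep (n := n) φ q) with hX
  set x₀ := extChartAt (𝓡 n) q q with hx₀
  have hx := mem_extChartAt_target (I := 𝓡 n) q
  set A : EuclideanSpace ℝ (Fin n) → EuclideanSpace ℝ (Fin n) → ℝ := fun x v ↦
    ‖fderiv ℝ (chartFun e q) x v‖ ^ 2 with hA
  set Q : EuclideanSpace ℝ (Fin n) → EuclideanSpace ℝ (Fin n) → ℝ := fun x v ↦
    chartForm g q x v v - 2 / chartForm g q x (X x) (X x) * chartForm g q x (X x) v ^ 2 with hQ
  have hQf : ∀ x ∈ (extChartAt (𝓡 n) q).target, ∀ v, Q x v =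
      g.flip ((extChartAt (𝓡 n) q).symm x) (vel φ ((extChartAt (𝓡 n) q).symm x))
        (chartD q x v) := by
    intro x hx v
    simp only [hQ, chartForm_apply, hX]
    rw [hφ.chartD_generator hx]
    rfl
  have hXX : chartForm g q x₀ (X x₀) (X x₀) ≠ 0 := by
    rw [chartForm_apply, hX, hφ.chartD_generator hx, hx₀, extChartAt_to_inv]
    exact hq.ne
  have hcomp : ∃ C, ∀ᶠ x in 𝓝 x₀, ∀ v, A x v ≤ C * Q x v := by
    have hGc : ∀ v : EuclideanSpace ℝ (Fin n), ContinuousAt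
        (fun z : EuclideanSpace ℝ (Fin n) × EuclideanSpace ℝ (Fin n) ↦ chartForm g q z.1)
        (x₀, v) := fun v ↦
      ContinuousAt.comp (f := Prod.fst) (continuousAt_chartForm g hx) continuousAt_fst
    have hXc : ∀ v : EuclideanSpace ℝ (Fin n), ContinuousAt
        (fun z : EuclideanSpace ℝ (Fin n) × EuclideanSpace ℝ (Fin n) ↦ X z.1)
        (x₀, v) := fun v ↦
      ContinuousAt.comp (g := X) (f := Prod.fst) (hφ.contDiffAt_generator hx).continuousAt
        continuousAt_fst
    have hDc : ∀ v : EuclideanSpace ℝ (Fin n), ContinuousAt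
        (fun z : EuclideanSpace ℝ (Fin n) × EuclideanSpace ℝ (Fin n) ↦
          fderiv ℝ (chartFun e q) z.1) (x₀, v) := fun v ↦
      ContinuousAt.comp (f := Prod.fst) ((continuousOn_fderiv_chartFun he q).continuousAt
        ((isOpen_extChartAt_target q).mem_nhds hx)) continuousAt_fst
    refine exists_eventually_le_mul (fun v ↦ ?_) (fun v ↦ ?_) (fun x c v ↦ ?_) (fun x c v ↦ ?_)
      fun v hv ↦ ?_
    · exact (((hDc v).clm_apply continuousAt_snd).norm).pow 2
    · exact (((hGc v).clm_apply continuousAt_snd).clm_apply continuousAt_snd).sub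
        ((continuousAt_const.div₀ (((hGc v).clm_apply (hXc v)).clm_apply (hXc v)) hXX).mul
          ((((hGc v).clm_apply (hXc v)).clm_apply continuousAt_snd).pow 2))
    · simp only [hA, map_smul, norm_smul, mul_pow, Real.norm_eq_abs, sq_abs]
    · simp only [hQ, map_smul, smul_apply, smul_eq_mul]
      ring
    · rw [hQf x₀ hx]
      refine g.flip_pos _ ?_ ?_
      · rw [hx₀, extChartAt_to_inv]
        exact hq
      · exact fun h0 ↦ hv ((isInvertible_chartD q hx).injective (h0.trans (map_zero _).symm))
  obtain ⟨C, hC⟩ := hcomp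
  refine ⟨C, ?_⟩
  filter_upwards [(continuousAt_extChartAt (I := 𝓡 n) q).eventually hC,
    extChartAt_source_mem_nhds (I := 𝓡 n) q] with p hp hps w
  have hpt := (extChartAt (𝓡 n) q).map_source hps
  obtain ⟨v, rfl⟩ := (isInvertible_chartD q hpt).surjective w
  have h1 := hp v
  rw [hQf _ hpt] at h1
  simp only [hA] at h1
  rw [fderiv_chartFun he hpt, (extChartAt (𝓡 n) q).left_inv hps] at h1
  exact h1

/-- On a compact set where the flow is timelike, the flipped metric controls the derivative
of `e`. -/
theorem IsIsometricFlow.exists_fder_le_flip_of_isCompact (hφ : IsIsometricFlow g φ) {e : M → F}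
    (he : ContMDiff (𝓡 n) 𝓘(ℝ, F) ∞ e) {S : Set M} (hS : IsCompact S)
    (hneg : ∀ p ∈ S, sqVel g φ p < 0) :
    ∃ C, ∀ p ∈ S, ∀ w, ‖fder (n := n) e p w‖ ^ 2 ≤ C * g.flip p (vel φ p) w := by
  -- The compactness induction runs over arbitrary sets, but enlarging the constant needs `flip` to
  -- be nonnegative, which is known only on `S`; hence the doubled membership.
  suffices h : ∃ C, ∀ p ∈ S, p ∈ S → ∀ w, ‖fder (n := n) e p w‖ ^ 2 ≤ C * g.flip p (vel φ p) w by
    obtain ⟨C, hC⟩ := h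
    exact ⟨C, fun p hp ↦ hC p hp hp⟩
  refine hS.induction_on (p := fun s ↦ ∃ C, ∀ p ∈ s, p ∈ S → ∀ w,
    ‖fder (n := n) e p w‖ ^ 2 ≤ C * g.flip p (vel φ p) w) ⟨0, by simp⟩ ?_ ?_ ?_
  · rintro s t hst ⟨C, hC⟩
    exact ⟨C, fun p hp ↦ hC p (hst hp)⟩
  · rintro s t ⟨C, hC⟩ ⟨D, hD⟩
    refine ⟨max C D, ?_⟩
    rintro p (hp | hp) hpS w
    · exact (hC p hp hpS w).trans
        (mul_le_mul_of_nonneg_right (le_max_left _ _) (g.flip_nonneg p (hneg p hpS) w))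
    · exact (hD p hp hpS w).trans
        (mul_le_mul_of_nonneg_right (le_max_right _ _) (g.flip_nonneg p (hneg p hpS) w))
  · intro q hq
    obtain ⟨C, hC⟩ := hφ.exists_fder_le_flip he (hneg q hq)
    exact ⟨{p | ∀ w, ‖fder (n := n) e p w‖ ^ 2 ≤ C * g.flip p (vel φ p) w},
      mem_nhdsWithin_of_mem_nhds hC, C, fun p hp _ ↦ hp⟩

/-- If an isometry scales the generator of a flow that is somewhere timelike, then it does so by
a factor `±1`. -/
theorem sq_eq_one_of_mder_vel {p₀ : M}
    (hmin : ∀ p, sqVel g φ p₀ ≤ sqVel g φ p) (hneg : sqVel g φ p₀ < 0) (Φ : isometryGroup g)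
    {c : ℝ} (hc : ∀ p, mder Φ.1 p (vel (n := n) φ p) = c • vel φ (Φ.1 p)) : c ^ 2 = 1 := by
  have h1 : ∀ p, sqVel g φ p = c ^ 2 * sqVel g φ (Φ.1 p) := by
    intro p
    rw [sqVel, ← bil_mder_isometry Φ p, hc]
    simp only [map_smul, smul_apply, smul_eq_mul, sqVel]
    ring
  -- As the minimum is negative, comparison at the image of `p₀` gives `1 ≤ c ^ 2`, and at its
  -- preimage `c ^ 2 ≤ 1`.
  have h2 := h1 p₀
  have h3 := h1 (Φ.1.symm p₀)
  rw [Φ.1.apply_symm_apply] at h3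
  have h4 := hmin (Φ.1 p₀)
  have h5 := hmin (Φ.1.symm p₀)
  have h6 := sq_nonneg c
  nlinarith

/-- The jets at a point where a somewhere timelike flow has minimal squared velocity are bounded
for a group of isometries that scale the generator. -/
theorem IsIsometricFlow.jetsBounded [CompactSpace M] (hφ : IsIsometricFlow g φ) {p₀ : M}
    (hmin : ∀ p, sqVel g φ p₀ ≤ sqVel g φ p) (hneg : sqVel g φ p₀ < 0)
    (G : Subgroup (isometryGroup g))
    (hG : ∀ Φ ∈ G, ∃ c : ℝ, ∀ p, mder Φ.1 p (vel (n := n) φ p) = c • vel φ (Φ.1 p)) {e : M → F}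
    (he : ContMDiff (𝓡 n) 𝓘(ℝ, F) ∞ e) : JetsBounded G e p₀ := by
  -- Since `c ^ 2 = 1`, every member of `G` maps `p₀` into this compact level set, where one
  -- constant compares the flipped metric with the derivative of `e`.
  set S := {p | sqVel g φ p = sqVel g φ p₀} with hS
  have hSc : IsCompact S := (isClosed_eq hφ.continuous_sqVel continuous_const).isCompact
  obtain ⟨C, hC⟩ := hφ.exists_fder_le_flip_of_isCompact he hSc fun p hp ↦ by
    rw [show sqVel g φ p = sqVel g φ p₀ from hp]; exact hneg
  obtain ⟨D, hD⟩ := g.flip_le p₀ (vel φ p₀)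
  refine ⟨√(|C| * |D|), fun Φ hΦ ↦ ?_⟩
  obtain ⟨c, hc⟩ := hG Φ hΦ
  have hc1 := sq_eq_one_of_mder_vel hmin hneg Φ hc
  have hc0 : c ≠ 0 := by rintro rfl; norm_num at hc1
  have hv : g.bil (Φ.1 p₀) (vel φ (Φ.1 p₀)) (vel φ (Φ.1 p₀)) = sqVel g φ p₀ := by
    rw [sqVel, ← bil_mder_isometry Φ p₀, hc]
    simp only [map_smul, smul_apply, smul_eq_mul]
    rw [← mul_assoc, ← pow_two, hc1, one_mul]
  -- The sign of `c` disappears because `flip` involves the vector only through squares.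
  have hflip : ∀ w, g.flip (Φ.1 p₀) (vel φ (Φ.1 p₀)) (mder Φ.1 p₀ w) =
      g.flip p₀ (vel φ p₀) w := by
    intro w
    have h1 : c * g.bil (Φ.1 p₀) (vel φ (Φ.1 p₀)) (mder Φ.1 p₀ w) = g.bil p₀ (vel φ p₀) w := by
      rw [← bil_mder_isometry Φ p₀ (vel φ p₀) w, hc]
      simp
    rw [LorentzMetric.flip, LorentzMetric.flip, bil_mder_isometry, hv, ← h1, mul_pow, hc1, one_mul]
    rfl
  refine ContinuousLinearMap.opNorm_le_bound _ (Real.sqrt_nonneg _) fun w ↦ ?_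
  have hcomp : fder (n := n) (e ∘ Φ.1) p₀ w = fder e (Φ.1 p₀) (mder Φ.1 p₀ w) := by
    have h1 := mfderiv_comp p₀ (he.mdifferentiable (by simp) (Φ.1 p₀))
      ((contMDiff_isometry Φ).mdifferentiable (by simp) p₀)
    exact DFunLike.congr_fun h1 w
  have h1 := hC (Φ.1 p₀) hv (mder Φ.1 p₀ w)
  rw [hflip, ← hcomp] at h1
  have h2 : g.flip p₀ (vel φ p₀) w ≤ |D| * ‖w‖ ^ 2 :=
    (hD w).trans (by gcongr; exact le_abs_self D)
  have h3 := g.flip_nonneg p₀ hneg w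
  refine (sq_le_sq₀ (norm_nonneg _) (by positivity)).1 ?_
  rw [mul_pow, Real.sq_sqrt (by positivity)]
  calc _ ≤ C * g.flip p₀ (vel φ p₀) w := h1
    _ ≤ |C| * (|D| * ‖w‖ ^ 2) := mul_le_mul (le_abs_self C) h2 h3 (abs_nonneg C)
    _ = _ := by ring

end Stationary

/-! ### The fibration-preserving group: closedness and compactness. -/

section Fibration

variable {n : ℕ} {M : Type*} [TopologicalSpace M]
  [ChartedSpace (EuclideanSpace ℝ (Fin n)) M] [IsManifold (𝓡 n) ∞ M]
  {g : LorentzMetric n M} {φ : Flow ℝ M}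

theorem continuous_isometryGroup_apply (p : M) :
    Continuous fun Φ : isometryGroup g ↦ (Φ.1 p : M) := by
  have h1 : Continuous fun Φ : isometryGroup g ↦ (⟨Φ.1, Φ.1.continuous⟩ : C(M, M)) :=
    continuous_induced_dom
  exact (continuous_eval_const (F := C(M, M)) p).comp h1

/-- The isometries that intertwine a flow with its rescaling form a closed set. -/
theorem isClosed_intertwining [T2Space M] (g : LorentzMetric n M) (φ : Flow ℝ M) (c : ℝ) :
    IsClosed {Φ : isometryGroup g | ∀ t p, Φ.1 (φ t p) = φ (t * c) (Φ.1 p)} := by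
  simp only [ofPred_forall]
  refine isClosed_iInter fun t ↦ isClosed_iInter fun p ↦ ?_
  have h1 : Continuous fun Φ : isometryGroup g ↦ φ (t * c) (Φ.1 p) :=
    (φ.continuous_toFun (t * c)).comp (continuous_isometryGroup_apply p)
  exact isClosed_eq (continuous_isometryGroup_apply _) h1

variable [T2Space M] {K : (p : M) → TangentSpace (𝓡 n) p}

theorem mem_fibrationIsometryGroup_of_intertwining (hK : IsSmoothField K) (hφ : IsFlowOf φ K)
    (hiso : ∀ t : ℝ, ∃ Φ : isometryGroup g, ∀ p, Φ.1 p = φ t p) {c : ℝ} (hc : c ≠ 0)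
    {Φ : isometryGroup g} (hΦ : ∀ t p, Φ.1 (φ t p) = φ (t * c) (Φ.1 p)) :
    Φ ∈ fibrationIsometryGroup g (orbitProj g K) := by
  intro p q
  rw [orbitProj_eq_iff hK hφ hiso, orbitProj_eq_iff hK hφ hiso]
  constructor
  · rintro ⟨t, ht⟩
    exact ⟨t / c, Φ.1.injective (by rw [hΦ, div_mul_cancel₀ _ hc, ht])⟩
  · rintro ⟨t, rfl⟩
    exact ⟨t * c, (hΦ t p).symm⟩

/-- The flow conjugated by `Φ` is isometric, has its orbits inside those of `φ`, and its velocity is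
the push-forward of that of `φ`; `exists_vel_eq_smul` compares the two. -/
theorem exists_mder_vel_eq_smul [ConnectedSpace M] (hK : IsSmoothField K) (hφ : IsFlowOf φ K)
    (hiso : ∀ t : ℝ, ∃ Φ : isometryGroup g, ∀ p, Φ.1 p = φ t p) (hne : ∀ p, K p ≠ 0)
    {Φ : isometryGroup g} (hΦ : Φ ∈ fibrationIsometryGroup g (orbitProj g K)) :
    ∃ c : ℝ, ∀ p, mder Φ.1 p (vel (n := n) φ p) = c • vel φ (Φ.1 p) := by
  have hφ' : IsIsometricFlow g φ := ⟨hφ.contMDiff, fun t ↦ by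
    obtain ⟨Ψ, hΨ⟩ := hiso t
    exact ⟨Ψ, funext hΨ⟩⟩
  obtain ⟨c, hc⟩ := exists_vel_eq_smul hφ' (hφ'.conjFlow Φ) (fun p ↦ by
    rw [hφ.vel_eq]; exact hne p) fun p t ↦ by
      have h1 : orbitProj g K (Φ.1.symm p) = orbitProj g K (φ t (Φ.1.symm p)) :=
        (orbitProj_eq_iff hK hφ hiso).2 ⟨t, rfl⟩
      have h2 := (orbitProj_eq_iff hK hφ hiso).1 ((hΦ _ _).2 h1)
      rw [Φ.1.apply_symm_apply] at h2
      obtain ⟨s, hs⟩ := h2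
      exact ⟨s, hs.symm⟩
  exact ⟨c, fun p ↦ by rw [← hφ'.vel_conjFlow, hc]⟩

/-- The fibration-preserving isometries form a compact group. -/
theorem isCompact_fibrationIsometryGroup [CompactSpace M] [ConnectedSpace M]
    (hK : IsKilling g K) (hne : ∀ p, K p ≠ 0) (htime : ∃ p, g.form p (K p) (K p) < 0) :
    IsCompact (fibrationIsometryGroup g (orbitProj g K) : Set (isometryGroup g)) := by
  obtain ⟨hKs, φ, hφ, hiso⟩ := hK
  have hφ' : IsIsometricFlow g φ := ⟨hφ.contMDiff, fun t ↦ by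
    obtain ⟨Ψ, hΨ⟩ := hiso t
    exact ⟨Ψ, funext hΨ⟩⟩
  obtain ⟨p₁, hp₁⟩ := htime
  obtain ⟨p₀, -, hp₀⟩ := isCompact_univ.exists_isMinOn ⟨p₁, mem_univ p₁⟩
    hφ'.continuous_sqVel.continuousOn
  have hmin : ∀ p, sqVel g φ p₀ ≤ sqVel g φ p := fun p ↦ hp₀ (mem_univ p)
  have hneg : sqVel g φ p₀ < 0 := (hmin p₁).trans_lt (by
    rw [sqVel, hφ.vel_eq]
    exact hp₁)
  have hscale : ∀ Φ ∈ fibrationIsometryGroup g (orbitProj g K), ∃ c : ℝ, ∀ p,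
      mder Φ.1 p (vel (n := n) φ p) = c • vel φ (Φ.1 p) := fun Φ hΦ ↦
    exists_mder_vel_eq_smul hKs hφ hiso hne hΦ
  have hclosed : IsClosed
      (fibrationIsometryGroup g (orbitProj g K) : Set (isometryGroup g)) := by
    -- Mapping orbits to orbits is not visibly a closed condition. Intertwining `φ` at a fixed speed
    -- is one, and only the speeds `1` and `-1` occur.
    have h1 : (fibrationIsometryGroup g (orbitProj g K) : Set (isometryGroup g)) =
        {Φ | ∀ t p, Φ.1 (φ t p) = φ (t * 1) (Φ.1 p)} ∪
          {Φ | ∀ t p, Φ.1 (φ t p) = φ (t * -1) (Φ.1 p)} := by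
      ext Φ
      constructor
      · intro hΦ
        obtain ⟨c, hc⟩ := hscale Φ hΦ
        have h2 : ∀ t p, Φ.1 (φ t p) = φ (t * c) (Φ.1 p) := hφ.apply_flow hKs Φ fun p ↦ by
          rw [← hφ.vel_eq, ← hφ.vel_eq, hc]
        rcases sq_eq_one_iff.1 (sq_eq_one_of_mder_vel hmin hneg Φ hc) with rfl | rfl
        · exact Or.inl h2
        · exact Or.inr h2
      · rintro (hΦ | hΦ)
        · exact mem_fibrationIsometryGroup_of_intertwining hKs hφ hiso one_ne_zero hΦ
        · exact mem_fibrationIsometryGroup_of_intertwining hKs hφ hiso (by norm_num) hΦ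
    rw [h1]
    exact (isClosed_intertwining g φ 1).union (isClosed_intertwining g φ (-1))
  -- The Whitney embedding serves twice: it measures the jets, and it induces a metric on `M`
  -- compatible with its topology.
  obtain ⟨N, e, he, hemb, hinj⟩ := exists_embedding_euclidean_of_compact (I := 𝓡 n) (M := M)
  have hjets : JetsBounded (fibrationIsometryGroup g (orbitProj g K)) e p₀ :=
    hφ'.jetsBounded hmin hneg _ hscale he
  let _ : MetricSpace M := hemb.isEmbedding.comapMetricSpace e
  exact isCompact_of_jetsBounded _ hclosed he hinj (fun p q ↦ rfl) hjets

end Fibration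

end LorentzFibration

end

theorem mainTheorem7 {n : ℕ} (hn : 2 ≤ n) {M : Type*} [TopologicalSpace M]
    [ChartedSpace (EuclideanSpace ℝ (Fin n)) M] [IsManifold (𝓡 n) ∞ M]
    [T2Space M] [CompactSpace M] [ConnectedSpace M]
    (g : LorentzFibration.LorentzMetric n M)
    (K : (p : M) → TangentSpace (𝓡 n) p)
    (hK : LorentzFibration.IsClosedKilling g K)
    (hK_ne : ∀ p : M, K p ≠ 0)
    (hK_timelike : ∃ p : M, g.form p (K p) (K p) < 0) :
    IsCompact
      (LorentzFibration.fibrationIsometryGroup g (LorentzFibration.orbitProj g K) :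
        Set (LorentzFibration.isometryGroup g)) := by
  exact LorentzFibration.isCompact_fibrationIsometryGroup hK.1 hK_ne hK_timelike
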